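/- **Setting.** Let $r_\infty\ge 1$, $n\ge 0$, $r_1,\dots,r_n\ge 1$ be integers with $g:=r_\infty-3+\sum_s r_s\ge 0$. Let $U$ be an open subset of a complex normed space (the space of deformation parameters) and $\mathcal L_\alpha$ the derivation along a vector field on $U$. Let $X_1,\dots,X_n$, $\omega$, $t_{\infty,k}$ ($0\le k\le r_\infty-1$), $t_{X_s,k}$ ($0\le k\le r_s-1$) be holomorphic functions on $U$; put $\alpha_{p,k}:=\mathcal L_\alpha[t_{p,k}]$ for $k\ge 1$ and $\alpha_{X_s}:=\mathcal L_\alpha[X_s]$, and let $t_{p,0}$ be constant. Let $$\tilde L(\lambda)=\sum_{k=1}^{r_\infty-1}\tilde L^{[\infty,k]}\lambda^{k-1}+\sum_{s=1}^n\sum_{k=0}^{r_s-1}\frac{\tilde L^{[X_s,k]}}{(\lambda-X_s)^{k+1}},\qquad \tilde A_\alpha(\lambda)=\sum_{k=0}^{r_\infty-1}A^{[\infty,k]}\lambda^k+\sum_{s=1}^n\sum_{k=1}^{r_s}\frac{A^{[X_s,k]}}{(\lambda-X_s)^k}$$ be families of $2\times 2$ matrices on $U$, with $\tilde L$ holomorphic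 and trace-free, such that the following hold at every point of $U$. * *(Normalization at infinity.)* The $X_s$ are distinct, $\omega\ne0$, and the leading coefficient at each pole ($\tilde L^{[X_s,r_s-1]}$; $\tilde L^{[\infty,r_\infty-1]}$ if $r_\infty\ge2$, $\sum_s\tilde L^{[X_s,0]}$ if $r_\infty=1$) has distinct eigenvalues. If $r_\infty\ge2$, $\tilde L^{[\infty,r_\infty-1]}=\mathrm{diag}(-t_{\infty,r_\infty-1},t_{\infty,r_\infty-1})$; if $r_\infty=1$, $\sum_s\tilde L^{[X_s,0]}=\mathrm{diag}(-t_{\infty,0},t_{\infty,0})$. The upper right entry of $\tilde L^{[\infty,r_\infty-2]}$ if $r_\infty\ge 3$, of $\sum_s\tilde L^{[X_s,0]}$ if $r_\infty=2$, of $\sum_s(\tilde L^{[X_s,1]}\delta_{r_s\ge2}+X_s\tilde L^{[X_s,0]})$ if $r_\infty=1$, is $\omega$. * *(Trivial times.)* $t_{\infty,r_\infty-1}=1$, $t_{\infty,r_\infty-2}=0$ if $r_\infty\ge3$; $t_{\infty,1}=1$, $X_1=0$ if $r_\infty=2$; $X_1=0$, $X_2=1$ if $r_\infty=1$, $n\ge2$;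 $X_1=0$, $t_{X_1,r_1-1}=1$ if $r_\infty=n=1$. * *(Isomonodromy.)* $\mathcal L_\alpha[\tilde L]-\partial_\lambda\tilde A_\alpha+[\tilde L,\tilde A_\alpha]=0$, and at every pole $p$, with local coordinate $z=\lambda-X_s$ or $z=1/\lambda$, the systems $\partial_\lambda\Psi=\tilde L\Psi$ and $\mathcal L_\alpha\Psi=\tilde A_\alpha\Psi$ have a common formal fundamental solution $\Psi=F_p(z)\,\mathrm{diag}(e^{T_p},e^{-T_p})$, where $T_p=-\sum_{k=1}^{r_p-1}\frac{t_{p,k}}{k z^{k}}+t_{p,0}\ln z$ and $F_p$ is a matrix of formal power series in $z$ with holomorphic coefficients on $U$ and $\det F_p=1$. **Coordinates.** Fix a point of $U$. Write $$\tilde L_{1,2}=\frac{\omega\prod_{j=1}^g(\lambda-q_j)}{\prod_{s}(\lambda-X_s)^{r_s}},$$ and assume that the $q_j$ are distinct and different from the $X_s$; put $p_i:=\tilde L_{1,1}(q_i)$. Let $Q_{X_s,k}$ (for $k\ge 1$) be the coefficient of $(\lambda-X_s)^{-k}$ in the expansion at $X_s$ of this rational function (so $Q_{X_s,k}=0$ for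 $k>r_s$), and $Q_{\infty,k}$ ($0\le k\le r_\infty-4$) the coefficient of $\lambda^k$ in its expansion at $\infty$, both seen as functions of $(q_1,\dots,q_g)$. Let $P_{X_s,k}$ ($1\le k\le r_s$), $P_{\infty,k}$ ($0\le k\le r_\infty-4$) satisfy $$p_i=\sum_{k=0}^{r_\infty-4}P_{\infty,k}\frac{\partial Q_{\infty,k}}{\partial q_i}+\sum_{s}\sum_{k=1}^{r_s}P_{X_s,k}\frac{\partial Q_{X_s,k}}{\partial q_i},$$ together with $\sum_s\sum_{m=1}^{r_s}P_{X_s,m}Q_{X_s,m}=0$ if $r_\infty\le2$, and $\sum_s\sum_{m=1}^{r_s-1}P_{X_s,m}Q_{X_s,m+1}+\sum_s\sum_{m=1}^{r_s}X_sP_{X_s,m}Q_{X_s,m}=0$ if $r_\infty=1$. Put $$g_0=\begin{cases}t_{\infty,r_\infty-2}+t_{\infty,r_\infty-1}\big(\sum_jq_j-\sum_sr_sX_s\big)&r_\infty\ge2,\\[2pt] t_{\infty,0}\big(\sum_jq_j-\sum_sr_sX_s\big)-\sum_s\big[X_s\tilde L^{[X_s,0]}+\tilde L^{[X_s,1]}\delta_{r_s\ge2}\big]_{1,1}&r_\infty=1,\end{cases}$$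 and, with $Q_{\infty,-1}:=\sum_sQ_{X_s,1}$, for $1\le k\le r_s$ resp. $0\le k\le r_\infty-4$, $$R_{X_s,k}=\sum_{m=1}^{r_s+1-k}P_{X_s,m}Q_{X_s,k+m-1}-\frac{g_0+t_{\infty,r_\infty-1}X_s}{\omega}Q_{X_s,k}-\frac{t_{\infty,r_\infty-1}}{\omega}Q_{X_s,k+1}\delta_{k\le r_s-1},$$ $$R_{\infty,k}=-\omega P_{\infty,r_\infty-4-k}-\sum_{m=0}^{r_\infty-5-k}P_{\infty,m}Q_{\infty,k+1+m}-\frac{t_{\infty,r_\infty-1}}{\omega}Q_{\infty,k-1}-\frac{g_0}{\omega}Q_{\infty,k}.$$ Let $G=\begin{pmatrix}1&0\\ \tilde L_{1,1}&\tilde L_{1,2}\end{pmatrix}$ and define $\nu_{X_s,k}$ and $\nu_{\infty,k}$ as the coefficients of $(\lambda-X_s)^k$ at $X_s$, resp. of $\lambda^{-k}$ at $\infty$, in the expansions of the entry $(1,2)$ of $G\tilde A_\alpha G^{-1}+\mathcal L_\alpha[G]G^{-1}$. Finally let $[f]_{X_s,-}$ be the singular part of $f$ at $X_s$, $[f]_{\infty,+}$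 its polynomial part at infinity (with the constant term), $\mathrm{Res}_\infty f$ minus the coefficient of $\lambda^{-1}$ at infinity, $$c_{X_s,j}=\sum_{m=0}^{2r_s-j}t_{X_s,r_s-1-m}\,t_{X_s,j+m-r_s-1},\qquad c_{\infty,j}=\sum_{m=0}^{2r_\infty-4-j}t_{\infty,r_\infty-1-m}\,t_{\infty,j+m-r_\infty+3},$$ $$\mathcal S=\sum_s\big(X_s^2Q_{X_s,1}+2X_sQ_{X_s,2}+Q_{X_s,3}\big),\qquad W=\frac{\tilde L_{1,1}}{\tilde L_{1,2}}\Big(\frac{\tilde L_{1,1}}{\tilde L_{1,2}}[\tilde A_\alpha]_{1,2}-2[\tilde A_\alpha]_{1,1}\Big).$$ **Theorem 4.3.** At the chosen point, the following hold, where empty sums are zero and in 3. and 7. the entries $(1,1)$ and $(1,2)$ stand for the expressions given in 1., 2., 5. and 6. 1. $\displaystyle\tilde L_{1,1}=-\tilde L_{2,2}=\sum_s\sum_{k=1}^{r_s}\frac{R_{X_s,k}}{(\lambda-X_s)^k}-t_{\infty,r_\infty-1}\delta_{r_\infty\ge2}\lambda^{r_\infty-2}-t_{\infty,r_\infty-2}\delta_{r_\infty\ge3}\lambda^{r_\infty-3}+\sum_{k=0}^{r_\infty-4}R_{\infty,k}\lambda^k.$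 2. $\displaystyle\tilde L_{1,2}=\sum_s\sum_{k=1}^{r_s}\frac{Q_{X_s,k}}{(\lambda-X_s)^k}+\sum_{k=0}^{r_\infty-4}Q_{\infty,k}\lambda^k+\omega\,\delta_{r_\infty\ge3}\lambda^{r_\infty-3}.$ 3. $\displaystyle\tilde L_{2,1}=\delta_{r_\infty\ge3}\left[\frac{\sum_{j=r_\infty-3}^{2r_\infty-4}c_{\infty,j}\lambda^j-\tilde L_{1,1}^2}{\tilde L_{1,2}}\right]_{\infty,+}+\sum_s\left[\frac{\sum_{j=r_s+1}^{2r_s}c_{X_s,j}(\lambda-X_s)^{-j}-\tilde L_{1,1}^2}{\tilde L_{1,2}}\right]_{X_s,-}.$ 4. If $r_\infty=1$: $\displaystyle g_0=-\sum_s\big(X_sR_{X_s,1}+R_{X_s,2}\delta_{r_s\ge2}\big)-\frac{t_{\infty,0}}{\omega}\,\mathcal S.$ 5. $\displaystyle[\tilde A_\alpha]_{1,2}=\omega\nu_{\infty,1}\lambda^{r_\infty-4}\delta_{r_\infty\ge4}+\sum_{j=0}^{r_\infty-5}\Big(\omega\nu_{\infty,r_\infty-3-j}+\sum_{k=j+1}^{r_\infty-4}\nu_{\infty,k-j}Q_{\infty,k}\Big)\lambda^j+\sum_s\sum_{j=1}^{r_s}\frac{\sum_{k=j}^{r_s}\nu_{X_s,k-j}Q_{X_s,k}}{(\lambda-X_s)^{j}}.$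 6. $\displaystyle[\tilde A_\alpha]_{1,1}=-[\tilde A_\alpha]_{2,2}=\frac{\mathcal L_\alpha[\omega]}{2\omega}-t_{\infty,1}\nu_{\infty,0}\delta_{r_\infty,2}+\Big(\frac12-t_{\infty,0}\Big)\nu_{\infty,-1}\delta_{r_\infty,1}-t_{\infty,r_\infty-1}\sum_{j=0}^{r_\infty-3}\nu_{\infty,r_\infty-2-j}\lambda^j-t_{\infty,r_\infty-2}\sum_{j=0}^{r_\infty-4}\nu_{\infty,r_\infty-3-j}\lambda^j$ $\displaystyle\qquad+\sum_{j=0}^{r_\infty-5}\Big(\sum_{i=1}^{r_\infty-4-j}\nu_{\infty,i}R_{\infty,j+i}\Big)\lambda^j+\sum_s\sum_{j=1}^{r_s}\frac{\sum_{i=0}^{r_s-j}\nu_{X_s,i}R_{X_s,i+j}}{(\lambda-X_s)^{j}}.$ 7. $[\tilde A_\alpha]_{2,1}=E_\infty+E_{\rm fin}$, where $$E_{\rm fin}=\sum_s\left[\frac{\sum_{k=r_s+1}^{2r_s}\big(\sum_{j=k}^{2r_s}c_{X_s,j}\nu_{X_s,j-k}\big)(\lambda-X_s)^{-k}}{\tilde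 L_{1,2}}\right]_{X_s,-}+\sum_s\big[W\big]_{X_s,-},$$ $E_\infty=0$ if $r_\infty\le2$, and if $r_\infty\ge3$ $$E_\infty=-\frac{t_{\infty,r_\infty-1}}{\omega^2}\mathcal L_\alpha[\omega]\lambda+\frac2\omega\,\mathrm{Res}_\infty\Big([\tilde A_\alpha]_{1,1}-\frac{\tilde L_{1,1}}{\tilde L_{1,2}}[\tilde A_\alpha]_{1,2}\Big)+\frac{Q_{\infty,r_\infty-4}}{\omega^3}\mathcal L_\alpha[\omega]+\left[\frac{\sum_{k=r_\infty-3}^{2r_\infty-5}\big(\sum_{j=k+1}^{2r_\infty-4}c_{\infty,j}\nu_{\infty,j-k}\big)\lambda^k}{\tilde L_{1,2}}\right]_{\infty,+}+\big[W\big]_{\infty,+}$$ (recall $Q_{\infty,-1}=\sum_sQ_{X_s,1}$, used when $r_\infty=3$). 8. The coefficients $\nu$ satisfy $\nu_{X_s,0}=-\alpha_{X_s}$ and the lower triangular Toeplitz systems $$\sum_{j=0}^{i}t_{X_s,r_s-1-(i-j)}\,\nu_{X_s,j+1}=-\frac{\alpha_{X_s,r_s-1-i}}{r_s-1-i}\quad(0\le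 i\le r_s-2),\qquad \sum_{j=0}^{i}t_{\infty,r_\infty-1-(i-j)}\,\nu_{\infty,j+1}=\frac{\alpha_{\infty,r_\infty-3-i}}{r_\infty-3-i}\quad(0\le i\le r_\infty-4).$$ 9. If $r_\infty=2$: $\sum_s\sum_{k=1}^{r_s}\nu_{X_s,k-1}Q_{X_s,k}=\omega\nu_{\infty,0}$. If $r_\infty=1$: $\omega\nu_{\infty,-1}=\sum_s\sum_{k=1}^{r_s}\nu_{X_s,k-1}Q_{X_s,k}$ and $$\mathcal S\,\nu_{\infty,-1}+\omega\nu_{\infty,0}=\sum_s\Big(\sum_{k=2}^{r_s}\nu_{X_s,k-2}Q_{X_s,k}+X_s\sum_{k=1}^{r_s}\nu_{X_s,k-1}Q_{X_s,k}\Big).$$ 10. If $r_\infty\ge3$: $$\omega\nu_{\infty,r_\infty-2}=\sum_s\sum_{k=1}^{r_s}\nu_{X_s,k-1}Q_{X_s,k}-\sum_{j=1}^{r_\infty-3}\nu_{\infty,j}Q_{\infty,j-1},$$ $$\omega\nu_{\infty,r_\infty-1}=\sum_s\sum_{k=2}^{r_s}\nu_{X_s,k-2}Q_{X_s,k}+\sum_s\sum_{k=1}^{r_s}\nu_{X_s,k-1}X_sQ_{X_s,k}-\sum_{j=2}^{r_\infty-2}\nu_{\infty,j}Q_{\infty,j-2}-\nu_{\infty,1}\sum_sQ_{X_s,1}.$$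 -/

import Mathlib

open scoped LaurentSeries PowerSeries

noncomputable section

namespace GeoLax

/-! ### Laurent expansions of rational functions of `lam` -/

/-- Expansion of a rational function at `0`. -/
def expZero : RatFunc ℂ →+* ℂ⸨X⸩ :=
  letI := RatFunc.liftAlgebra ℂ ℂ⸨X⸩
  algebraMap (RatFunc ℂ) ℂ⸨X⸩

/-- Expansion of a rational function at the finite point `a`, in the local coordinate
`z = lam - a`. -/
def expAt (a : ℂ) : RatFunc ℂ →+* ℂ⸨X⸩ :=
  expZero.comp (RatFunc.laurent a : RatFunc ℂ →ₐ[ℂ] RatFunc ℂ).toRingHom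

theorem transcendental_inv_X : Transcendental ℂ ((RatFunc.X : RatFunc ℂ)⁻¹) := by
  intro h
  exact RatFunc.transcendental_X (IsAlgebraic.inv_iff.mp h)

theorem aeval_inv_X_injective :
    Function.Injective (Polynomial.aeval (R := ℂ) ((RatFunc.X : RatFunc ℂ)⁻¹)) :=
  transcendental_iff_injective.mp transcendental_inv_X

/-- The substitution `lam ↦ 1 / lam` in rational functions. -/
def invSubst : RatFunc ℂ →ₐ[ℂ] RatFunc ℂ :=
  RatFunc.liftAlgHom (Polynomial.aeval (R := ℂ) ((RatFunc.X : RatFunc ℂ)⁻¹))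
    (nonZeroDivisors_le_comap_nonZeroDivisors_of_injective _ aeval_inv_X_injective)

/-- Expansion of a rational function at infinity, in the local coordinate `z = 1 / lam`. -/
def expInf : RatFunc ℂ →+* ℂ⸨X⸩ :=
  expZero.comp invSubst.toRingHom

/-- `[f]_{a,-}`: the singular part of `f` at the finite point `a`. -/
def singAt (a : ℂ) (f : RatFunc ℂ) : RatFunc ℂ :=
  ∑ k ∈ Finset.Icc 1 (-(expAt a f).order).toNat,
    RatFunc.C ((expAt a f).coeff (-(k : ℤ))) / (RatFunc.X - RatFunc.C a) ^ k

/-- `[f]_{∞,+}`: the polynomial part of `f` at infinity, constant term included. -/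
def polyInf (f : RatFunc ℂ) : RatFunc ℂ :=
  ∑ k ∈ Finset.range ((-(expInf f).order).toNat + 1),
    RatFunc.C ((expInf f).coeff (-(k : ℤ))) * RatFunc.X ^ k

/-- The residue of `f(lam) d lam` at infinity: minus the coefficient of `1 / lam`. -/
def resInf (f : RatFunc ℂ) : ℂ := -(expInf f).coeff 1

/-- Value of a rational function at the number `c`. -/
def evalAt (c : ℂ) (f : RatFunc ℂ) : ℂ := RatFunc.eval (RingHom.id ℂ) c f

/-! ### Families of connections normalized at infinity and their deformations -/

/-- Derivative of a function on the space of deformation parameters along the vector field `v`. -/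
def dirDeriv {E : Type*} [NormedAddCommGroup E] [NormedSpace ℂ E]
    (v : E → E) (f : E → ℂ) (b : E) : ℂ :=
  fderiv ℂ f b (v b)

/-- Data of a pair of matrices `L(lam; b)`, `A(lam; b)`, rational in `lam`, depending on a
deformation parameter `b : E`; the poles are infinity (order `rinf`) and `n` finite points (orders
`r s`). Values of the fields at indices outside the ranges indicated play no role. -/
structure LaxFamily (n rinf : ℕ) (r : Fin n → ℕ) (E : Type*) where
  /-- the finite poles `X_s` -/
  pos : Fin n → E → ℂ
  /-- `t_{∞,k}`, `0 ≤ k ≤ rinf - 1`: monodromy (`k = 0`) and irregular times (`1 ≤ k`) -/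
  tInf : ℕ → E → ℂ
  /-- `t_{X_s,k}`, `0 ≤ k ≤ r s - 1`: monodromy (`k = 0`) and irregular times (`1 ≤ k`) -/
  tX : Fin n → ℕ → E → ℂ
  /-- the upper right entry fixed by the normalization at infinity -/
  om : E → ℂ
  /-- coefficient of `lam ^ (k - 1)` in `L`, `1 ≤ k ≤ rinf - 1` -/
  LInf : ℕ → E → Matrix (Fin 2) (Fin 2) ℂ
  /-- coefficient of `(lam - X_s) ^ (-(k + 1))` in `L`, `0 ≤ k ≤ r s - 1` -/
  LX : Fin n → ℕ → E → Matrix (Fin 2) (Fin 2) ℂ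
  /-- coefficient of `lam ^ k` in `A`, `0 ≤ k ≤ rinf - 1` -/
  AInf : ℕ → E → Matrix (Fin 2) (Fin 2) ℂ
  /-- coefficient of `(lam - X_s) ^ (-k)` in `A`, `1 ≤ k ≤ r s` -/
  AX : Fin n → ℕ → E → Matrix (Fin 2) (Fin 2) ℂ

namespace LaxFamily

variable {n rinf : ℕ} {r : Fin n → ℕ} {E : Type*} (D : LaxFamily n rinf r E)

/-- The rational function `lam - X_s`. -/
def lin (b : E) (s : Fin n) : RatFunc ℂ := RatFunc.X - RatFunc.C (D.pos s b)

/-- The Lax matrix, an `sl_2` connection with poles of order at most `rinf` at infinity (as a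
differential form) and `r s` at `X_s`. -/
def laxL (b : E) : Matrix (Fin 2) (Fin 2) (RatFunc ℂ) :=
  ∑ k ∈ Finset.Icc 1 (rinf - 1),
      (D.LInf k b).map (fun c => RatFunc.C c * RatFunc.X ^ (k - 1)) +
    ∑ s, ∑ k ∈ Finset.range (r s),
      (D.LX s k b).map (fun c => RatFunc.C c / D.lin b s ^ (k + 1))

/-- The auxiliary matrix; its pole structure is dominated by the one of the Lax matrix. -/
def laxA (b : E) : Matrix (Fin 2) (Fin 2) (RatFunc ℂ) :=
  ∑ k ∈ Finset.range rinf, (D.AInf k b).map (fun c => RatFunc.C c * RatFunc.X ^ k) +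
    ∑ s, ∑ k ∈ Finset.Icc 1 (r s), (D.AX s k b).map (fun c => RatFunc.C c / D.lin b s ^ k)

/-- `L(·; b)` is the representative normalized at infinity, with leading coefficients at each pole
having distinct eigenvalues. -/
structure IsNormalized (b : E) : Prop where
  pos_injective : Function.Injective (fun s => D.pos s b)
  om_ne_zero : D.om b ≠ 0
  trace_LInf : ∀ k ∈ Finset.Icc 1 (rinf - 1), (D.LInf k b).trace = 0
  trace_LX : ∀ s, ∀ k ∈ Finset.range (r s), (D.LX s k b).trace = 0
  eig_X : ∀ s, (D.LX s (r s - 1) b).charpoly.roots.Nodup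
  eig_inf : 2 ≤ rinf → (D.LInf (rinf - 1) b).charpoly.roots.Nodup
  eig_inf_one : rinf = 1 → (∑ s, D.LX s 0 b).charpoly.roots.Nodup
  lead_ge_two : 2 ≤ rinf →
    D.LInf (rinf - 1) b = Matrix.diagonal ![-D.tInf (rinf - 1) b, D.tInf (rinf - 1) b]
  sub_ge_three : 3 ≤ rinf → D.LInf (rinf - 2) b 0 1 = D.om b
  sub_two : rinf = 2 → (∑ s, D.LX s 0 b) 0 1 = D.om b
  lead_one : rinf = 1 → ∑ s, D.LX s 0 b = Matrix.diagonal ![-D.tInf 0 b, D.tInf 0 b]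
  sub_one : rinf = 1 →
    (∑ s, ((if 2 ≤ r s then D.LX s 1 b else 0) + D.pos s b • D.LX s 0 b)) 0 1 = D.om b

/-- The choice of values of the trivial times. The first and second finite poles are those with
index `0` and `1`. -/
structure TrivialTimesFixed (b : E) : Prop where
  ge_three : 3 ≤ rinf → D.tInf (rinf - 1) b = 1 ∧ D.tInf (rinf - 2) b = 0
  two : rinf = 2 → D.tInf 1 b = 1 ∧ ∀ s : Fin n, (s : ℕ) = 0 → D.pos s b = 0
  one_of_two_le : rinf = 1 → 2 ≤ n →
    (∀ s : Fin n, (s : ℕ) = 0 → D.pos s b = 0) ∧ (∀ s : Fin n, (s : ℕ) = 1 → D.pos s b = 1)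
  one_of_one : rinf = 1 → n = 1 → ∀ s : Fin n, D.pos s b = 0 ∧ D.tX s (r s - 1) b = 1

variable [NormedAddCommGroup E] [NormedSpace ℂ E]

/-- The components `α_{∞,k}`, `α_{X_s,k}`, `α_{X_s}` of the deformation: the derivation along `v` is
`∑ α_{∞,k} ∂/∂t_{∞,k} + ∑ α_{X_s,k} ∂/∂t_{X_s,k} + ∑ α_{X_s} ∂/∂X_s`. -/
def alphaInf (v : E → E) (b : E) (k : ℕ) : ℂ := dirDeriv v (D.tInf k) b

/-- The component `α_{X_s,k}`. -/
def alphaX (v : E → E) (b : E) (s : Fin n) (k : ℕ) : ℂ := dirDeriv v (D.tX s k) b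

/-- The component `α_{X_s}`. -/
def alphaPos (v : E → E) (b : E) (s : Fin n) : ℂ := dirDeriv v (D.pos s) b

/-- Matrix of power series seen as a matrix of Laurent series. -/
def toLaurent (F : Matrix (Fin 2) (Fin 2) ℂ⟦X⟧) : Matrix (Fin 2) (Fin 2) ℂ⸨X⸩ :=
  F.map (HahnSeries.ofPowerSeries ℤ ℂ)

/-- Entrywise `d/dz`. -/
def dz (F : Matrix (Fin 2) (Fin 2) ℂ⟦X⟧) : Matrix (Fin 2) (Fin 2) ℂ⸨X⸩ :=
  (toLaurent F).map (LaurentSeries.derivative ℂ)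

/-- Derivation along `v` of the coefficients of a family of matrices of power series. -/
def coeffDeriv (v : E → E) (F : E → Matrix (Fin 2) (Fin 2) ℂ⟦X⟧) (b : E) :
    Matrix (Fin 2) (Fin 2) ℂ⸨X⸩ :=
  toLaurent (Matrix.of fun i j =>
    PowerSeries.mk fun k => dirDeriv v (fun c => PowerSeries.coeff k (F c i j)) b)

/-- With `z = lam - X_s` and `T = -∑_{1 ≤ k < r s} t_{X_s,k} / (k z ^ k) + t_{X_s,0} ln z`, this is
`∂T/∂lam`. -/
def irrX (b : E) (s : Fin n) : ℂ⸨X⸩ :=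
  ∑ k ∈ Finset.range (r s), HahnSeries.single (-((k : ℤ) + 1)) (D.tX s k b)

/-- The derivative of the same `T` along `v` at fixed `lam`; since `X_s` varies,
`z` has derivative `-α_{X_s}`. -/
def irrXDeriv (v : E → E) (b : E) (s : Fin n) : ℂ⸨X⸩ :=
  -∑ k ∈ Finset.Icc 1 (r s - 1),
      HahnSeries.single (-(k : ℤ)) (D.alphaX v b s k / (k : ℂ)) -
    D.alphaPos v b s • D.irrX b s

/-- With `z = 1 / lam` and `T = -∑_{1 ≤ k < rinf} t_{∞,k} / (k z ^ k) + t_{∞,0} ln z`, this is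
`∂T/∂lam`. -/
def irrInf (b : E) : ℂ⸨X⸩ :=
  -∑ k ∈ Finset.range rinf, HahnSeries.single (1 - (k : ℤ)) (D.tInf k b)

/-- The derivative of the same `T` along `v`. -/
def irrInfDeriv (v : E → E) (b : E) : ℂ⸨X⸩ :=
  -∑ k ∈ Finset.Icc 1 (rinf - 1),
      HahnSeries.single (-(k : ℤ)) (D.alphaInf v b k / (k : ℂ))

/-- `F(z) diag(exp T, exp (-T))` is, at the pole `X_s`, a formal fundamental solution of determinant
one of both `∂Ψ/∂lam = L Ψ` and `𝓛_α Ψ = A Ψ`; `F` is a power series in `z = lam - X_s`. -/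
structure IsFormalSolutionX (U : Set E) (v : E → E) (s : Fin n)
    (F : E → Matrix (Fin 2) (Fin 2) ℂ⟦X⟧) : Prop where
  coeff_differentiable : ∀ i j k,
    DifferentiableOn ℂ (fun b => PowerSeries.coeff k (F b i j)) U
  det_eq_one : ∀ b ∈ U, (F b).det = 1
  lam_eq : ∀ b ∈ U,
    dz (F b) + toLaurent (F b) * Matrix.diagonal ![D.irrX b s, -D.irrX b s] =
      (D.laxL b).map (expAt (D.pos s b)) * toLaurent (F b)
  deform_eq : ∀ b ∈ U,
    coeffDeriv v F b - D.alphaPos v b s • dz (F b) +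
        toLaurent (F b) * Matrix.diagonal ![D.irrXDeriv v b s, -D.irrXDeriv v b s] =
      (D.laxA b).map (expAt (D.pos s b)) * toLaurent (F b)

/-- The analogue at infinity, with `z = 1 / lam`, so that `∂/∂lam = -z ^ 2 d/dz`. -/
structure IsFormalSolutionInf (U : Set E) (v : E → E)
    (F : E → Matrix (Fin 2) (Fin 2) ℂ⟦X⟧) : Prop where
  coeff_differentiable : ∀ i j k,
    DifferentiableOn ℂ (fun b => PowerSeries.coeff k (F b i j)) U
  det_eq_one : ∀ b ∈ U, (F b).det = 1
  lam_eq : ∀ b ∈ U,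
    -((HahnSeries.single 2 1 : ℂ⸨X⸩) • dz (F b)) +
        toLaurent (F b) * Matrix.diagonal ![D.irrInf b, -D.irrInf b] =
      (D.laxL b).map expInf * toLaurent (F b)
  deform_eq : ∀ b ∈ U,
    coeffDeriv v F b +
        toLaurent (F b) * Matrix.diagonal ![D.irrInfDeriv v b, -D.irrInfDeriv v b] =
      (D.laxA b).map expInf * toLaurent (F b)

/-- Isomonodromic deformation along the vector field `v` over the open set `U`: `L` is a holomorphic
family of normalized connections with irregular times and monodromies `t_{p,k}`, the monodromies
`t_{p,0}` are constant, the trivial times are fixed, `L` and `A` satisfy the zero curvature equation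
`𝓛_α[L] - ∂A/∂lam + [L, A] = 0`, and at each pole both linear systems have a common formal
fundamental solution in Birkhoff form. -/
structure IsIsomonodromic (U : Set E) (v : E → E) : Prop where
  normalized : ∀ b ∈ U, D.IsNormalized b
  trivialTimes : ∀ b ∈ U, D.TrivialTimesFixed b
  tInf_zero_const : ∀ b ∈ U, ∀ c ∈ U, D.tInf 0 b = D.tInf 0 c
  tX_zero_const : ∀ s, ∀ b ∈ U, ∀ c ∈ U, D.tX s 0 b = D.tX s 0 c
  differentiable_pos : ∀ s, DifferentiableOn ℂ (D.pos s) U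
  differentiable_tInf : ∀ k < rinf, DifferentiableOn ℂ (D.tInf k) U
  differentiable_tX : ∀ s, ∀ k < r s, DifferentiableOn ℂ (D.tX s k) U
  differentiable_om : DifferentiableOn ℂ D.om U
  differentiable_LInf : ∀ k ∈ Finset.Icc 1 (rinf - 1), ∀ i j,
    DifferentiableOn ℂ (fun b => D.LInf k b i j) U
  differentiable_LX : ∀ s, ∀ k ∈ Finset.range (r s), ∀ i j,
    DifferentiableOn ℂ (fun b => D.LX s k b i j) U
  zero_curvature : ∀ b ∈ U, ∀ c : ℂ, (∀ s, c ≠ D.pos s b) →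
    (Matrix.of fun i j => dirDeriv v (fun e => evalAt c (D.laxL e i j)) b) -
        (Matrix.of fun i j => deriv (fun y => evalAt y (D.laxA b i j)) c) +
      ⁅(D.laxL b).map (evalAt c), (D.laxA b).map (evalAt c)⁆ = 0
  formal_inf : ∃ F, D.IsFormalSolutionInf U v F
  formal_X : ∀ s, ∃ F, D.IsFormalSolutionX U v s F

end LaxFamily

/-! ### Oper gauge, Darboux coordinates and Lax coordinates -/

namespace LaxFamily

variable {n rinf : ℕ} {r : Fin n → ℕ} {E : Type*} (D : LaxFamily n rinf r E)

/-- The gauge matrix leading to the oper form. -/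
def gaugeG (b : E) : Matrix (Fin 2) (Fin 2) (RatFunc ℂ) :=
  !![1, 0; D.laxL b 0 0, D.laxL b 0 1]

/-- Upper right entry of the auxiliary matrix `G A G⁻¹ + 𝓛_α[G] G⁻¹` of the oper gauge; the first
row of `𝓛_α[G]` vanishes. -/
def operA12 (b : E) : RatFunc ℂ := (D.gaugeG b * D.laxA b * (D.gaugeG b)⁻¹) 0 1

/-- `ν_{X_s,k}`: coefficient of `(lam - X_s) ^ k` in the expansion of `operA12` at `X_s`. -/
def nuX (b : E) (s : Fin n) (k : ℕ) : ℂ := (expAt (D.pos s b) (D.operA12 b)).coeff (k : ℤ)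

/-- `ν_{∞,k}`: coefficient of `lam ^ (-k)` in the expansion of `operA12` at infinity. -/
def nuInf (b : E) (k : ℤ) : ℂ := (expInf (D.operA12 b)).coeff k

/-- The lower triangular Toeplitz matrix `M_{X_s}` of irregular times. -/
def matMX (b : E) (s : Fin n) : Matrix (Fin (r s - 1)) (Fin (r s - 1)) ℂ :=
  Matrix.of fun i j =>
    if (j : ℕ) ≤ (i : ℕ) then D.tX s (r s - 1 - ((i : ℕ) - (j : ℕ))) b else 0

/-- The lower triangular Toeplitz matrix `M_∞` of irregular times. -/
def matMInf (b : E) : Matrix (Fin (rinf - 3)) (Fin (rinf - 3)) ℂ :=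
  Matrix.of fun i j =>
    if (j : ℕ) ≤ (i : ℕ) then D.tInf (rinf - 1 - ((i : ℕ) - (j : ℕ))) b else 0

/-- The rational function `om ∏ (lam - q_j) / ∏ (lam - X_s) ^ (r s)`. -/
def factored {g : ℕ} (b : E) (q : Fin g → ℂ) : RatFunc ℂ :=
  RatFunc.C (D.om b) * (∏ j, (RatFunc.X - RatFunc.C (q j))) / ∏ s, D.lin b s ^ r s

/-- `q` lists the apparent singularities: the zeros of the upper right entry of the Lax matrix,
assumed to be simple and away from the poles. -/
structure IsApparent {g : ℕ} (b : E) (q : Fin g → ℂ) : Prop where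
  factorization : D.laxL b 0 1 = D.factored b q
  injective : Function.Injective q
  ne_pos : ∀ j s, q j ≠ D.pos s b

/-- The dual coordinates `p_i`. -/
def pcoord {g : ℕ} (b : E) (q : Fin g → ℂ) (i : Fin g) : ℂ := evalAt (q i) (D.laxL b 0 0)

/-- `Q_{X_s,k}` as a function of `q`: coefficient of `(lam - X_s) ^ (-k)`. -/
def QX {g : ℕ} (b : E) (s : Fin n) (k : ℕ) (q : Fin g → ℂ) : ℂ :=
  (expAt (D.pos s b) (D.factored b q)).coeff (-(k : ℤ))

/-- `Q_{∞,k}` as a function of `q`: coefficient of `lam ^ k` at infinity, used for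
`0 ≤ k ≤ rinf - 4`. -/
def QInf {g : ℕ} (b : E) (k : ℕ) (q : Fin g → ℂ) : ℂ :=
  (expInf (D.factored b q)).coeff (-(k : ℤ))

/-- Partial derivative with respect to `q_i`. -/
def partialq {g : ℕ} (f : (Fin g → ℂ) → ℂ) (q : Fin g → ℂ) (i : Fin g) : ℂ :=
  deriv (fun x => f (Function.update q i x)) (q i)

/-- `P` is conjugate to `Q`: `p_i = ∑ P ∂Q/∂q_i`, with the additional relations that make `P` unique
when `rinf ≤ 2`. -/
structure IsConjugate {g : ℕ} (b : E) (q : Fin g → ℂ) (PX : Fin n → ℕ → ℂ) (PInf : ℕ → ℂ) :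
    Prop where
  momentum : ∀ i, D.pcoord b q i =
    ∑ k ∈ Finset.range (rinf - 3), PInf k * partialq (D.QInf b k) q i +
      ∑ s, ∑ k ∈ Finset.Icc 1 (r s), PX s k * partialq (D.QX b s k) q i
  relation_le_two : rinf ≤ 2 →
    ∑ s, ∑ m ∈ Finset.Icc 1 (r s), PX s m * D.QX b s m q = 0
  relation_one : rinf = 1 →
    ∑ s, ∑ m ∈ Finset.Icc 1 (r s - 1), PX s m * D.QX b s (m + 1) q +
      ∑ s, ∑ m ∈ Finset.Icc 1 (r s), D.pos s b * PX s m * D.QX b s m q = 0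

/-- The number `g_0` of the gauge transformation to the oper form. -/
def g0 {g : ℕ} (b : E) (q : Fin g → ℂ) : ℂ :=
  if 2 ≤ rinf then
    D.tInf (rinf - 2) b + D.tInf (rinf - 1) b * (∑ j, q j - ∑ s, (r s : ℂ) * D.pos s b)
  else
    D.tInf 0 b * (∑ j, q j - ∑ s, (r s : ℂ) * D.pos s b) -
      (∑ s, (D.pos s b • D.LX s 0 b + if 2 ≤ r s then D.LX s 1 b else 0)) 0 0

/-- The geometric Lax coordinate `R_{X_s,k}`, `1 ≤ k ≤ r s`. -/
def RX {g : ℕ} (b : E) (q : Fin g → ℂ) (PX : Fin n → ℕ → ℂ) (s : Fin n) (k : ℕ) : ℂ :=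
  ∑ m ∈ Finset.Icc 1 (r s + 1 - k), PX s m * D.QX b s (k + m - 1) q -
    (D.g0 b q + D.tInf (rinf - 1) b * D.pos s b) / D.om b * D.QX b s k q -
    if k ≤ r s - 1 then D.tInf (rinf - 1) b / D.om b * D.QX b s (k + 1) q else 0

/-- The geometric Lax coordinate `R_{∞,k}`, `0 ≤ k ≤ rinf - 4`. -/
def RInf {g : ℕ} (b : E) (q : Fin g → ℂ) (PInf : ℕ → ℂ) (k : ℕ) : ℂ :=
  -D.om b * PInf (rinf - 4 - k) -
    ∑ m ∈ Finset.range (rinf - 4 - k), PInf m * D.QInf b (k + 1 + m) q -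
    D.tInf (rinf - 1) b / D.om b *
      (if k = 0 then ∑ s, D.QX b s 1 q else D.QInf b (k - 1) q) -
    D.g0 b q / D.om b * D.QInf b k q

/-! ### The explicit expressions

In what follows `Qx, Qi, Rx, Ri` stand for the values of the Lax coordinates at the finite poles and
at infinity, and `nx, ni` for the coefficients `ν` at the finite poles and at infinity. -/

/-- `∑_s ∑_k c_{s,k} / (lam - X_s) ^ k`. -/
def polarSum (b : E) (c : Fin n → ℕ → ℂ) : RatFunc ℂ :=
  ∑ s, ∑ k ∈ Finset.Icc 1 (r s), RatFunc.C (c s k) / D.lin b s ^ k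

/-- `∑_s X_s ^ 2 Q_{X_s,1} + 2 X_s Q_{X_s,2} + Q_{X_s,3}`. -/
def thirdMoment (b : E) (Qx : Fin n → ℕ → ℂ) : ℂ :=
  ∑ s, (D.pos s b ^ 2 * Qx s 1 + 2 * D.pos s b * Qx s 2 + Qx s 3)

/-- Expression of the upper left entry of the Lax matrix. -/
def formL11 (b : E) (Rx : Fin n → ℕ → ℂ) (Ri : ℕ → ℂ) : RatFunc ℂ :=
  D.polarSum b Rx -
    (if 2 ≤ rinf then RatFunc.C (D.tInf (rinf - 1) b) * RatFunc.X ^ (rinf - 2) else 0) -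
    (if 3 ≤ rinf then RatFunc.C (D.tInf (rinf - 2) b) * RatFunc.X ^ (rinf - 3) else 0) +
    ∑ k ∈ Finset.range (rinf - 3), RatFunc.C (Ri k) * RatFunc.X ^ k

/-- Expression of the upper right entry of the Lax matrix. -/
def formL12 (b : E) (Qx : Fin n → ℕ → ℂ) (Qi : ℕ → ℂ) : RatFunc ℂ :=
  D.polarSum b Qx + ∑ k ∈ Finset.range (rinf - 3), RatFunc.C (Qi k) * RatFunc.X ^ k +
    if 3 ≤ rinf then RatFunc.C (D.om b) * RatFunc.X ^ (rinf - 3) else 0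

/-- `∑_{m=0}^{2 r_s - j} t_{X_s, r_s - 1 - m} t_{X_s, j + m - r_s - 1}`. -/
def sqCoeffX (b : E) (s : Fin n) (j : ℕ) : ℂ :=
  ∑ m ∈ Finset.range (2 * r s - j + 1),
    D.tX s (r s - 1 - m) b * D.tX s (j + m - r s - 1) b

/-- `∑_{m=0}^{2 rinf - 4 - j} t_{∞, rinf - 1 - m} t_{∞, j + m - rinf + 3}`. -/
def sqCoeffInf (b : E) (j : ℕ) : ℂ :=
  ∑ m ∈ Finset.range (2 * rinf - 4 - j + 1),
    D.tInf (rinf - 1 - m) b * D.tInf (j + m + 3 - rinf) b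

/-- Sum over the finite poles of the singular parts entering the lower left entry of the Lax
matrix. -/
def formL21Finite (b : E) (Qx Rx : Fin n → ℕ → ℂ) (Qi Ri : ℕ → ℂ) : RatFunc ℂ :=
  ∑ s, singAt (D.pos s b)
    ((∑ j ∈ Finset.Icc (r s + 1) (2 * r s), RatFunc.C (D.sqCoeffX b s j) / D.lin b s ^ j -
      D.formL11 b Rx Ri ^ 2) / D.formL12 b Qx Qi)

/-- Expression of the lower left entry of the Lax matrix. -/
def formL21 (b : E) (Qx Rx : Fin n → ℕ → ℂ) (Qi Ri : ℕ → ℂ) : RatFunc ℂ :=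
  (if 3 ≤ rinf then
    polyInf
      ((∑ j ∈ Finset.Icc (rinf - 3) (2 * rinf - 4),
          RatFunc.C (D.sqCoeffInf b j) * RatFunc.X ^ j -
        D.formL11 b Rx Ri ^ 2) / D.formL12 b Qx Qi)
   else 0) + D.formL21Finite b Qx Rx Qi Ri

/-- Expression of the upper right entry of the auxiliary matrix. -/
def formA12 (b : E) (Qx : Fin n → ℕ → ℂ) (Qi : ℕ → ℂ) (nx : Fin n → ℕ → ℂ) (ni : ℤ → ℂ) :
    RatFunc ℂ :=
  (if 4 ≤ rinf then RatFunc.C (D.om b * ni 1) * RatFunc.X ^ (rinf - 4) else 0) +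
    ∑ j ∈ Finset.range (rinf - 4),
      RatFunc.C (D.om b * ni ((rinf : ℤ) - 3 - j) +
        ∑ k ∈ Finset.Icc (j + 1) (rinf - 4), ni ((k : ℤ) - j) * Qi k) * RatFunc.X ^ j +
    D.polarSum b (fun s j => ∑ k ∈ Finset.Icc j (r s), nx s (k - j) * Qx s k)

/-- Expression of the upper left entry of the auxiliary matrix; `dom` stands for `𝓛_α[om]`. -/
def formA11 (b : E) (dom : ℂ) (Rx : Fin n → ℕ → ℂ) (Ri : ℕ → ℂ)
    (nx : Fin n → ℕ → ℂ) (ni : ℤ → ℂ) : RatFunc ℂ :=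
  RatFunc.C (1 / (2 * D.om b) * dom -
      (if rinf = 2 then D.tInf 1 b * ni 0 else 0) +
      (if rinf = 1 then (1 / 2 - D.tInf 0 b) * ni (-1) else 0)) -
    RatFunc.C (D.tInf (rinf - 1) b) *
      ∑ j ∈ Finset.range (rinf - 2), RatFunc.C (ni ((rinf : ℤ) - 2 - j)) * RatFunc.X ^ j -
    RatFunc.C (D.tInf (rinf - 2) b) *
      ∑ j ∈ Finset.range (rinf - 3), RatFunc.C (ni ((rinf : ℤ) - 3 - j)) * RatFunc.X ^ j +
    ∑ j ∈ Finset.range (rinf - 4),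
      RatFunc.C (∑ i ∈ Finset.Icc 1 (rinf - 4 - j), ni (i : ℤ) * Ri (j + i)) * RatFunc.X ^ j +
    D.polarSum b (fun s j => ∑ i ∈ Finset.range (r s - j + 1), nx s i * Rx s (i + j))

/-- The rational function
`(L11 / L12) ((L11 / L12) A12 - 2 A11)`, with the entries replaced by their expressions. -/
def formW (b : E) (dom : ℂ) (Qx Rx : Fin n → ℕ → ℂ) (Qi Ri : ℕ → ℂ)
    (nx : Fin n → ℕ → ℂ) (ni : ℤ → ℂ) : RatFunc ℂ :=
  D.formL11 b Rx Ri / D.formL12 b Qx Qi *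
    (D.formL11 b Rx Ri / D.formL12 b Qx Qi * D.formA12 b Qx Qi nx ni -
      2 * D.formA11 b dom Rx Ri nx ni)

/-- Sum over the finite poles of the singular parts entering the lower left entry of the auxiliary
matrix. -/
def formA21Finite (b : E) (dom : ℂ) (Qx Rx : Fin n → ℕ → ℂ) (Qi Ri : ℕ → ℂ)
    (nx : Fin n → ℕ → ℂ) (ni : ℤ → ℂ) : RatFunc ℂ :=
  ∑ s, singAt (D.pos s b)
      ((∑ k ∈ Finset.Icc (r s + 1) (2 * r s),
        RatFunc.C (∑ j ∈ Finset.Icc k (2 * r s), D.sqCoeffX b s j * nx s (j - k)) /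
          D.lin b s ^ k) / D.formL12 b Qx Qi) +
    ∑ s, singAt (D.pos s b) (D.formW b dom Qx Rx Qi Ri nx ni)

/-- Expression of the lower left entry of the auxiliary matrix. -/
def formA21 (b : E) (dom : ℂ) (Qx Rx : Fin n → ℕ → ℂ) (Qi Ri : ℕ → ℂ)
    (nx : Fin n → ℕ → ℂ) (ni : ℤ → ℂ) : RatFunc ℂ :=
  (if 3 ≤ rinf then
    -(RatFunc.C (D.tInf (rinf - 1) b / D.om b ^ 2 * dom) * RatFunc.X) +
      RatFunc.C (2 / D.om b *
          resInf (D.formA11 b dom Rx Ri nx ni -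
            D.formL11 b Rx Ri / D.formL12 b Qx Qi * D.formA12 b Qx Qi nx ni) +
        1 / D.om b ^ 3 * (if rinf = 3 then ∑ s, Qx s 1 else Qi (rinf - 4)) * dom) +
      polyInf
        ((∑ k ∈ Finset.Icc (rinf - 3) (2 * rinf - 5),
          RatFunc.C (∑ j ∈ Finset.Icc (k + 1) (2 * rinf - 4),
            D.sqCoeffInf b j * ni ((j : ℤ) - k)) * RatFunc.X ^ k) / D.formL12 b Qx Qi) +
      polyInf (D.formW b dom Qx Rx Qi Ri nx ni)
   else 0) + D.formA21Finite b dom Qx Rx Qi Ri nx ni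

end LaxFamily

end GeoLax

end

/-!
Apart from derivatives along `v`, everything happens at one point of the deformation space and is
read off from Laurent expansions in `lam`.

A rational function with poles only at the `X_s` and at infinity is determined by its singular parts
at the `X_s` and its polynomial part at infinity (`partialFractions.ext`), so each formula reduces to
a comparison of finitely many Laurent coefficients at each pole.

*Local input.* At a pole, `L = ∂F F⁻¹ + F diag(∂T, -∂T) F⁻¹`, and likewise `A`, where `det F = 1`;
so the entries are explicit expressions in those of `F` and its derivatives
(`entries_of_birkhoff`). Two consequences carry the proof. First, `L11 ^ 2 + L12 L21 = -det L` agrees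
with the square of `∂T/∂lam` up to an error whose pole is no worse than that of `L` at a
finite point, and `O(lam ^ (rinf - 4))` at infinity (`vanishesBelow_sq_sub`).
Second, put `N = A12 / L12`, the entry `(1, 2)` in the oper gauge, whose coefficients are the `ν`
(`operA12_eq`). The matrix `A - N L` has lost its polar part, and `N ∂T/∂lam` agrees with
`𝓛_α T` up to a regular term (`local_deformation`, `IsBirkhoffAtInfinity`); at a finite pole this
also gives the constant term `-α_{X_s}` of `N`, and at infinity the normalization of `L` gives the
constant term of `A11 - N L11`. `IsIsomonodromic.expAt_bounds`, `IsIsomonodromic.expInf_bounds` and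
`IsIsomonodromic.expInf_C00` record these facts for the given family.

*Lax matrix.* The entry `L12` is its own partial fraction expansion. For `L11`, moving the apparent
singularity `q_i` multiplies `L12` by `(lam - x) / (lam - q_i)`; hence the right-hand side of the
relation between `p_i` and the `P` is the value at `q_i` of an explicit rational function
(`IsConjugate.coeff_momPart`), while `L12` vanishes there. So `L11` and the claimed expression agree
at all `q_i`, and at infinity up to `O(lam ^ (rinf - 4))`; their difference times
`∏ (lam - X_s) ^ r_s` is a polynomial of degree less than `g` with the `g` zeros `q_i`, hence zero
(`IsIsomonodromic.laxL11`). The entry `L21` follows from `-det L`, divided by `L12`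
(`IsIsomonodromic.laxL21`).

*Auxiliary matrix.* `A12 = N L12`, and `A11` and `A21` equal `N L11` and `N L21` up to terms regular
at the finite poles and controlled at infinity, so their coefficients are convolutions of those of
`L` with the `ν`; for `A21` the determinant of `L` replaces `L21` (`IsNormalized.laxA21_sub`). The
Toeplitz systems are the polar coefficients of `N ∂T/∂lam = 𝓛_α T`, and the remaining relations
between the `ν` at infinity are the coefficients of `lam ^ (-1)` and `lam ^ (-2)` in `A12 = N L12`.
-/

noncomputable section

namespace GeoLax

/-! ### Laurent series vanishing below a given order -/

/-- All coefficients of `f` of index less than `m` vanish, i.e. `f = O(z ^ m)`. Unlike a bound on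
`HahnSeries.order`, this includes `f = 0` for every `m`. -/
def VanishesBelow (m : ℤ) (f : ℂ⸨X⸩) : Prop := ∀ i < m, f.coeff i = 0

namespace VanishesBelow

variable {m k : ℤ} {f h : ℂ⸨X⸩}

theorem mono (hf : VanishesBelow m f) (hk : k ≤ m) : VanishesBelow k f :=
  fun i hi => hf i (hi.trans_le hk)

theorem zero (m : ℤ) : VanishesBelow m 0 := fun _ _ => rfl

theorem add (hf : VanishesBelow m f) (hh : VanishesBelow m h) : VanishesBelow m (f + h) :=
  fun i hi => by rw [HahnSeries.coeff_add, hf i hi, hh i hi, add_zero]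

theorem neg (hf : VanishesBelow m f) : VanishesBelow m (-f) :=
  fun i hi => by rw [HahnSeries.coeff_neg, hf i hi, neg_zero]

theorem sub (hf : VanishesBelow m f) (hh : VanishesBelow m h) : VanishesBelow m (f - h) :=
  fun i hi => by rw [HahnSeries.coeff_sub, hf i hi, hh i hi, sub_zero]

theorem sum {ι : Type*} {s : Finset ι} {F : ι → ℂ⸨X⸩} (hF : ∀ i ∈ s, VanishesBelow m (F i)) :
    VanishesBelow m (∑ i ∈ s, F i) :=
  fun j hj => by rw [HahnSeries.coeff_sum]; exact Finset.sum_eq_zero fun i hi => hF i hi j hj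

theorem single (c : ℂ) : VanishesBelow m (HahnSeries.single m c) :=
  fun _ hi => HahnSeries.coeff_single_of_ne hi.ne

theorem C (c : ℂ) : VanishesBelow 0 (HahnSeries.C c : ℂ⸨X⸩) :=
  fun _ hi => HahnSeries.coeff_single_of_ne hi.ne

theorem one : VanishesBelow 0 (1 : ℂ⸨X⸩) := by
  simpa using C 1

theorem ofPowerSeries (f : ℂ⟦X⟧) : VanishesBelow 0 (HahnSeries.ofPowerSeries ℤ ℂ f) :=
  fun i hi => by rw [PowerSeries.coeff_coe, if_pos hi]

theorem derivative (hf : VanishesBelow 0 f) : VanishesBelow 0 (LaurentSeries.derivative ℂ f) := by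
  intro i hi
  rw [LaurentSeries.derivative_apply, LaurentSeries.hasseDeriv_coeff]
  rcases eq_or_ne i (-1) with rfl | h
  · simp
  · rw [hf _ (by push_cast; omega), smul_zero]

theorem iff_orderTop : VanishesBelow m f ↔ (m : WithTop ℤ) ≤ f.orderTop := by
  rw [HahnSeries.le_orderTop_iff_forall]
  simp [VanishesBelow]

theorem mul (hf : VanishesBelow m f) (hh : VanishesBelow k h) : VanishesBelow (m + k) (f * h) := by
  rw [iff_orderTop] at *
  rw [HahnSeries.orderTop_mul, WithTop.coe_add]
  exact add_le_add hf hh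

/-- The product of series vanishing below `m` and below `k`, at any weaker order. -/
theorem mul' {j : ℤ} (hf : VanishesBelow m f) (hh : VanishesBelow k h) (hj : j ≤ m + k) :
    VanishesBelow j (f * h) :=
  (hf.mul hh).mono hj

theorem mul_zero_zero (hf : VanishesBelow 0 f) (hh : VanishesBelow 0 h) :
    VanishesBelow 0 (f * h) := hf.mul hh

theorem pow (hf : VanishesBelow 0 f) : ∀ n : ℕ, VanishesBelow 0 (f ^ n)
  | 0 => by simpa using one
  | n + 1 => by rw [pow_succ]; exact (pow hf n).mul hf

/-- Division by a series of exact order `k` lowers the order of vanishing by `k`. -/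
theorem of_mul (hfh : VanishesBelow m (f * h)) (hk : h.coeff k ≠ 0) :
    VanishesBelow (m - k) f := by
  rw [iff_orderTop] at *
  have h1 : h.orderTop ≤ (k : WithTop ℤ) := HahnSeries.orderTop_le_of_coeff_ne_zero hk
  rw [HahnSeries.orderTop_mul] at hfh
  rcases eq_or_ne f 0 with rfl | hf
  · simp
  have hh : h ≠ 0 := by rintro rfl; simp at hk
  rw [← HahnSeries.order_eq_orderTop_of_ne_zero hf, ← HahnSeries.order_eq_orderTop_of_ne_zero hh,
    ← WithTop.coe_add, WithTop.coe_le_coe] at hfh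
  rw [← HahnSeries.order_eq_orderTop_of_ne_zero hh, WithTop.coe_le_coe] at h1
  rw [← HahnSeries.order_eq_orderTop_of_ne_zero hf, WithTop.coe_le_coe]
  omega

theorem div (hf : VanishesBelow m f) (hk : h.coeff k ≠ 0) : VanishesBelow (m - k) (f / h) := by
  have hh : h ≠ 0 := by rintro rfl; simp at hk
  apply of_mul (h := h) _ hk
  rwa [div_mul_cancel₀ _ hh]

theorem div' {j : ℤ} (hf : VanishesBelow m f) (hk : h.coeff k ≠ 0) (hj : j ≤ m - k) :
    VanishesBelow j (f / h) :=
  (hf.div hk).mono hj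

theorem succ (hf : VanishesBelow m f) (h0 : f.coeff m = 0) : VanishesBelow (m + 1) f := by
  intro i hi
  rcases (Int.lt_add_one_iff.mp hi).lt_or_eq with h | rfl
  · exact hf i h
  · exact h0

end VanishesBelow

/-- Two series agreeing up to `O(z ^ m)` have the same coefficients below `m`. -/
theorem coeff_eq_of_sub {m i : ℤ} {f h : ℂ⸨X⸩} (hfh : VanishesBelow m (f - h)) (hi : i < m) :
    f.coeff i = h.coeff i := by
  have := hfh i hi
  rwa [HahnSeries.coeff_sub, sub_eq_zero] at this

/-- Coefficients of a product of two series bounded below are finite convolutions. -/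
theorem coeff_mul_of_vanishesBelow {a b : ℤ} {f h : ℂ⸨X⸩} (hf : VanishesBelow a f)
    (hh : VanishesBelow b h) (m : ℤ) :
    (f * h).coeff m = ∑ i ∈ Finset.Icc a (m - b), f.coeff i * h.coeff (m - i) := by
  classical
  rw [HahnSeries.coeff_mul]
  have key : ∀ ij ∈ Finset.antidiagonal f.isPWO_support h.isPWO_support m,
      f.coeff ij.1 * h.coeff ij.2 = f.coeff ij.1 * h.coeff (m - ij.1) := by
    intro ij hij
    rw [Finset.mem_antidiagonal] at hij
    rw [show ij.2 = m - ij.1 by linarith [hij.2.2]]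
  rw [Finset.sum_congr rfl key]
  rw [← Finset.sum_image (s := Finset.antidiagonal f.isPWO_support h.isPWO_support m)
    (g := fun ij : ℤ × ℤ => ij.1) (f := fun i => f.coeff i * h.coeff (m - i))]
  · apply Finset.sum_subset
    · intro i hi
      rw [Finset.mem_image] at hi
      obtain ⟨ij, hij, rfl⟩ := hi
      rw [Finset.mem_antidiagonal] at hij
      rw [Finset.mem_Icc]
      constructor
      · by_contra hlt
        exact hij.1 (hf _ (not_le.mp hlt))
      · by_contra hlt
        exact hij.2.1 (hh _ (by linarith [hij.2.2, not_le.mp hlt]))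
    · intro i _ hi
      by_contra hne
      apply hi
      rw [Finset.mem_image]
      refine ⟨(i, m - i), ?_, rfl⟩
      rw [Finset.mem_antidiagonal]
      exact ⟨left_ne_zero_of_mul hne, right_ne_zero_of_mul hne, by simp⟩
  · intro x hx y hy hxy
    rw [Finset.mem_coe, Finset.mem_antidiagonal] at hx hy
    exact Prod.ext hxy (by have := hx.2.2; have := hy.2.2; simp only at hxy; omega)

theorem coeff_mul_lead {a b : ℤ} {f h : ℂ⸨X⸩} (hf : VanishesBelow a f) (hh : VanishesBelow b h)
    {m : ℤ} (hm : m = a + b) : (f * h).coeff m = f.coeff a * h.coeff b := by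
  subst hm
  rw [coeff_mul_of_vanishesBelow hf hh]
  simp

theorem coeff_mul_lead_succ {a b : ℤ} {f h : ℂ⸨X⸩} (hf : VanishesBelow a f)
    (hh : VanishesBelow b h) {m : ℤ} (hm : m = a + b + 1) :
    (f * h).coeff m = f.coeff a * h.coeff (b + 1) + f.coeff (a + 1) * h.coeff b := by
  subst hm
  rw [coeff_mul_of_vanishesBelow hf hh, show a + b + 1 - b = a + 1 by ring,
    ← Finset.add_sum_Ioc_eq_sum_Icc (by omega : a ≤ a + 1),
    show Finset.Ioc a (a + 1) = {a + 1} by ext; simp; omega, Finset.sum_singleton]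
  congr 3 <;> ring

/-! ### Expansions of rational functions -/

@[simp] theorem expZero_C (c : ℂ) : expZero (RatFunc.C c) = HahnSeries.C c := by
  unfold expZero
  rw [← RatFunc.algebraMap_C]
  exact (RatFunc.coe_coe (Polynomial.C c)).symm.trans (by simp)

@[simp] theorem expZero_X : expZero RatFunc.X = HahnSeries.single 1 1 := by
  unfold expZero
  exact RatFunc.coe_X

@[simp] theorem expAt_C (a c : ℂ) : expAt a (RatFunc.C c) = HahnSeries.C c := by
  simp [expAt]

@[simp] theorem expAt_X (a : ℂ) :
    expAt a RatFunc.X = HahnSeries.single 1 1 + HahnSeries.C a := by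
  simp [expAt]

@[simp] theorem expInf_C (c : ℂ) : expInf (RatFunc.C c) = HahnSeries.C c := by
  have : invSubst (RatFunc.C c) = RatFunc.C c := by
    rw [← RatFunc.algebraMap_eq_C]; exact invSubst.commutes c
  simp [expInf, this]

@[simp] theorem expInf_X : expInf RatFunc.X = HahnSeries.single (-1) 1 := by
  have : invSubst RatFunc.X = RatFunc.X⁻¹ := by
    rw [← RatFunc.algebraMap_X]
    simp [invSubst, RatFunc.liftAlgHom]
  simp [expInf, this]

theorem expAt_X_sub_C (a c : ℂ) :
    expAt a (RatFunc.X - RatFunc.C c) = HahnSeries.single 1 1 + HahnSeries.C (a - c) := by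
  rw [map_sub, expAt_X, expAt_C, map_sub]
  ring

theorem expAt_X_sub_C_self (a : ℂ) :
    expAt a (RatFunc.X - RatFunc.C a) = HahnSeries.single 1 1 := by
  simp [expAt_X_sub_C]

theorem single_neg_pow (k : ℕ) :
    ((HahnSeries.single 1 1 : ℂ⸨X⸩) ^ k)⁻¹ = HahnSeries.single (-(k : ℤ)) 1 := by
  rw [HahnSeries.single_pow, inv_eq_of_mul_eq_one_right]
  rw [HahnSeries.single_mul_single]
  simp

theorem expAt_div_X_sub_C_pow_self (a c : ℂ) (k : ℕ) :
    expAt a (RatFunc.C c / (RatFunc.X - RatFunc.C a) ^ k) = HahnSeries.single (-(k : ℤ)) c := by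
  rw [map_div₀, map_pow, expAt_X_sub_C_self, expAt_C, div_eq_mul_inv, single_neg_pow,
    HahnSeries.C_apply, HahnSeries.single_mul_single]
  simp

theorem vanishesBelow_single_add_C (c : ℂ) :
    VanishesBelow 0 (HahnSeries.single 1 1 + HahnSeries.C c : ℂ⸨X⸩) :=
  ((VanishesBelow.single 1).mono (by norm_num)).add (.C c)

theorem coeff_zero_single_add_C (c : ℂ) :
    (HahnSeries.single 1 1 + HahnSeries.C c : ℂ⸨X⸩).coeff 0 = c := by
  simp [HahnSeries.coeff_add, HahnSeries.C_apply, HahnSeries.coeff_single_of_ne]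

theorem vanishesBelow_expAt_inv {a c : ℂ} (h : a ≠ c) :
    VanishesBelow 0 (expAt a (RatFunc.X - RatFunc.C c)⁻¹) := by
  rw [map_inv₀, expAt_X_sub_C, inv_eq_one_div]
  exact VanishesBelow.one.div' (k := 0)
    (by rw [coeff_zero_single_add_C]; exact sub_ne_zero.mpr h) (by norm_num)

theorem vanishesBelow_expAt_div {a c : ℂ} (h : a ≠ c) (d : ℂ) (k : ℕ) :
    VanishesBelow 0 (expAt a (RatFunc.C d / (RatFunc.X - RatFunc.C c) ^ k)) := by
  rw [div_eq_mul_inv, ← inv_pow, map_mul, map_pow, expAt_C]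
  exact (VanishesBelow.C d).mul ((vanishesBelow_expAt_inv h).pow k)

theorem vanishesBelow_expAt_C_mul_X_pow (a c : ℂ) (k : ℕ) :
    VanishesBelow 0 (expAt a (RatFunc.C c * RatFunc.X ^ k)) := by
  rw [map_mul, map_pow, expAt_C, expAt_X]
  exact (VanishesBelow.C c).mul ((vanishesBelow_single_add_C a).pow k)

theorem expInf_C_mul_X_pow (c : ℂ) (k : ℕ) :
    expInf (RatFunc.C c * RatFunc.X ^ k) = HahnSeries.single (-(k : ℤ)) c := by
  rw [map_mul, map_pow, expInf_C, expInf_X, HahnSeries.single_pow, HahnSeries.C_apply,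
    HahnSeries.single_mul_single]
  simp

theorem expInf_X_sub_C (a : ℂ) :
    expInf (RatFunc.X - RatFunc.C a) = HahnSeries.single (-1) 1 - HahnSeries.C a := by
  rw [map_sub, expInf_X, expInf_C]

theorem X_sub_C_ne_zero (a : ℂ) : (RatFunc.X - RatFunc.C a : RatFunc ℂ) ≠ 0 := by
  intro h
  have := congrArg (fun f => (expAt a f).coeff 1) h
  simp [expAt_X_sub_C_self] at this

theorem coeff_expInf_X_sub_C (a : ℂ) :
    VanishesBelow (-1) (expInf (RatFunc.X - RatFunc.C a)) ∧
      (expInf (RatFunc.X - RatFunc.C a)).coeff (-1) = 1 ∧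
      (expInf (RatFunc.X - RatFunc.C a)).coeff 0 = -a := by
  rw [expInf_X_sub_C]
  refine ⟨(VanishesBelow.single 1).sub ((VanishesBelow.C a).mono (by norm_num)), ?_, ?_⟩
  · simp [HahnSeries.coeff_sub, HahnSeries.C_apply, HahnSeries.coeff_single_of_ne]
  · simp [HahnSeries.coeff_sub, HahnSeries.C_apply, HahnSeries.coeff_single_of_ne]

theorem vanishesBelow_expInf_inv (a : ℂ) :
    VanishesBelow 1 (expInf (RatFunc.X - RatFunc.C a)⁻¹) := by
  rw [map_inv₀, inv_eq_one_div]
  refine VanishesBelow.one.div' (k := -1) ?_ (by norm_num)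
  rw [(coeff_expInf_X_sub_C a).2.1]
  exact one_ne_zero

theorem vanishesBelow_expInf_div (a d : ℂ) (k : ℕ) :
    VanishesBelow k (expInf (RatFunc.C d / (RatFunc.X - RatFunc.C a) ^ k)) := by
  induction k with
  | zero => simpa using VanishesBelow.C d
  | succ k ih =>
    rw [pow_succ, ← div_div, div_eq_mul_inv _ (RatFunc.X - RatFunc.C a), map_mul]
    exact ih.mul' (vanishesBelow_expInf_inv a) (by push_cast; omega)

/-- Recursion `u_{k+1} (m + 1) = u_k m + a u_{k+1} m` for the coefficients of the expansion
`u_k` of `(lam - a) ^ (-k)` at infinity. -/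
theorem coeff_expInf_div_succ (a d : ℂ) (k : ℕ) (m : ℤ) :
    (expInf (RatFunc.C d / (RatFunc.X - RatFunc.C a) ^ (k + 1))).coeff (m + 1) =
      (expInf (RatFunc.C d / (RatFunc.X - RatFunc.C a) ^ k)).coeff m +
        a * (expInf (RatFunc.C d / (RatFunc.X - RatFunc.C a) ^ (k + 1))).coeff m := by
  have h : RatFunc.C d / (RatFunc.X - RatFunc.C a) ^ k =
      (RatFunc.X - RatFunc.C a) * (RatFunc.C d / (RatFunc.X - RatFunc.C a) ^ (k + 1)) := by
    have := X_sub_C_ne_zero a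
    rw [pow_succ]
    field_simp
  rw [h, map_mul, expInf_X_sub_C, sub_mul, HahnSeries.coeff_sub, HahnSeries.coeff_single_mul,
    HahnSeries.C_mul_eq_smul, HahnSeries.coeff_smul]
  simp

theorem coeff_expInf_div_one (a d : ℂ) {k : ℕ} (hk : 1 ≤ k) :
    (expInf (RatFunc.C d / (RatFunc.X - RatFunc.C a) ^ k)).coeff 1 = if k = 1 then d else 0 := by
  obtain ⟨k, rfl⟩ := Nat.exists_eq_add_of_le' hk
  have h := coeff_expInf_div_succ a d k 0
  rw [zero_add] at h
  rw [h, vanishesBelow_expInf_div a d (k + 1) 0 (by push_cast; omega), mul_zero, add_zero]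
  rcases k with _ | k
  · simp [HahnSeries.C_apply]
  · rw [vanishesBelow_expInf_div a d (k + 1) 0 (by push_cast; omega), if_neg (by omega)]

theorem coeff_expInf_div_two (a d : ℂ) {k : ℕ} (hk : 1 ≤ k) :
    (expInf (RatFunc.C d / (RatFunc.X - RatFunc.C a) ^ k)).coeff 2 =
      (if k = 2 then d else 0) + a * if k = 1 then d else 0 := by
  obtain ⟨k, rfl⟩ := Nat.exists_eq_add_of_le' hk
  have h := coeff_expInf_div_succ a d k 1
  rw [one_add_one_eq_two] at h
  rw [h, coeff_expInf_div_one a d hk]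
  rcases k with _ | k
  · simp [HahnSeries.C_apply, HahnSeries.coeff_single_of_ne]
  · rw [coeff_expInf_div_one a d (by omega)]
    simp

theorem coeff_expInf_div_three (a d : ℂ) {k : ℕ} (hk : 1 ≤ k) :
    (expInf (RatFunc.C d / (RatFunc.X - RatFunc.C a) ^ k)).coeff 3 =
      (if k = 3 then d else 0) + 2 * a * (if k = 2 then d else 0) +
        a ^ 2 * if k = 1 then d else 0 := by
  obtain ⟨k, rfl⟩ := Nat.exists_eq_add_of_le' hk
  have h := coeff_expInf_div_succ a d k 2
  rw [show (2 : ℤ) + 1 = 3 by norm_num] at h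
  rw [h, coeff_expInf_div_two a d hk]
  rcases k with _ | k
  · simp [HahnSeries.C_apply, HahnSeries.coeff_single_of_ne]
    ring
  · rw [coeff_expInf_div_two a d (by omega)]
    simp
    split_ifs <;> ring

/-! ### Singular parts, polynomial parts and partial fractions -/

theorem expAt_singAt (a : ℂ) (f : RatFunc ℂ) {k : ℕ} (hk : 1 ≤ k) :
    (expAt a (singAt a f)).coeff (-(k : ℤ)) = (expAt a f).coeff (-(k : ℤ)) := by
  rw [singAt, map_sum, HahnSeries.coeff_sum]
  have h : ∀ x ∈ Finset.Icc 1 (-(expAt a f).order).toNat,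
      (expAt a (RatFunc.C ((expAt a f).coeff (-(x : ℤ))) /
        (RatFunc.X - RatFunc.C a) ^ x)).coeff (-(k : ℤ)) =
        if k = x then (expAt a f).coeff (-(k : ℤ)) else 0 := by
    intro x _
    by_cases hx : k = x
    · subst hx
      rw [expAt_div_X_sub_C_pow_self, if_pos rfl, HahnSeries.coeff_single_same]
    · rw [expAt_div_X_sub_C_pow_self, if_neg hx, HahnSeries.coeff_single_of_ne (by omega)]
  rw [Finset.sum_congr rfl h, Finset.sum_ite_eq]
  split_ifs with hmem
  · rfl
  · symm
    apply HahnSeries.coeff_eq_zero_of_lt_order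
    rw [Finset.mem_Icc] at hmem
    omega

theorem vanishesBelow_expAt_singAt {a c : ℂ} (h : a ≠ c) (f : RatFunc ℂ) :
    VanishesBelow 0 (expAt a (singAt c f)) := by
  rw [singAt, map_sum]
  exact .sum fun k _ => vanishesBelow_expAt_div h _ k

theorem vanishesBelow_expInf_singAt (a : ℂ) (f : RatFunc ℂ) :
    VanishesBelow 1 (expInf (singAt a f)) := by
  rw [singAt, map_sum]
  exact .sum fun k hk => (vanishesBelow_expInf_div _ _ k).mono
    (by have := (Finset.mem_Icc.mp hk).1; omega)

theorem expInf_polyInf (f : RatFunc ℂ) (k : ℕ) :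
    (expInf (polyInf f)).coeff (-(k : ℤ)) = (expInf f).coeff (-(k : ℤ)) := by
  rw [polyInf, map_sum, HahnSeries.coeff_sum]
  have h : ∀ x ∈ Finset.range ((-(expInf f).order).toNat + 1),
      (expInf (RatFunc.C ((expInf f).coeff (-(x : ℤ))) * RatFunc.X ^ x)).coeff (-(k : ℤ)) =
        if k = x then (expInf f).coeff (-(k : ℤ)) else 0 := by
    intro x _
    by_cases hx : k = x
    · subst hx
      rw [expInf_C_mul_X_pow, if_pos rfl, HahnSeries.coeff_single_same]
    · rw [expInf_C_mul_X_pow, if_neg hx, HahnSeries.coeff_single_of_ne (by omega)]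
  rw [Finset.sum_congr rfl h, Finset.sum_ite_eq]
  split_ifs with hmem
  · rfl
  · symm
    apply HahnSeries.coeff_eq_zero_of_lt_order
    rw [Finset.mem_range] at hmem
    omega

theorem vanishesBelow_expAt_polyInf (a : ℂ) (f : RatFunc ℂ) :
    VanishesBelow 0 (expAt a (polyInf f)) := by
  rw [polyInf, map_sum]
  exact .sum fun k _ => vanishesBelow_expAt_C_mul_X_pow a _ k

open Polynomial in
theorem vanishesBelow_expAt_algebraMap (a : ℂ) (p : ℂ[X]) :
    VanishesBelow 0 (expAt a (algebraMap ℂ[X] (RatFunc ℂ) p)) ∧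
      (expAt a (algebraMap ℂ[X] (RatFunc ℂ) p)).coeff 0 = p.eval a := by
  induction p using Polynomial.induction_on' with
  | add p q hp hq =>
    rw [map_add, map_add, HahnSeries.coeff_add, hp.2, hq.2, eval_add]
    exact ⟨hp.1.add hq.1, rfl⟩
  | monomial n c =>
    have hpow : ∀ n : ℕ, ((HahnSeries.single 1 1 + HahnSeries.C a : ℂ⸨X⸩) ^ n).coeff 0 = a ^ n := by
      intro n
      induction n with
      | zero => simp
      | succ n ih =>
        rw [pow_succ, coeff_mul_lead ((vanishesBelow_single_add_C a).pow n)
          (vanishesBelow_single_add_C a) (by simp), ih, coeff_zero_single_add_C, pow_succ]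
    rw [← C_mul_X_pow_eq_monomial, map_mul, map_pow, RatFunc.algebraMap_C, RatFunc.algebraMap_X]
    refine ⟨vanishesBelow_expAt_C_mul_X_pow a c n, ?_⟩
    rw [map_mul, map_pow, expAt_C, expAt_X, HahnSeries.C_mul_eq_smul, HahnSeries.coeff_smul, hpow]
    simp

open Polynomial in
theorem coeff_expInf_algebraMap (p : ℂ[X]) (k : ℕ) :
    (expInf (algebraMap ℂ[X] (RatFunc ℂ) p)).coeff (-(k : ℤ)) = p.coeff k := by
  induction p using Polynomial.induction_on' with
  | add p q hp hq => rw [map_add, map_add, HahnSeries.coeff_add, hp, hq, coeff_add]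
  | monomial n c =>
    rw [← C_mul_X_pow_eq_monomial, map_mul, map_pow, RatFunc.algebraMap_C, RatFunc.algebraMap_X,
      expInf_C_mul_X_pow, coeff_C_mul_X_pow, HahnSeries.coeff_single]
    simp

open Polynomial in
theorem coeff_expAt_aeval_inv (a : ℂ) (p : ℂ[X]) (k : ℕ) :
    (expAt a (aeval (RatFunc.X - RatFunc.C a)⁻¹ p)).coeff (-(k : ℤ)) = p.coeff k := by
  induction p using Polynomial.induction_on' with
  | add p q hp hq => rw [map_add, map_add, HahnSeries.coeff_add, hp, hq, coeff_add]
  | monomial n c =>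
    rw [aeval_monomial, RatFunc.algebraMap_eq_C, inv_pow, ← div_eq_mul_inv,
      expAt_div_X_sub_C_pow_self, coeff_monomial, HahnSeries.coeff_single]
    simp [eq_comm]

open Polynomial in
/-- Polynomial expressions in a function without polar part at `a` have none. -/
theorem vanishesBelow_expAt_aeval {a : ℂ} {f : RatFunc ℂ} (hf : VanishesBelow 0 (expAt a f))
    (p : ℂ[X]) : VanishesBelow 0 (expAt a (aeval f p)) := by
  rw [aeval_eq_sum_range, map_sum]
  refine .sum fun i _ => ?_
  rw [RatFunc.smul_eq_C_mul, map_mul, map_pow, expAt_C]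
  exact (VanishesBelow.C _).mul (hf.pow i)

open Polynomial in
/-- Rational functions which are the sum of a polynomial and of polynomials without constant term
in the `(lam - a s)⁻¹`. -/
def partialFractions {ι : Type*} [Fintype ι] (a : ι → ℂ) : Submodule ℂ (RatFunc ℂ) where
  carrier := {f | ∃ (p : ℂ[X]) (c : ι → ℂ[X]), f = algebraMap ℂ[X] (RatFunc ℂ) p +
    ∑ s, (RatFunc.X - RatFunc.C (a s))⁻¹ * aeval (RatFunc.X - RatFunc.C (a s))⁻¹ (c s)}
  zero_mem' := ⟨0, 0, by simp⟩
  add_mem' := by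
    rintro _ _ ⟨p, c, rfl⟩ ⟨p', c', rfl⟩
    refine ⟨p + p', c + c', ?_⟩
    simp only [map_add, Pi.add_apply, mul_add, Finset.sum_add_distrib]
    ring
  smul_mem' := by
    rintro x _ ⟨p, c, rfl⟩
    refine ⟨x • p, x • c, ?_⟩
    simp only [Pi.smul_apply, map_smul, mul_smul_comm, ← Finset.smul_sum, smul_add]
    congr 1
    rw [Algebra.smul_def, Algebra.smul_def, map_mul]
    rfl

namespace partialFractions

open Polynomial

variable {ι : Type*} [Fintype ι] {a : ι → ℂ} {f : RatFunc ℂ}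

theorem C_mul_mem (x : ℂ) (hf : f ∈ partialFractions a) :
    RatFunc.C x * f ∈ partialFractions a := by
  rw [← RatFunc.smul_eq_C_mul]
  exact Submodule.smul_mem _ _ hf

theorem X_pow_mem (k : ℕ) : RatFunc.X ^ k ∈ partialFractions a :=
  ⟨X ^ k, 0, by simp⟩

theorem C_mul_X_pow_mem (x : ℂ) (k : ℕ) : RatFunc.C x * RatFunc.X ^ k ∈ partialFractions a :=
  C_mul_mem x (X_pow_mem k)

theorem div_mem (x : ℂ) (s : ι) {k : ℕ} (hk : 1 ≤ k) :
    RatFunc.C x / (RatFunc.X - RatFunc.C (a s)) ^ k ∈ partialFractions a := by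
  classical
  obtain ⟨k, rfl⟩ := Nat.exists_eq_add_of_le' hk
  refine ⟨0, Pi.single s (monomial k x), ?_⟩
  rw [Finset.sum_eq_single s]
  · rw [Pi.single_eq_same, aeval_monomial, RatFunc.algebraMap_eq_C, map_zero, zero_add, inv_pow,
      div_eq_mul_inv, pow_succ, mul_inv]
    ring
  · intro t _ ht
    simp [Pi.single_eq_of_ne ht]
  · simp

theorem X_mul_mem (hf : f ∈ partialFractions a) : RatFunc.X * f ∈ partialFractions a := by
  obtain ⟨p, c, rfl⟩ := hf
  refine ⟨X * p + C (∑ s, (c s).coeff 0), fun s => (c s).divX + C (a s) * c s, ?_⟩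
  rw [mul_add, map_add, map_mul, RatFunc.algebraMap_X, RatFunc.algebraMap_C, add_assoc, map_sum,
    ← Finset.sum_add_distrib, Finset.mul_sum]
  congr 1
  refine Finset.sum_congr rfl fun s _ => ?_
  have h0 := X_sub_C_ne_zero (a s)
  have h1 := congrArg (aeval (RatFunc.X - RatFunc.C (a s))⁻¹) (divX_mul_X_add (c s))
  simp only [map_add, map_mul, aeval_X, aeval_C, RatFunc.algebraMap_eq_C] at h1 ⊢
  generalize aeval (RatFunc.X - RatFunc.C (a s))⁻¹ (c s) = y at *
  have h2 : RatFunc.X * ((RatFunc.X - RatFunc.C (a s))⁻¹ * y) =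
      y + RatFunc.C (a s) * ((RatFunc.X - RatFunc.C (a s))⁻¹ * y) := by
    field_simp
    ring
  rw [h2]
  nth_rewrite 1 [← h1]
  ring

theorem polyInf_mem (f : RatFunc ℂ) : polyInf f ∈ partialFractions a :=
  Submodule.sum_mem _ fun _ _ => C_mul_X_pow_mem _ _

theorem singAt_mem (s : ι) (f : RatFunc ℂ) : singAt (a s) f ∈ partialFractions a :=
  Submodule.sum_mem _ fun _ hk => div_mem _ s (Finset.mem_Icc.mp hk).1

theorem vanishesBelow_expAt (hf : f ∈ partialFractions a) {x : ℂ} (hx : ∀ s, x ≠ a s) :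
    VanishesBelow 0 (expAt x f) := by
  obtain ⟨p, c, rfl⟩ := hf
  rw [map_add, map_sum]
  refine (vanishesBelow_expAt_algebraMap x p).1.add (.sum fun s _ => ?_)
  rw [map_mul]
  exact (vanishesBelow_expAt_inv (hx s)).mul_zero_zero
    (vanishesBelow_expAt_aeval (vanishesBelow_expAt_inv (hx s)) _)

/-- Liouville: a rational function without singular part at the `a s` and without polynomial part
at infinity vanishes. -/
theorem eq_zero (ha : Function.Injective a) (hf : f ∈ partialFractions a)
    (hinf : ∀ k : ℕ, (expInf f).coeff (-(k : ℤ)) = 0)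
    (hfin : ∀ s, ∀ k : ℕ, 1 ≤ k → (expAt (a s) f).coeff (-(k : ℤ)) = 0) : f = 0 := by
  obtain ⟨p, c, rfl⟩ := hf
  have hc : ∀ s, c s = 0 := by
    intro s
    ext k
    have h := hfin s (k + 1) (by omega)
    rw [map_add, map_sum, HahnSeries.coeff_add, HahnSeries.coeff_sum,
      (vanishesBelow_expAt_algebraMap (a s) p).1 _ (by push_cast; omega), zero_add,
      Finset.sum_eq_single s] at h
    · rw [map_mul, map_inv₀, expAt_X_sub_C_self, ← pow_one (HahnSeries.single 1 1 : ℂ⸨X⸩),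
        single_neg_pow, HahnSeries.coeff_single_mul, one_mul] at h
      rw [← coeff_expAt_aeval_inv (a s) (c s) k, coeff_zero, ← h]
      congr 1
      push_cast
      ring
    · intro t _ hts
      have hst : a s ≠ a t := fun h => hts (ha h).symm
      rw [map_mul]
      exact ((vanishesBelow_expAt_inv hst).mul_zero_zero
        (vanishesBelow_expAt_aeval (vanishesBelow_expAt_inv hst) _)) _ (by push_cast; omega)
    · simp
  have hp : p = 0 := by
    ext k
    have h := hinf k
    simp only [hc, map_zero, mul_zero, Finset.sum_const_zero, add_zero] at h
    rw [← coeff_expInf_algebraMap, h, coeff_zero]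
  simp [hc, hp]

theorem ext (ha : Function.Injective a) {f h : RatFunc ℂ} (hf : f ∈ partialFractions a)
    (hh : h ∈ partialFractions a)
    (hinf : ∀ k : ℕ, (expInf f).coeff (-(k : ℤ)) = (expInf h).coeff (-(k : ℤ)))
    (hfin : ∀ s, ∀ k : ℕ, 1 ≤ k →
      (expAt (a s) f).coeff (-(k : ℤ)) = (expAt (a s) h).coeff (-(k : ℤ))) : f = h := by
  refine sub_eq_zero.mp (eq_zero ha (Submodule.sub_mem _ hf hh) (fun k => ?_) fun s k hk => ?_)
  · rw [map_sub, HahnSeries.coeff_sub, hinf, sub_self]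
  · rw [map_sub, HahnSeries.coeff_sub, hfin s k hk, sub_self]

end partialFractions

theorem coeff_expInf_sum (S : Finset ℕ) (a : ℕ → ℂ) (m : ℕ) :
    (expInf (∑ k ∈ S, RatFunc.C (a k) * RatFunc.X ^ k)).coeff (-(m : ℤ)) =
      if m ∈ S then a m else 0 := by
  rw [map_sum, HahnSeries.coeff_sum]
  have h : ∀ x ∈ S, (expInf (RatFunc.C (a x) * RatFunc.X ^ x)).coeff (-(m : ℤ)) =
      if m = x then a m else 0 := by
    intro x _
    by_cases hx : m = x
    · subst hx
      rw [expInf_C_mul_X_pow, if_pos rfl, HahnSeries.coeff_single_same]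
    · rw [expInf_C_mul_X_pow, if_neg hx, HahnSeries.coeff_single_of_ne (by omega)]
  rw [Finset.sum_congr rfl h, Finset.sum_ite_eq]

theorem coeff_expInf_C_mul_X_pow (a : ℂ) (k m : ℕ) :
    (expInf (RatFunc.C a * RatFunc.X ^ k)).coeff (-(m : ℤ)) = if m = k then a else 0 := by
  by_cases hx : m = k
  · subst hx
    rw [expInf_C_mul_X_pow, if_pos rfl, HahnSeries.coeff_single_same]
  · rw [expInf_C_mul_X_pow, if_neg hx, HahnSeries.coeff_single_of_ne (by omega)]

theorem coeff_expInf_sum_of_pos (S : Finset ℕ) (a : ℕ → ℂ) {i : ℤ} (hi : 0 < i) :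
    (expInf (∑ k ∈ S, RatFunc.C (a k) * RatFunc.X ^ k)).coeff i = 0 := by
  rw [map_sum, HahnSeries.coeff_sum]
  refine Finset.sum_eq_zero fun x _ => ?_
  rw [expInf_C_mul_X_pow, HahnSeries.coeff_single_of_ne (by omega)]

theorem vanishesBelow_expInf_sum (N : ℕ) (a : ℕ → ℂ) :
    VanishesBelow (1 - (N : ℤ)) (expInf (∑ k ∈ Finset.range N, RatFunc.C (a k) * RatFunc.X ^ k)) := by
  rw [map_sum]
  refine .sum fun k hk => ?_
  rw [expInf_C_mul_X_pow]
  exact (VanishesBelow.single _).mono (by have := Finset.mem_range.mp hk; omega)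

theorem vanishesBelow_expAt_sum (x : ℂ) (S : Finset ℕ) (a : ℕ → ℂ) :
    VanishesBelow 0 (expAt x (∑ k ∈ S, RatFunc.C (a k) * RatFunc.X ^ k)) := by
  rw [map_sum]
  exact .sum fun k _ => vanishesBelow_expAt_C_mul_X_pow _ _ _

theorem sum_mem_partialFractions {ι : Type*} [Fintype ι] {p : ι → ℂ} (S : Finset ℕ) (a : ℕ → ℂ) :
    ∑ k ∈ S, RatFunc.C (a k) * RatFunc.X ^ k ∈ partialFractions p :=
  Submodule.sum_mem _ fun _ _ => partialFractions.C_mul_X_pow_mem _ _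

namespace LaxFamily

variable {n rinf : ℕ} {r : Fin n → ℕ} {E : Type*} (D : LaxFamily n rinf r E)

/-- The space of rational functions with poles at most at infinity and at the `X_s`. -/
abbrev polarSpace (b : E) : Submodule ℂ (RatFunc ℂ) := partialFractions (fun s => D.pos s b)

variable {b : E}

theorem polarSum_mem (c : Fin n → ℕ → ℂ) : D.polarSum b c ∈ D.polarSpace b :=
  Submodule.sum_mem _ fun s _ => Submodule.sum_mem _ fun _ hk =>
    partialFractions.div_mem (a := fun s => D.pos s b) _ s (Finset.mem_Icc.mp hk).1

theorem vanishesBelow_expAt_polarSum (hpos : Function.Injective fun s => D.pos s b)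
    (c : Fin n → ℕ → ℂ) (s : Fin n) :
    VanishesBelow (-(r s : ℤ)) (expAt (D.pos s b) (D.polarSum b c)) := by
  rw [polarSum, map_sum]
  refine .sum fun t _ => ?_
  rw [map_sum]
  refine .sum fun k hk => ?_
  rcases eq_or_ne s t with rfl | hst
  · rw [lin, expAt_div_X_sub_C_pow_self]
    exact (VanishesBelow.single _).mono (by have := (Finset.mem_Icc.mp hk).2; omega)
  · exact (vanishesBelow_expAt_div (fun h => hst (hpos h)) _ _).mono (by omega)

theorem coeff_expAt_polarSum (hpos : Function.Injective fun s => D.pos s b)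
    (c : Fin n → ℕ → ℂ) (s : Fin n) {k : ℕ} (hk : 1 ≤ k) :
    (expAt (D.pos s b) (D.polarSum b c)).coeff (-(k : ℤ)) = if k ≤ r s then c s k else 0 := by
  rw [polarSum, map_sum, HahnSeries.coeff_sum, Finset.sum_eq_single s]
  · rw [map_sum, HahnSeries.coeff_sum]
    have h : ∀ x ∈ Finset.Icc 1 (r s),
        (expAt (D.pos s b) (RatFunc.C (c s x) / D.lin b s ^ x)).coeff (-(k : ℤ)) =
        if k = x then c s k else 0 := by
      intro x _
      rw [lin, expAt_div_X_sub_C_pow_self]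
      by_cases hx : k = x
      · subst hx
        rw [if_pos rfl, HahnSeries.coeff_single_same]
      · rw [if_neg hx, HahnSeries.coeff_single_of_ne (by omega)]
    rw [Finset.sum_congr rfl h, Finset.sum_ite_eq]
    simp [hk]
  · intro t _ hts
    rw [map_sum, HahnSeries.coeff_sum]
    exact Finset.sum_eq_zero fun x _ =>
      vanishesBelow_expAt_div (fun h => hts (hpos h).symm) _ _ _ (by omega)
  · simp

theorem vanishesBelow_expInf_polarSum (c : Fin n → ℕ → ℂ) :
    VanishesBelow 1 (expInf (D.polarSum b c)) := by
  rw [polarSum, map_sum]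
  refine .sum fun s _ => ?_
  rw [map_sum]
  exact .sum fun k hk => (vanishesBelow_expInf_div _ _ k).mono
    (by have := (Finset.mem_Icc.mp hk).1; omega)

theorem coeff_expInf_polarSum_one (hr : ∀ s, 1 ≤ r s) (c : Fin n → ℕ → ℂ) :
    (expInf (D.polarSum b c)).coeff 1 = ∑ s, c s 1 := by
  simp only [polarSum, lin]
  rw [map_sum, HahnSeries.coeff_sum]
  refine Finset.sum_congr rfl fun s _ => ?_
  rw [map_sum, HahnSeries.coeff_sum, Finset.sum_congr rfl fun k hk =>
    coeff_expInf_div_one (D.pos s b) (c s k) (Finset.mem_Icc.mp hk).1]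
  simp [hr s]

theorem coeff_expInf_polarSum_two (hr : ∀ s, 1 ≤ r s) (c : Fin n → ℕ → ℂ) :
    (expInf (D.polarSum b c)).coeff 2 =
      ∑ s, ((if 2 ≤ r s then c s 2 else 0) + D.pos s b * c s 1) := by
  simp only [polarSum, lin]
  rw [map_sum, HahnSeries.coeff_sum]
  refine Finset.sum_congr rfl fun s _ => ?_
  rw [map_sum, HahnSeries.coeff_sum, Finset.sum_congr rfl fun k hk =>
    coeff_expInf_div_two (D.pos s b) (c s k) (Finset.mem_Icc.mp hk).1, Finset.sum_add_distrib, ← Finset.mul_sum]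
  simp [hr s]

theorem coeff_expInf_polarSum_three (hr : ∀ s, 1 ≤ r s) (c : Fin n → ℕ → ℂ) :
    (expInf (D.polarSum b c)).coeff 3 =
      ∑ s, ((if 3 ≤ r s then c s 3 else 0) + 2 * D.pos s b * (if 2 ≤ r s then c s 2 else 0) +
        D.pos s b ^ 2 * c s 1) := by
  simp only [polarSum, lin]
  rw [map_sum, HahnSeries.coeff_sum]
  refine Finset.sum_congr rfl fun s _ => ?_
  rw [map_sum, HahnSeries.coeff_sum, Finset.sum_congr rfl fun k hk =>
    coeff_expInf_div_three (D.pos s b) (c s k) (Finset.mem_Icc.mp hk).1, Finset.sum_add_distrib,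
    Finset.sum_add_distrib, ← Finset.mul_sum, ← Finset.mul_sum]
  simp [hr s]

/-! ### Expansions of the entries of the Lax and auxiliary matrices -/

theorem laxL_apply (b : E) (i j : Fin 2) :
    D.laxL b i j = ∑ k ∈ Finset.range (rinf - 1), RatFunc.C (D.LInf (k + 1) b i j) * RatFunc.X ^ k +
      D.polarSum b fun s k => D.LX s (k - 1) b i j := by
  simp only [laxL, Matrix.add_apply, Matrix.sum_apply, Matrix.map_apply, polarSum]
  congr 1
  · rw [← Finset.Ico_succ_right_eq_Icc, Finset.sum_Ico_eq_sum_range]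
    refine Finset.sum_congr (by simp) fun k _ => ?_
    rw [add_comm 1 k, Nat.add_sub_cancel]
  · refine Finset.sum_congr rfl fun s _ => ?_
    rw [← Finset.Ico_succ_right_eq_Icc, Finset.sum_Ico_eq_sum_range]
    refine Finset.sum_congr (by simp) fun k _ => ?_
    rw [add_comm 1 k, Nat.add_sub_cancel]

theorem laxA_apply (b : E) (i j : Fin 2) :
    D.laxA b i j = ∑ k ∈ Finset.range rinf, RatFunc.C (D.AInf k b i j) * RatFunc.X ^ k +
      D.polarSum b fun s k => D.AX s k b i j := by
  simp only [laxA, Matrix.add_apply, Matrix.sum_apply, Matrix.map_apply, polarSum]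

theorem laxL_mem (i j : Fin 2) : D.laxL b i j ∈ D.polarSpace b := by
  rw [laxL_apply]
  exact Submodule.add_mem _ (sum_mem_partialFractions _ _) (D.polarSum_mem _)

theorem laxA_mem (i j : Fin 2) : D.laxA b i j ∈ D.polarSpace b := by
  rw [laxA_apply]
  exact Submodule.add_mem _ (sum_mem_partialFractions _ _) (D.polarSum_mem _)

theorem vanishesBelow_expAt_laxL (hpos : Function.Injective fun s => D.pos s b) (s : Fin n)
    (i j : Fin 2) : VanishesBelow (-(r s : ℤ)) (expAt (D.pos s b) (D.laxL b i j)) := by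
  rw [laxL_apply, map_add]
  exact ((vanishesBelow_expAt_sum _ _ _).mono (by omega)).add
    (D.vanishesBelow_expAt_polarSum hpos _ s)

theorem coeff_expInf_laxL (i j : Fin 2) (k : ℕ) :
    (expInf (D.laxL b i j)).coeff (-(k : ℤ)) =
      if k + 1 ≤ rinf - 1 then D.LInf (k + 1) b i j else 0 := by
  rw [laxL_apply, map_add, HahnSeries.coeff_add, coeff_expInf_sum,
    D.vanishesBelow_expInf_polarSum _ _ (by omega), add_zero]
  simp

theorem coeff_expInf_laxL_one (hr : ∀ s, 1 ≤ r s) (i j : Fin 2) :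
    (expInf (D.laxL b i j)).coeff 1 = (∑ s, D.LX s 0 b) i j := by
  rw [laxL_apply, map_add, HahnSeries.coeff_add, coeff_expInf_sum_of_pos _ _ one_pos,
    D.coeff_expInf_polarSum_one hr, zero_add, Matrix.sum_apply]

theorem coeff_expInf_laxL_two (hr : ∀ s, 1 ≤ r s) (i j : Fin 2) :
    (expInf (D.laxL b i j)).coeff 2 =
      (∑ s, ((if 2 ≤ r s then D.LX s 1 b else 0) + D.pos s b • D.LX s 0 b)) i j := by
  rw [laxL_apply, map_add, HahnSeries.coeff_add, coeff_expInf_sum_of_pos _ _ two_pos,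
    D.coeff_expInf_polarSum_two hr, zero_add, Matrix.sum_apply]
  refine Finset.sum_congr rfl fun s _ => ?_
  rw [Matrix.add_apply, Matrix.smul_apply, smul_eq_mul]
  congr 1
  split_ifs <;> rfl

theorem vanishesBelow_expInf_laxL (hrinf : 1 ≤ rinf) (i j : Fin 2) :
    VanishesBelow (2 - (rinf : ℤ)) (expInf (D.laxL b i j)) := by
  rw [laxL_apply, map_add]
  exact ((vanishesBelow_expInf_sum _ _).mono (by push_cast [hrinf]; omega)).add
    ((D.vanishesBelow_expInf_polarSum _).mono (by omega))

/-- Leading coefficient of the Lax matrix at infinity. -/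
theorem IsNormalized.coeff_lead (hN : D.IsNormalized b) (hrinf : 1 ≤ rinf) (hr : ∀ s, 1 ≤ r s)
    (i j : Fin 2) : (expInf (D.laxL b i j)).coeff (2 - (rinf : ℤ)) =
      (Matrix.diagonal ![-D.tInf (rinf - 1) b, D.tInf (rinf - 1) b] :
        Matrix (Fin 2) (Fin 2) ℂ) i j := by
  rcases Nat.lt_or_ge rinf 2 with h | h
  · obtain rfl : rinf = 1 := by omega
    rw [show 2 - ((1 : ℕ) : ℤ) = 1 by norm_num, D.coeff_expInf_laxL_one hr, hN.lead_one rfl]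
  · rw [show 2 - (rinf : ℤ) = -((rinf - 2 : ℕ) : ℤ) by push_cast [h]; ring, coeff_expInf_laxL,
      if_pos (by omega), ← hN.lead_ge_two h, show rinf - 2 + 1 = rinf - 1 by omega]

theorem IsNormalized.vanishesBelow_laxL_offdiag (hN : D.IsNormalized b) (hrinf : 1 ≤ rinf)
    (hr : ∀ s, 1 ≤ r s) {i j : Fin 2} (hij : i ≠ j) :
    VanishesBelow (3 - (rinf : ℤ)) (expInf (D.laxL b i j)) :=
  ((D.vanishesBelow_expInf_laxL hrinf i j).succ (by
    rw [hN.coeff_lead D hrinf hr, Matrix.diagonal_apply_ne _ hij])).mono (by omega)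

/-- The normalization fixes the leading coefficient of the upper right entry at infinity. -/
theorem IsNormalized.coeff_laxL_om (hN : D.IsNormalized b) (hrinf : 1 ≤ rinf) (hr : ∀ s, 1 ≤ r s) :
    (expInf (D.laxL b 0 1)).coeff (3 - (rinf : ℤ)) = D.om b := by
  rcases (by omega : rinf = 1 ∨ rinf = 2 ∨ 3 ≤ rinf) with rfl | rfl | h
  · rw [show 3 - ((1 : ℕ) : ℤ) = 2 by norm_num, D.coeff_expInf_laxL_two hr, hN.sub_one rfl]
  · rw [show 3 - ((2 : ℕ) : ℤ) = 1 by norm_num, D.coeff_expInf_laxL_one hr, hN.sub_two rfl]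
  · rw [show 3 - (rinf : ℤ) = -((rinf - 3 : ℕ) : ℤ) by push_cast [h]; ring, coeff_expInf_laxL,
      if_pos (by omega), ← hN.sub_ge_three h, show rinf - 3 + 1 = rinf - 2 by omega]

theorem IsNormalized.trace_laxL (hN : D.IsNormalized b) : D.laxL b 1 1 = -D.laxL b 0 0 := by
  rw [eq_neg_iff_add_eq_zero, laxL_apply, laxL_apply]
  have h1 : ∀ k ∈ Finset.range (rinf - 1),
      RatFunc.C (D.LInf (k + 1) b 1 1) * RatFunc.X ^ k +
        RatFunc.C (D.LInf (k + 1) b 0 0) * RatFunc.X ^ k = (0 : RatFunc ℂ) := by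
    intro k hk
    have := hN.trace_LInf (k + 1) (by rw [Finset.mem_range] at hk; rw [Finset.mem_Icc]; omega)
    rw [Matrix.trace_fin_two] at this
    rw [← add_mul, ← map_add, add_comm, this, map_zero, zero_mul]
  have h2 : ∀ s, ∀ k ∈ Finset.Icc 1 (r s),
      RatFunc.C (D.LX s (k - 1) b 1 1) / D.lin b s ^ k +
        RatFunc.C (D.LX s (k - 1) b 0 0) / D.lin b s ^ k = 0 := by
    intro s k hk
    have := hN.trace_LX s (k - 1) (by rw [Finset.mem_Icc] at hk; rw [Finset.mem_range]; omega)
    rw [Matrix.trace_fin_two] at this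
    rw [← add_div, ← map_add, add_comm, this, map_zero, zero_div]
  rw [add_add_add_comm, ← Finset.sum_add_distrib, Finset.sum_eq_zero h1, polarSum, polarSum,
    ← Finset.sum_add_distrib, zero_add]
  refine Finset.sum_eq_zero fun s _ => ?_
  rw [← Finset.sum_add_distrib, Finset.sum_eq_zero (h2 s)]

end LaxFamily

/-! ### Formal solutions at a pole -/

/-- If `F` has determinant one and `M F = B + F diag (t, -t)`, then
`M = B F⁻¹ + t F diag (1, -1) F⁻¹`; entrywise form. -/
theorem entries_of_birkhoff {K : Type*} [CommRing K] {F B M : Matrix (Fin 2) (Fin 2) K} {t : K}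
    (hdet : F.det = 1) (h : B + F * Matrix.diagonal ![t, -t] = M * F) :
    M 0 0 = (B 0 0 * F 1 1 - B 0 1 * F 1 0) + t * (1 + 2 * (F 0 1 * F 1 0)) ∧
    M 0 1 = (B 0 1 * F 0 0 - B 0 0 * F 0 1) - t * (2 * (F 0 0 * F 0 1)) ∧
    M 1 0 = (B 1 0 * F 1 1 - B 1 1 * F 1 0) + t * (2 * (F 1 0 * F 1 1)) ∧
    M 1 1 = (B 1 1 * F 0 0 - B 1 0 * F 0 1) - t * (1 + 2 * (F 0 1 * F 1 0)) := by
  rw [Matrix.det_fin_two] at hdet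
  have e := fun i j => congrFun (congrFun h i) j
  have e00 := e 0 0
  have e01 := e 0 1
  have e10 := e 1 0
  have e11 := e 1 1
  simp only [Matrix.add_apply, Matrix.mul_apply, Fin.sum_univ_two, Matrix.diagonal_apply_eq,
    Matrix.diagonal_apply_ne _ (zero_ne_one' (Fin 2)),
    Matrix.diagonal_apply_ne _ (one_ne_zero' (Fin 2)), mul_zero, zero_add, add_zero,
    Matrix.cons_val_zero, Matrix.cons_val_one] at e00 e01 e10 e11
  refine ⟨?_, ?_, ?_, ?_⟩
  · linear_combination (-M 0 0 + t) * hdet - F 1 1 * e00 + F 1 0 * e01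
  · linear_combination (-M 0 1) * hdet + F 0 1 * e00 - F 0 0 * e01
  · linear_combination (-M 1 0) * hdet - F 1 1 * e10 + F 1 0 * e11
  · linear_combination (-M 1 1 - t) * hdet + F 0 1 * e10 - F 0 0 * e11

theorem VanishesBelow.two_mul {m : ℤ} {f : ℂ⸨X⸩} (hf : VanishesBelow m f) :
    VanishesBelow m (2 * f) := by
  rw [_root_.two_mul]
  exact hf.add hf

/-- Local form of a connection `M` having a formal fundamental solution `F diag (e^T, e^{-T})`,
where `t` is the derivative of `T`: `M = S + t N` with `S`, `N` power series and `N ^ 2 = 1`,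
written out for three of the entries. -/
theorem exists_local_form {F B M : Matrix (Fin 2) (Fin 2) ℂ⸨X⸩} {t : ℂ⸨X⸩}
    (hF : ∀ i j, VanishesBelow 0 (F i j)) (hB : ∀ i j, VanishesBelow 0 (B i j))
    (hdet : F.det = 1) (h : B + F * Matrix.diagonal ![t, -t] = M * F) :
    ∃ S00 S01 S10 : ℂ⸨X⸩, VanishesBelow 0 S00 ∧ VanishesBelow 0 S01 ∧ VanishesBelow 0 S10 ∧
      M 0 0 = S00 + t * (1 + 2 * (F 0 1 * F 1 0)) ∧ M 0 1 = S01 - t * (2 * (F 0 0 * F 0 1)) ∧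
      M 1 0 = S10 + t * (2 * (F 1 0 * F 1 1)) := by
  obtain ⟨h00, h01, h10, -⟩ := entries_of_birkhoff hdet h
  refine ⟨_, _, _, ?_, ?_, ?_, h00, h01, h10⟩
  · exact ((hB _ _).mul_zero_zero (hF _ _)).sub ((hB _ _).mul_zero_zero (hF _ _))
  · exact ((hB _ _).mul_zero_zero (hF _ _)).sub ((hB _ _).mul_zero_zero (hF _ _))
  · exact ((hB _ _).mul_zero_zero (hF _ _)).sub ((hB _ _).mul_zero_zero (hF _ _))

/-- Minus the determinant of a trace-free `2 × 2` connection agrees with the square of the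
derivative `t` of the exponent up to the pole order of `t`. -/
theorem vanishesBelow_sq_sub {F B L : Matrix (Fin 2) (Fin 2) ℂ⸨X⸩} {t : ℂ⸨X⸩} {m k : ℤ}
    (hF : ∀ i j, VanishesBelow 0 (F i j)) (hB : ∀ i j, VanishesBelow k (B i j))
    (hdet : F.det = 1) (h : B + F * Matrix.diagonal ![t, -t] = L * F)
    (ht : VanishesBelow m t) (hmk : m ≤ k) :
    VanishesBelow (m + k) (L 0 0 ^ 2 + L 0 1 * L 1 0 - t ^ 2) := by
  obtain ⟨h00, h01, h10, -⟩ := entries_of_birkhoff hdet h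
  have hS : ∀ i j k' l i' j' k'' l', VanishesBelow k (B i j * F k' l - B i' j' * F k'' l') :=
    fun _ _ _ _ _ _ _ _ => ((hB _ _).mul' (hF _ _) (by omega)).sub
      ((hB _ _).mul' (hF _ _) (by omega))
  have hM : ∀ i j k l, VanishesBelow 0 (2 * (F i j * F k l)) :=
    fun _ _ _ _ => ((hF _ _).mul_zero_zero (hF _ _)).two_mul
  generalize hS00 : B 0 0 * F 1 1 - B 0 1 * F 1 0 = S00 at h00
  generalize hS01 : B 0 1 * F 0 0 - B 0 0 * F 0 1 = S01 at h01
  generalize hS10 : B 1 0 * F 1 1 - B 1 1 * F 1 0 = S10 at h10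
  have v00 : VanishesBelow k S00 := hS00 ▸ hS _ _ _ _ _ _ _ _
  have v01 : VanishesBelow k S01 := hS01 ▸ hS _ _ _ _ _ _ _ _
  have v10 : VanishesBelow k S10 := hS10 ▸ hS _ _ _ _ _ _ _ _
  rw [Matrix.det_fin_two] at hdet
  have key : L 0 0 ^ 2 + L 0 1 * L 1 0 - t ^ 2 =
      S00 * S00 + S01 * S10 + t * (2 * (S00 * (1 + 2 * (F 0 1 * F 1 0))) +
        S01 * (2 * (F 1 0 * F 1 1)) - S10 * (2 * (F 0 0 * F 0 1))) := by
    rw [h00, h01, h10]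
    linear_combination (-4 * t ^ 2 * F 0 1 * F 1 0) * hdet
  rw [key]
  refine ((v00.mul' v00 (by omega)).add (v01.mul' v10 (by omega))).add (ht.mul ?_)
  refine (VanishesBelow.add ?_ ?_).sub ?_
  · exact (v00.mul' (VanishesBelow.one.add (hM _ _ _ _)) (by omega)).two_mul
  · exact v01.mul' (hM _ _ _ _) (by omega)
  · exact v10.mul' (hM _ _ _ _) (by omega)

/-- Two connections `L`, `A` with a common formal solution at a finite pole, `-α` being the
derivative of the local coordinate. If the upper right entry of `L` has a pole of the
maximal order `r`, the quotient `ν = A12 / L12` has the value `-α` at the pole, it agrees with the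
quotient of the derivatives of the exponents, and `A - ν L` is regular. -/
theorem local_deformation {F B G L A : Matrix (Fin 2) (Fin 2) ℂ⸨X⸩} {t σ : ℂ⸨X⸩} {α : ℂ} {r : ℤ}
    (hr : 1 ≤ r) (hF : ∀ i j, VanishesBelow 0 (F i j)) (hB : ∀ i j, VanishesBelow 0 (B i j))
    (hG : ∀ i j, VanishesBelow 0 (G i j))
    (hdet : F.det = 1) (ht : VanishesBelow (-r) t)
    (hσ : VanishesBelow (1 - r) (σ + HahnSeries.C α * t))
    (hL : B + F * Matrix.diagonal ![t, -t] = L * F)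
    (hA : G + F * Matrix.diagonal ![σ, -σ] = A * F)
    (hlead : (L 0 1).coeff (-r) ≠ 0) (hLr : ∀ i j, VanishesBelow (-r) (L i j)) :
    VanishesBelow 0 (A 0 1 / L 0 1) ∧ (A 0 1 / L 0 1).coeff 0 = -α ∧
      VanishesBelow 0 (t * (A 0 1 / L 0 1 + HahnSeries.C α) - (σ + HahnSeries.C α * t)) ∧
      VanishesBelow 0 (A 0 0 - A 0 1 / L 0 1 * L 0 0) ∧
      VanishesBelow 0 (A 1 0 - A 0 1 / L 0 1 * L 1 0) := by
  obtain ⟨S00, S01, S10, s00, s01, s10, h00, h01, h10⟩ := exists_local_form hF hB hdet hL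
  obtain ⟨P00, P01, P10, p00, p01, p10, g00, g01, g10⟩ := exists_local_form hF hG hdet hA
  have hM : ∀ i j k l, VanishesBelow 0 (2 * (F i j * F k l)) :=
    fun _ _ _ _ => ((hF _ _).mul_zero_zero (hF _ _)).two_mul
  have hM01 : VanishesBelow 0 (2 * (F 0 0 * F 0 1)) := hM _ _ _ _
  have htr : t.coeff (-r) ≠ 0 := by
    intro h0
    apply hlead
    rw [h01, HahnSeries.coeff_sub, s01 _ (by omega), coeff_mul_lead ht hM01 (by ring), h0]
    simp
  have ht0 : t ≠ 0 := by rintro rfl; simp at htr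
  have hL0 : L 0 1 ≠ 0 := by intro h; rw [h] at hlead; simp at hlead
  have hC : VanishesBelow 0 (HahnSeries.C α : ℂ⸨X⸩) := .C α
  set η := (σ + HahnSeries.C α * t) / t with hη
  have vη : VanishesBelow 1 η := hσ.div' htr (by ring_nf; omega)
  have hηt : η * t = σ + HahnSeries.C α * t := div_mul_cancel₀ _ ht0
  have key : ∀ {a l s p m : ℂ⸨X⸩}, l = s + t * m → a = p + σ * m →
      a - (η - HahnSeries.C α) * l = p + HahnSeries.C α * s - η * s := by
    rintro a l s p m rfl rfl
    linear_combination (-m) * hηt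
  have e00 := key h00 g00
  have e01 := key (m := -(2 * (F 0 0 * F 0 1))) (h01.trans (by ring)) (g01.trans (by ring))
  have e10 := key h10 g10
  have vE : ∀ {p s : ℂ⸨X⸩}, VanishesBelow 0 p → VanishesBelow 0 s →
      VanishesBelow 0 (p + HahnSeries.C α * s - η * s) := fun hp hs =>
    (hp.add (hC.mul_zero_zero hs)).sub (vη.mul' hs (by norm_num))
  have v00 := vE p00 s00
  have v01 := vE p01 s01
  have v10 := vE p10 s10
  rw [← e00] at v00
  rw [← e01] at v01
  rw [← e10] at v10
  set N := A 0 1 / L 0 1 with hN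
  have hNL : N * L 0 1 = A 0 1 := div_mul_cancel₀ _ hL0
  -- `N = η - α + O(z ^ r)`
  have vN : VanishesBelow r (N - (η - HahnSeries.C α)) := by
    have : N - (η - HahnSeries.C α) = (A 0 1 - (η - HahnSeries.C α) * L 0 1) / L 0 1 := by
      rw [← hNL]; field_simp
    rw [this]
    exact v01.div' hlead (by omega)
  have vN0 : VanishesBelow 1 (N + HahnSeries.C α) := by
    have : N + HahnSeries.C α = (N - (η - HahnSeries.C α)) + η := by ring
    rw [this]
    exact (vN.mono hr).add vη
  refine ⟨?_, ?_, ?_, ?_, ?_⟩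
  · have : N = (N + HahnSeries.C α) - HahnSeries.C α := by ring
    rw [this]
    exact (vN0.mono (by norm_num)).sub hC
  · have := vN0 0 (by norm_num)
    rw [HahnSeries.coeff_add, HahnSeries.C_apply, HahnSeries.coeff_single_same] at this
    exact eq_neg_of_add_eq_zero_left this
  · have : t * (N + HahnSeries.C α) - (σ + HahnSeries.C α * t) =
        t * (N - (η - HahnSeries.C α)) := by
      rw [← hηt]; ring
    rw [this]
    exact ht.mul' vN (by omega)
  · have : A 0 0 - N * L 0 0 =
        (A 0 0 - (η - HahnSeries.C α) * L 0 0) - (N - (η - HahnSeries.C α)) * L 0 0 := by ring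
    rw [this]
    exact v00.sub (vN.mul' (hLr _ _) (by omega))
  · have : A 1 0 - N * L 1 0 =
        (A 1 0 - (η - HahnSeries.C α) * L 1 0) - (N - (η - HahnSeries.C α)) * L 1 0 := by ring
    rw [this]
    exact v10.sub (vN.mul' (hLr _ _) (by omega))

/-- Two connections `L`, `A` with a common formal fundamental solution `F diag (e^T, e^{-T})` at
infinity, in the local coordinate `z`, where `F` is diagonal up to `O(z)`. Here `t`, `τ` are the
derivatives of `T` along `lam` and along the deformation, and `B`, `G` those of `F`. -/
structure IsBirkhoffAtInfinity (ρ : ℤ) (F B G L A : Matrix (Fin 2) (Fin 2) ℂ⸨X⸩) (t τ : ℂ⸨X⸩) :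
    Prop where
  F_reg : ∀ i j, VanishesBelow 0 (F i j)
  F01 : VanishesBelow 1 (F 0 1)
  F10 : VanishesBelow 1 (F 1 0)
  G_reg : ∀ i j, VanishesBelow 0 (G i j)
  G01 : VanishesBelow 1 (G 0 1)
  G10 : VanishesBelow 1 (G 1 0)
  B_reg : ∀ i j, VanishesBelow 2 (B i j)
  B01 : (B 0 1).coeff 2 = -(F 0 1).coeff 1
  det : F.det = 1
  t_reg : VanishesBelow (2 - ρ) t
  τ_reg : VanishesBelow (3 - ρ) τ
  L_eq : B + F * Matrix.diagonal ![t, -t] = L * F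
  A_eq : G + F * Matrix.diagonal ![τ, -τ] = A * F

namespace IsBirkhoffAtInfinity

variable {ρ : ℤ} {F B G L A : Matrix (Fin 2) (Fin 2) ℂ⸨X⸩} {t τ : ℂ⸨X⸩}

/-- The constant terms of the diagonal entries of `F` are inverse to each other. -/
theorem coeff_F_mul (h : IsBirkhoffAtInfinity ρ F B G L A t τ) :
    (F 0 0).coeff 0 * (F 1 1).coeff 0 = 1 := by
  have h1 := congrArg (fun f => f.coeff 0) h.det
  simp only [Matrix.det_fin_two] at h1
  rw [HahnSeries.coeff_sub, coeff_mul_lead (h.F_reg 0 0) (h.F_reg 1 1) (by norm_num),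
    h.F01.mul h.F10 0 (by norm_num), sub_zero] at h1
  simpa using h1

theorem vanishesBelow_A01 (h : IsBirkhoffAtInfinity ρ F B G L A t τ) {m : ℤ} (h1 : m ≤ 1)
    (h2 : m ≤ 4 - ρ) : VanishesBelow m (A 0 1) := by
  obtain ⟨-, h01, -, -⟩ := entries_of_birkhoff h.det h.A_eq
  rw [h01]
  exact ((h.G01.mul' (h.F_reg 0 0) (by omega)).sub ((h.G_reg 0 0).mul' h.F01 (by omega))).sub
    (h.τ_reg.mul' (((h.F_reg 0 0).mul h.F01).two_mul) (by omega))

theorem vanishesBelow_A10 (h : IsBirkhoffAtInfinity ρ F B G L A t τ) {m : ℤ} (h1 : m ≤ 1)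
    (h2 : m ≤ 4 - ρ) : VanishesBelow m (A 1 0) := by
  obtain ⟨-, -, h10, -⟩ := entries_of_birkhoff h.det h.A_eq
  rw [h10]
  exact ((h.G10.mul' (h.F_reg 1 1) (by omega)).sub ((h.G_reg 1 1).mul' h.F10 (by omega))).add
    (h.τ_reg.mul' ((h.F10.mul (h.F_reg 1 1)).two_mul) (by omega))

/-- The upper left entry of `L` is the derivative of the exponent up to an explicit order. -/
theorem vanishesBelow_L00_sub (h : IsBirkhoffAtInfinity ρ F B G L A t τ) {m : ℤ} (h1 : m ≤ 2)
    (h2 : m ≤ 4 - ρ) : VanishesBelow m (L 0 0 - t) := by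
  obtain ⟨h00, -, -, -⟩ := entries_of_birkhoff h.det h.L_eq
  rw [h00, add_sub_assoc, mul_add, mul_one, add_sub_cancel_left]
  exact (((h.B_reg 0 0).mul' (h.F_reg 1 1) (by omega)).sub
    ((h.B_reg 0 1).mul' (h.F_reg 1 0) (by omega))).add
    (h.t_reg.mul' ((h.F01.mul h.F10).two_mul) (by omega))

theorem coeff_S01 (h : IsBirkhoffAtInfinity ρ F B G L A t τ) (hρ : 1 ≤ ρ) :
    (B 0 1 * F 0 0 - B 0 0 * F 0 1).coeff (3 - ρ) =
      if ρ = 1 then -((F 0 0).coeff 0 * (F 0 1).coeff 1) else 0 := by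
  split_ifs with h1
  · subst h1
    rw [HahnSeries.coeff_sub, coeff_mul_lead (h.B_reg 0 1) (h.F_reg 0 0) (by norm_num),
      (h.B_reg 0 0).mul h.F01 _ (by norm_num), h.B01]
    ring
  · exact ((((h.B_reg 0 1).mul' (h.F_reg 0 0) le_rfl).sub
      ((h.B_reg 0 0).mul' h.F01 (by norm_num))) _ (by omega))

/-- The leading coefficient of the upper right entry of `L` in terms of the solution. -/
theorem coeff_L01 (h : IsBirkhoffAtInfinity ρ F B G L A t τ) (hρ : 1 ≤ ρ) :
    (L 0 1).coeff (3 - ρ) = (-2 * t.coeff (2 - ρ) - if ρ = 1 then 1 else 0) *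
      ((F 0 0).coeff 0 * (F 0 1).coeff 1) := by
  obtain ⟨-, h01, -, -⟩ := entries_of_birkhoff h.det h.L_eq
  rw [h01, HahnSeries.coeff_sub, h.coeff_S01 hρ,
    coeff_mul_lead h.t_reg (((h.F_reg 0 0).mul h.F01).two_mul) (by ring), two_mul,
    HahnSeries.coeff_add, coeff_mul_lead (h.F_reg 0 0) h.F01 rfl]
  split_ifs <;> ring

/-- Up to `O(z)`, the difference `A11 - ν L11`, where `ν = A12 / L12`, is a constant given by the
logarithmic derivative of the leading coefficient of `L12`. -/
theorem coeff_C00 (h : IsBirkhoffAtInfinity ρ F B G L A t τ) (hρ : 1 ≤ ρ)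
    (hlead : (L 0 1).coeff (3 - ρ) ≠ 0) (hL01 : VanishesBelow (3 - ρ) (L 0 1)) :
    VanishesBelow 0 (A 0 0 - A 0 1 / L 0 1 * L 0 0) ∧
      (A 0 0 - A 0 1 / L 0 1 * L 0 0).coeff 0 * (L 0 1).coeff (3 - ρ) =
        -t.coeff (2 - ρ) * ((G 0 0).coeff 0 * (F 0 1).coeff 1 + (F 0 0).coeff 0 * (G 0 1).coeff 1) -
          if ρ = 1 then (G 0 0).coeff 0 * (F 0 1).coeff 1 else 0 := by
  have hL0 : L 0 1 ≠ 0 := by intro h; rw [h] at hlead; simp at hlead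
  have hS := h.coeff_S01 hρ
  have had := h.coeff_F_mul
  obtain ⟨h00, h01, -, -⟩ := entries_of_birkhoff h.det h.L_eq
  obtain ⟨g00, g01, -, -⟩ := entries_of_birkhoff h.det h.A_eq
  have hM00 : VanishesBelow 0 (1 + 2 * (F 0 1 * F 1 0)) :=
    VanishesBelow.one.add ((h.F_reg 0 1).mul_zero_zero (h.F_reg 1 0)).two_mul
  have hM00c : (1 + 2 * (F 0 1 * F 1 0)).coeff 0 = 1 := by
    rw [HahnSeries.coeff_add, (h.F01.mul h.F10).two_mul 0 (by norm_num)]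
    simp
  have hM01 : VanishesBelow 1 (2 * (F 0 0 * F 0 1)) := ((h.F_reg 0 0).mul h.F01).two_mul
  have hM01c : (2 * (F 0 0 * F 0 1)).coeff 1 = 2 * ((F 0 0).coeff 0 * (F 0 1).coeff 1) := by
    rw [two_mul, HahnSeries.coeff_add,
      coeff_mul_lead (h.F_reg 0 0) h.F01 (by norm_num)]
    ring
  have hS00 : VanishesBelow 2 (B 0 0 * F 1 1 - B 0 1 * F 1 0) :=
    ((h.B_reg 0 0).mul (h.F_reg 1 1)).sub ((h.B_reg 0 1).mul (h.F_reg 1 0))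
  have hS01 : VanishesBelow 2 (B 0 1 * F 0 0 - B 0 0 * F 0 1) :=
    ((h.B_reg 0 1).mul (h.F_reg 0 0)).sub ((h.B_reg 0 0).mul (h.F_reg 0 1))
  have hP00 : VanishesBelow 0 (G 0 0 * F 1 1 - G 0 1 * F 1 0) :=
    ((h.G_reg 0 0).mul (h.F_reg 1 1)).sub ((h.G_reg 0 1).mul (h.F_reg 1 0))
  have hP00c : (G 0 0 * F 1 1 - G 0 1 * F 1 0).coeff 0 =
      (G 0 0).coeff 0 * (F 1 1).coeff 0 := by
    rw [HahnSeries.coeff_sub, coeff_mul_lead (h.G_reg 0 0) (h.F_reg 1 1) (by norm_num),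
      h.G01.mul h.F10 0 (by norm_num), sub_zero]
  have hP01 : VanishesBelow 1 (G 0 1 * F 0 0 - G 0 0 * F 0 1) :=
    (h.G01.mul' (h.F_reg 0 0) (by norm_num)).sub ((h.G_reg 0 0).mul' h.F01 (by norm_num))
  have hP01c : (G 0 1 * F 0 0 - G 0 0 * F 0 1).coeff 1 =
      (G 0 1).coeff 1 * (F 0 0).coeff 0 - (G 0 0).coeff 0 * (F 0 1).coeff 1 := by
    rw [HahnSeries.coeff_sub, coeff_mul_lead h.G01 (h.F_reg 0 0) (by norm_num),
      coeff_mul_lead (h.G_reg 0 0) h.F01 (by norm_num)]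
  have ht := h.t_reg
  have hτ := h.τ_reg
  generalize B 0 0 * F 1 1 - B 0 1 * F 1 0 = S00 at *
  generalize B 0 1 * F 0 0 - B 0 0 * F 0 1 = S01 at *
  generalize G 0 0 * F 1 1 - G 0 1 * F 1 0 = P00 at *
  generalize G 0 1 * F 0 0 - G 0 0 * F 0 1 = P01 at *
  generalize 1 + 2 * (F 0 1 * F 1 0) = M00 at *
  generalize 2 * (F 0 0 * F 0 1) = M01 at *
  -- the terms in `t * τ` cancel
  have hX : (A 0 0 - A 0 1 / L 0 1 * L 0 0) * L 0 1 =
      (P00 * S01 - P01 * S00) + τ * (M00 * S01 + M01 * S00) +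
        t * (-(P00 * M01) - P01 * M00) := by
    rw [sub_mul, mul_right_comm, div_mul_cancel₀ _ hL0, h00, h01, g00, g01]
    ring
  have v1 : VanishesBelow (4 - ρ) (τ * (M00 * S01 + M01 * S00)) :=
    hτ.mul' ((hM00.mul hS01).add (hM01.mul' hS00 (by norm_num))) (by omega)
  have v2 : VanishesBelow 1 (-(P00 * M01) - P01 * M00) := (hP00.mul hM01).neg.sub (hP01.mul hM00)
  have v : VanishesBelow (3 - ρ) ((A 0 0 - A 0 1 / L 0 1 * L 0 0) * L 0 1) := by
    rw [hX]
    refine (VanishesBelow.add ?_ (v1.mono (by omega))).add (ht.mul' v2 (by omega))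
    exact (hP00.mul' hS01 (by omega)).sub (hP01.mul' hS00 (by omega))
  have v0 := v.of_mul hlead
  rw [sub_self] at v0
  refine ⟨v0, ?_⟩
  have hPS : (P00 * S01).coeff (3 - ρ) =
      if ρ = 1 then -((G 0 0).coeff 0 * (F 0 1).coeff 1) else 0 := by
    split_ifs with h1
    · subst h1
      rw [coeff_mul_lead hP00 hS01 (by norm_num), hP00c]
      rw [if_pos rfl] at hS
      norm_num at hS
      rw [hS]
      linear_combination (-(G 0 0).coeff 0 * (F 0 1).coeff 1) * had
    · exact hP00.mul hS01 _ (by omega)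
  rw [← coeff_mul_lead v0 hL01 (zero_add _).symm, hX, HahnSeries.coeff_add, HahnSeries.coeff_add,
    v1 _ (by omega), coeff_mul_lead ht v2 (by ring), HahnSeries.coeff_sub, HahnSeries.coeff_sub,
    HahnSeries.coeff_neg,
    hP01.mul hS00 _ (by omega), coeff_mul_lead hP00 hM01 (by norm_num),
    coeff_mul_lead hP01 hM00 (by norm_num), hPS, hP00c, hM01c, hP01c, hM00c]
  split_ifs
  · linear_combination (-2 * t.coeff (2 - ρ) * (G 0 0).coeff 0 * (F 0 1).coeff 1) * had
  · linear_combination (-2 * t.coeff (2 - ρ) * (G 0 0).coeff 0 * (F 0 1).coeff 1) * had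

/-- With `ν = A12 / L12`, the lower left entry of `A - ν L` is `O(z)`. -/
theorem vanishesBelow_C10 (h : IsBirkhoffAtInfinity ρ F B G L A t τ) (hρ : 3 ≤ ρ)
    (hlead : (L 0 1).coeff (3 - ρ) ≠ 0) :
    VanishesBelow 1 (A 1 0 - A 0 1 / L 0 1 * L 1 0) := by
  have hL0 : L 0 1 ≠ 0 := by intro h; rw [h] at hlead; simp at hlead
  obtain ⟨-, h01, h10, -⟩ := entries_of_birkhoff h.det h.L_eq
  obtain ⟨-, g01, g10, -⟩ := entries_of_birkhoff h.det h.A_eq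
  have hM01 : VanishesBelow 1 (2 * (F 0 0 * F 0 1)) := ((h.F_reg 0 0).mul h.F01).two_mul
  have hM10 : VanishesBelow 1 (2 * (F 1 0 * F 1 1)) := (h.F10.mul (h.F_reg 1 1)).two_mul
  have hS10 : VanishesBelow 2 (B 1 0 * F 1 1 - B 1 1 * F 1 0) :=
    ((h.B_reg 1 0).mul (h.F_reg 1 1)).sub ((h.B_reg 1 1).mul (h.F_reg 1 0))
  have hS01 : VanishesBelow 2 (B 0 1 * F 0 0 - B 0 0 * F 0 1) :=
    ((h.B_reg 0 1).mul (h.F_reg 0 0)).sub ((h.B_reg 0 0).mul (h.F_reg 0 1))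
  have hP10 : VanishesBelow 1 (G 1 0 * F 1 1 - G 1 1 * F 1 0) :=
    (h.G10.mul' (h.F_reg 1 1) (by norm_num)).sub ((h.G_reg 1 1).mul' h.F10 (by norm_num))
  have hP01 : VanishesBelow 1 (G 0 1 * F 0 0 - G 0 0 * F 0 1) :=
    (h.G01.mul' (h.F_reg 0 0) (by norm_num)).sub ((h.G_reg 0 0).mul' h.F01 (by norm_num))
  have ht := h.t_reg
  have hτ := h.τ_reg
  generalize B 1 0 * F 1 1 - B 1 1 * F 1 0 = S10 at *
  generalize B 0 1 * F 0 0 - B 0 0 * F 0 1 = S01 at *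
  generalize G 1 0 * F 1 1 - G 1 1 * F 1 0 = P10 at *
  generalize G 0 1 * F 0 0 - G 0 0 * F 0 1 = P01 at *
  generalize 2 * (F 1 0 * F 1 1) = M10 at *
  generalize 2 * (F 0 0 * F 0 1) = M01 at *
  have hX : (A 1 0 - A 0 1 / L 0 1 * L 1 0) * L 0 1 =
      (P10 * S01 - P01 * S10) + τ * (M10 * S01 + M01 * S10) +
        t * (-(P10 * M01) - P01 * M10) := by
    rw [sub_mul, mul_right_comm, div_mul_cancel₀ _ hL0, h10, h01, g10, g01]
    ring
  have v : VanishesBelow (4 - ρ) ((A 1 0 - A 0 1 / L 0 1 * L 1 0) * L 0 1) := by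
    rw [hX]
    refine (VanishesBelow.add ?_ ?_).add ?_
    · exact (hP10.mul' hS01 (by omega)).sub (hP01.mul' hS10 (by omega))
    · exact hτ.mul' ((hM10.mul hS01).add (hM01.mul hS10)) (by omega)
    · exact ht.mul' ((hP10.mul hM01).neg.sub (hP01.mul hM10)) (by omega)
  exact (v.of_mul hlead).mono (by omega)

/-- The quotient `A12 / L12` agrees with the quotient of the derivatives of the exponent. -/
theorem vanishesBelow_t_mul_sub (h : IsBirkhoffAtInfinity ρ F B G L A t τ)
    (hlead : (L 0 1).coeff (3 - ρ) ≠ 0) :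
    VanishesBelow 0 (t * (A 0 1 / L 0 1) - τ) := by
  have hL0 : L 0 1 ≠ 0 := by intro h; rw [h] at hlead; simp at hlead
  obtain ⟨-, h01, -, -⟩ := entries_of_birkhoff h.det h.L_eq
  obtain ⟨-, g01, -, -⟩ := entries_of_birkhoff h.det h.A_eq
  have hS01 : VanishesBelow 2 (B 0 1 * F 0 0 - B 0 0 * F 0 1) :=
    ((h.B_reg 0 1).mul (h.F_reg 0 0)).sub ((h.B_reg 0 0).mul (h.F_reg 0 1))
  have hP01 : VanishesBelow 1 (G 0 1 * F 0 0 - G 0 0 * F 0 1) :=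
    (h.G01.mul' (h.F_reg 0 0) (by norm_num)).sub ((h.G_reg 0 0).mul' h.F01 (by norm_num))
  have hX : (t * (A 0 1 / L 0 1) - τ) * L 0 1 =
      t * (G 0 1 * F 0 0 - G 0 0 * F 0 1) - τ * (B 0 1 * F 0 0 - B 0 0 * F 0 1) := by
    rw [sub_mul, mul_assoc, div_mul_cancel₀ _ hL0, g01, h01]
    ring
  have v : VanishesBelow (3 - ρ) ((t * (A 0 1 / L 0 1) - τ) * L 0 1) := by
    rw [hX]
    exact (h.t_reg.mul' hP01 (by omega)).sub (h.τ_reg.mul' hS01 (by omega))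
  exact (v.of_mul hlead).mono (by omega)

end IsBirkhoffAtInfinity

/-! ### Derivatives along a vector field -/

section DirDeriv

variable {E : Type*} [NormedAddCommGroup E] [NormedSpace ℂ E] {U : Set E} {v : E → E} {b : E}

theorem dirDeriv_congr (hU : IsOpen U) (hb : b ∈ U) {f h : E → ℂ} (hfh : ∀ e ∈ U, f e = h e) :
    dirDeriv v f b = dirDeriv v h b := by
  have : f =ᶠ[nhds b] h := Filter.eventually_of_mem (hU.mem_nhds hb) hfh
  rw [dirDeriv, dirDeriv, this.fderiv_eq]

theorem dirDeriv_eq_zero (hU : IsOpen U) (hb : b ∈ U) {f : E → ℂ} {c : ℂ} (hf : ∀ e ∈ U, f e = c) :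
    dirDeriv v f b = 0 := by
  rw [dirDeriv_congr hU hb hf]
  simp [dirDeriv]

theorem dirDeriv_mul {f h : E → ℂ} (hf : DifferentiableAt ℂ f b) (hh : DifferentiableAt ℂ h b) :
    dirDeriv v (fun e => f e * h e) b = dirDeriv v f b * h b + f b * dirDeriv v h b := by
  rw [dirDeriv, fderiv_fun_mul hf hh]
  simp [dirDeriv]
  ring

theorem dirDeriv_sub {f h : E → ℂ} (hf : DifferentiableAt ℂ f b) (hh : DifferentiableAt ℂ h b) :
    dirDeriv v (fun e => f e - h e) b = dirDeriv v f b - dirDeriv v h b := by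
  rw [dirDeriv, fderiv_fun_sub hf hh]
  simp [dirDeriv]

theorem dirDeriv_const_mul (c : ℂ) {f : E → ℂ} (hf : DifferentiableAt ℂ f b) :
    dirDeriv v (fun e => c * f e) b = c * dirDeriv v f b := by
  rw [dirDeriv, fderiv_const_mul hf]
  simp [dirDeriv]

theorem dirDeriv_sum {ι : Type*} {S : Finset ι} {f : ι → E → ℂ}
    (hf : ∀ i ∈ S, DifferentiableAt ℂ (f i) b) :
    dirDeriv v (fun e => ∑ i ∈ S, f i e) b = ∑ i ∈ S, dirDeriv v (f i) b := by
  rw [dirDeriv, fderiv_fun_sum hf]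
  simp [dirDeriv]

/-- Derivative along `v` of the coefficients of a family of power series. -/
def seriesDeriv (v : E → E) (f : E → ℂ⟦X⟧) (b : E) : ℂ⟦X⟧ :=
  PowerSeries.mk fun k => dirDeriv v (fun c => PowerSeries.coeff k (f c)) b

theorem seriesDeriv_mul {f h : E → ℂ⟦X⟧}
    (hf : ∀ k, DifferentiableAt ℂ (fun e => PowerSeries.coeff k (f e)) b)
    (hh : ∀ k, DifferentiableAt ℂ (fun e => PowerSeries.coeff k (h e)) b) :
    seriesDeriv v (fun e => f e * h e) b = seriesDeriv v f b * h b + f b * seriesDeriv v h b := by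
  ext k
  simp only [seriesDeriv, PowerSeries.coeff_mk, map_add, PowerSeries.coeff_mul]
  rw [dirDeriv_sum fun p _ => (hf p.1).mul (hh p.2), ← Finset.sum_add_distrib]
  exact Finset.sum_congr rfl fun p _ => dirDeriv_mul (hf p.1) (hh p.2)

/-- Jacobi's formula for a family of matrices of constant determinant. -/
theorem trace_seriesDeriv (hU : IsOpen U) (hb : b ∈ U) {F : E → Matrix (Fin 2) (Fin 2) ℂ⟦X⟧}
    (hF : ∀ i j k, DifferentiableOn ℂ (fun b => PowerSeries.coeff k (F b i j)) U)
    (hdet : ∀ e ∈ U, (F e).det = 1) :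
    seriesDeriv v (fun e => F e 0 0) b * F b 1 1 + F b 0 0 * seriesDeriv v (fun e => F e 1 1) b -
      (seriesDeriv v (fun e => F e 0 1) b * F b 1 0 +
        F b 0 1 * seriesDeriv v (fun e => F e 1 0) b) = 0 := by
  have hd : ∀ i j k, DifferentiableAt ℂ (fun e => PowerSeries.coeff k (F e i j)) b :=
    fun i j k => (hF i j k).differentiableAt (hU.mem_nhds hb)
  have hd2 : ∀ i j i' j' k,
      DifferentiableAt ℂ (fun e => PowerSeries.coeff k (F e i j * F e i' j')) b := by
    intro i j i' j' k
    simp only [PowerSeries.coeff_mul]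
    exact DifferentiableAt.fun_sum fun p _ => (hd i j p.1).mul (hd i' j' p.2)
  rw [← seriesDeriv_mul (hd 0 0) (hd 1 1), ← seriesDeriv_mul (hd 0 1) (hd 1 0)]
  ext k
  simp only [seriesDeriv, PowerSeries.coeff_mk, map_sub, map_zero]
  rw [← dirDeriv_sub (hd2 _ _ _ _ k) (hd2 _ _ _ _ k)]
  refine dirDeriv_eq_zero hU hb (c := PowerSeries.coeff k (1 : ℂ⟦X⟧)) fun e he => ?_
  rw [← map_sub, ← Matrix.det_fin_two, hdet e he]

end DirDeriv

namespace LaxFamily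

variable {n rinf : ℕ} {r : Fin n → ℕ} {E : Type*} (D : LaxFamily n rinf r E)

theorem operA12_eq (b : E) : D.operA12 b = D.laxA b 0 1 / D.laxL b 0 1 := by
  rw [operA12, gaugeG, Matrix.mul_assoc, Matrix.mul_apply, Fin.sum_univ_two, Matrix.mul_apply,
    Fin.sum_univ_two, Matrix.inv_def, Matrix.adjugate_fin_two_of, Matrix.det_fin_two_of]
  simp [div_eq_mul_inv]

theorem vanishesBelow_irrX (b : E) (s : Fin n) : VanishesBelow (-(r s : ℤ)) (D.irrX b s) :=
  .sum fun k hk => (VanishesBelow.single _).mono (by have := Finset.mem_range.mp hk; omega)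

theorem coeff_irrX (b : E) (s : Fin n) (k : ℕ) :
    (D.irrX b s).coeff (-(k : ℤ) - 1) = if k < r s then D.tX s k b else 0 := by
  rw [irrX, HahnSeries.coeff_sum]
  have h : ∀ x ∈ Finset.range (r s),
      (HahnSeries.single (-((x : ℤ) + 1)) (D.tX s x b)).coeff (-(k : ℤ) - 1) =
        if k = x then D.tX s k b else 0 := by
    intro x _
    by_cases hx : k = x
    · subst hx
      rw [if_pos rfl, show -(k : ℤ) - 1 = -((k : ℤ) + 1) by ring, HahnSeries.coeff_single_same]
    · rw [if_neg hx, HahnSeries.coeff_single_of_ne (by omega)]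
  rw [Finset.sum_congr rfl h, Finset.sum_ite_eq]
  simp

theorem vanishesBelow_irrInf (b : E) : VanishesBelow (2 - (rinf : ℤ)) (D.irrInf b) :=
  (VanishesBelow.sum fun k hk => (VanishesBelow.single _).mono
    (by have := Finset.mem_range.mp hk; omega)).neg

theorem coeff_irrInf (b : E) (k : ℕ) :
    (D.irrInf b).coeff (1 - (k : ℤ)) = if k < rinf then -D.tInf k b else 0 := by
  rw [irrInf, HahnSeries.coeff_neg, HahnSeries.coeff_sum]
  have h : ∀ x ∈ Finset.range rinf,
      (HahnSeries.single (1 - (x : ℤ)) (D.tInf x b)).coeff (1 - (k : ℤ)) =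
        if k = x then D.tInf k b else 0 := by
    intro x _
    by_cases hx : k = x
    · subst hx
      rw [if_pos rfl, HahnSeries.coeff_single_same]
    · rw [if_neg hx, HahnSeries.coeff_single_of_ne (by omega)]
  rw [Finset.sum_congr rfl h, Finset.sum_ite_eq]
  simp only [Finset.mem_range]
  split_ifs <;> simp

variable [NormedAddCommGroup E] [NormedSpace ℂ E] {v : E → E} {U : Set E} {b : E}

theorem irrXDeriv_add (b : E) (s : Fin n) :
    D.irrXDeriv v b s + HahnSeries.C (D.alphaPos v b s) * D.irrX b s =
      -∑ k ∈ Finset.Icc 1 (r s - 1),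
        HahnSeries.single (-(k : ℤ)) (D.alphaX v b s k / (k : ℂ)) := by
  rw [irrXDeriv, HahnSeries.C_mul_eq_smul, sub_add_cancel]

theorem coeff_irrXDeriv_add (b : E) (s : Fin n) {k : ℕ} (hk : 1 ≤ k) (hk' : k ≤ r s - 1) :
    (D.irrXDeriv v b s + HahnSeries.C (D.alphaPos v b s) * D.irrX b s).coeff (-(k : ℤ)) =
      -(D.alphaX v b s k / (k : ℂ)) := by
  rw [irrXDeriv_add, HahnSeries.coeff_neg, HahnSeries.coeff_sum, Finset.sum_eq_single k]
  · rw [HahnSeries.coeff_single_same]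
  · intro x _ hx
    rw [HahnSeries.coeff_single_of_ne (by omega)]
  · intro h
    exact absurd (Finset.mem_Icc.mpr ⟨hk, hk'⟩) h

theorem coeff_irrInfDeriv (b : E) {k : ℕ} (hk : 1 ≤ k) (hk' : k ≤ rinf - 1) :
    (D.irrInfDeriv v b).coeff (-(k : ℤ)) = -(D.alphaInf v b k / (k : ℂ)) := by
  rw [irrInfDeriv, HahnSeries.coeff_neg, HahnSeries.coeff_sum, Finset.sum_eq_single k]
  · rw [HahnSeries.coeff_single_same]
  · intro x _ hx
    rw [HahnSeries.coeff_single_of_ne (by omega)]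
  · intro h
    exact absurd (Finset.mem_Icc.mpr ⟨hk, hk'⟩) h

variable {D}

theorem IsIsomonodromic.alphaInf_lead (hU : IsOpen U) (hD : D.IsIsomonodromic U v) (hb : b ∈ U)
    (h : 2 ≤ rinf) : D.alphaInf v b (rinf - 1) = 0 := by
  refine dirDeriv_eq_zero hU hb (c := 1) fun e he => ?_
  rcases eq_or_lt_of_le h with rfl | h3
  · exact ((hD.trivialTimes e he).two rfl).1
  · exact ((hD.trivialTimes e he).ge_three h3).1

theorem IsIsomonodromic.alphaInf_sublead (hU : IsOpen U) (hD : D.IsIsomonodromic U v) (hb : b ∈ U)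
    (h : 3 ≤ rinf) : D.alphaInf v b (rinf - 2) = 0 :=
  dirDeriv_eq_zero hU hb (c := 0) fun e he => ((hD.trivialTimes e he).ge_three h).2

theorem IsIsomonodromic.tInf_lead_const (hD : D.IsIsomonodromic U v) (hrinf : 1 ≤ rinf)
    (hb : b ∈ U) {e : E} (he : e ∈ U) : D.tInf (rinf - 1) e = D.tInf (rinf - 1) b := by
  rcases (by omega : rinf = 1 ∨ rinf = 2 ∨ 3 ≤ rinf) with rfl | rfl | h
  · exact hD.tInf_zero_const e he b hb
  · exact ((hD.trivialTimes e he).two rfl).1.trans ((hD.trivialTimes b hb).two rfl).1.symm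
  · exact ((hD.trivialTimes e he).ge_three h).1.trans
      ((hD.trivialTimes b hb).ge_three h).1.symm

theorem IsIsomonodromic.tInf_lead_ne_zero (hD : D.IsIsomonodromic U v) (hrinf : 1 ≤ rinf)
    (hb : b ∈ U) : D.tInf (rinf - 1) b ≠ 0 := by
  rcases (by omega : rinf = 1 ∨ rinf = 2 ∨ 3 ≤ rinf) with rfl | rfl | h
  · intro h0
    have hN := hD.normalized b hb
    have h1 := hN.eig_inf_one rfl
    have h0' : D.tInf 0 b = 0 := h0
    have hz : (Matrix.diagonal ![-D.tInf 0 b, D.tInf 0 b] : Matrix (Fin 2) (Fin 2) ℂ) = 0 := by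
      rw [h0']
      ext i j
      fin_cases i <;> fin_cases j <;> simp
    rw [hN.lead_one rfl, hz, Matrix.charpoly_zero] at h1
    simp [two_nsmul] at h1
  · rw [show (2 : ℕ) - 1 = 1 from rfl, ((hD.trivialTimes b hb).two rfl).1]
    exact one_ne_zero
  · rw [((hD.trivialTimes b hb).ge_three h).1]
    exact one_ne_zero

theorem IsIsomonodromic.vanishesBelow_irrInfDeriv (hU : IsOpen U) (hD : D.IsIsomonodromic U v)
    (hb : b ∈ U) : VanishesBelow (3 - (rinf : ℤ)) (D.irrInfDeriv v b) := by
  refine (VanishesBelow.sum fun k hk => ?_).neg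
  rw [Finset.mem_Icc] at hk
  rcases (by omega : k = rinf - 1 ∨ (k = rinf - 2 ∧ 3 ≤ rinf) ∨ k ≤ rinf - 3) with h | ⟨h, h3⟩ | h
  · rw [h, hD.alphaInf_lead hU hb (by omega)]
    simpa using VanishesBelow.zero _
  · rw [h, hD.alphaInf_sublead hU hb h3]
    simpa using VanishesBelow.zero _
  · exact (VanishesBelow.single _).mono (by omega)

theorem coeff_toLaurent (F : Matrix (Fin 2) (Fin 2) ℂ⟦X⟧) (i j : Fin 2) (k : ℕ) :
    (toLaurent F i j).coeff (k : ℤ) = PowerSeries.coeff k (F i j) := by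
  rw [toLaurent, Matrix.map_apply, PowerSeries.coeff_coe, if_neg (by omega)]
  simp

theorem coeff_zero_toLaurent (F : Matrix (Fin 2) (Fin 2) ℂ⟦X⟧) (i j : Fin 2) :
    (toLaurent F i j).coeff 0 = PowerSeries.coeff 0 (F i j) := by
  simpa using coeff_toLaurent F i j 0

theorem coeff_one_toLaurent (F : Matrix (Fin 2) (Fin 2) ℂ⟦X⟧) (i j : Fin 2) :
    (toLaurent F i j).coeff 1 = PowerSeries.coeff 1 (F i j) := by
  simpa using coeff_toLaurent F i j 1

theorem det_toLaurent {F : Matrix (Fin 2) (Fin 2) ℂ⟦X⟧} (hF : F.det = 1) :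
    (toLaurent F).det = 1 := by
  have := congrArg (HahnSeries.ofPowerSeries ℤ ℂ) hF
  rwa [RingHom.map_det, map_one] at this

theorem vanishesBelow_toLaurent (F : Matrix (Fin 2) (Fin 2) ℂ⟦X⟧) (i j : Fin 2) :
    VanishesBelow 0 (toLaurent F i j) :=
  .ofPowerSeries _

theorem coeffDeriv_apply (F : E → Matrix (Fin 2) (Fin 2) ℂ⟦X⟧) (i j : Fin 2) :
    coeffDeriv v F b i j = HahnSeries.ofPowerSeries ℤ ℂ (seriesDeriv v (fun e => F e i j) b) :=
  rfl

/-- The gauge matrix `F` at infinity is diagonal at leading order, since it commutes with the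
leading coefficient of the Lax matrix. -/
theorem IsFormalSolutionInf.coeff_offdiag (hD : D.IsIsomonodromic U v) (hrinf : 1 ≤ rinf)
    (hr : ∀ s, 1 ≤ r s) {F : E → Matrix (Fin 2) (Fin 2) ℂ⟦X⟧}
    (hF : D.IsFormalSolutionInf U v F) (hb : b ∈ U) :
    PowerSeries.coeff 0 (F b 0 1) = 0 ∧ PowerSeries.coeff 0 (F b 1 0) = 0 := by
  have ht := hD.tInf_lead_ne_zero hrinf hb
  have hN := hD.normalized b hb
  have hFr := vanishesBelow_toLaurent (F b)
  have hL := D.vanishesBelow_expInf_laxL (b := b) hrinf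
  have htr := D.vanishesBelow_irrInf b
  have htc : (D.irrInf b).coeff (2 - (rinf : ℤ)) = -D.tInf (rinf - 1) b := by
    have := D.coeff_irrInf b (rinf - 1)
    rw [if_pos (by omega)] at this
    rw [← this]
    congr 1
    push_cast [hrinf]
    ring
  have hB : ∀ i j, VanishesBelow 2
      ((-((HahnSeries.single 2 1 : ℂ⸨X⸩) • dz (F b))) i j) := fun i j =>
    ((VanishesBelow.single _).mul' (VanishesBelow.ofPowerSeries (F b i j)).derivative
      (by norm_num)).neg
  have e := fun i j => congrFun (congrFun (hF.lam_eq b hb) i) j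
  have e01 := congrArg (fun f => f.coeff (2 - (rinf : ℤ))) (e 0 1)
  have e10 := congrArg (fun f => f.coeff (2 - (rinf : ℤ))) (e 1 0)
  simp only [Matrix.add_apply, Matrix.mul_apply, Fin.sum_univ_two, Matrix.diagonal_apply_eq,
    Matrix.diagonal_apply_ne _ (zero_ne_one' (Fin 2)),
    Matrix.diagonal_apply_ne _ (one_ne_zero' (Fin 2)), mul_zero, zero_add, add_zero,
    Matrix.cons_val_zero, Matrix.cons_val_one, Matrix.map_apply] at e01 e10
  rw [HahnSeries.coeff_add, hB 0 1 _ (by omega), HahnSeries.coeff_add,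
    coeff_mul_lead (hFr _ _) htr.neg (by ring), coeff_mul_lead (hL _ _) (hFr _ _) (by ring),
    coeff_mul_lead (hL _ _) (hFr _ _) (by ring), HahnSeries.coeff_neg, htc,
    hN.coeff_lead D hrinf hr, hN.coeff_lead D hrinf hr, coeff_zero_toLaurent,
    coeff_zero_toLaurent] at e01
  rw [HahnSeries.coeff_add, hB 1 0 _ (by omega), HahnSeries.coeff_add,
    coeff_mul_lead (hFr _ _) htr (by ring), coeff_mul_lead (hL _ _) (hFr _ _) (by ring),
    coeff_mul_lead (hL _ _) (hFr _ _) (by ring), htc,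
    hN.coeff_lead D hrinf hr, hN.coeff_lead D hrinf hr, coeff_zero_toLaurent,
    coeff_zero_toLaurent] at e10
  simp only [Matrix.diagonal_apply_eq,
    Matrix.diagonal_apply_ne _ (zero_ne_one' (Fin 2)),
    Matrix.diagonal_apply_ne _ (one_ne_zero' (Fin 2)), zero_mul, zero_add, add_zero,
    Matrix.cons_val_zero, Matrix.cons_val_one] at e01 e10
  constructor
  · have : 2 * D.tInf (rinf - 1) b * PowerSeries.coeff 0 (F b 0 1) = 0 := by
      linear_combination e01
    exact (mul_eq_zero.mp this).resolve_left (mul_ne_zero two_ne_zero ht)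
  · have : 2 * D.tInf (rinf - 1) b * PowerSeries.coeff 0 (F b 1 0) = 0 := by
      linear_combination -e10
    exact (mul_eq_zero.mp this).resolve_left (mul_ne_zero two_ne_zero ht)

theorem IsFormalSolutionInf.isBirkhoff (hU : IsOpen U) (hD : D.IsIsomonodromic U v)
    (hrinf : 1 ≤ rinf) (hr : ∀ s, 1 ≤ r s) {F : E → Matrix (Fin 2) (Fin 2) ℂ⟦X⟧}
    (hF : D.IsFormalSolutionInf U v F) (hb : b ∈ U) :
    IsBirkhoffAtInfinity rinf (toLaurent (F b)) (-((HahnSeries.single 2 1 : ℂ⸨X⸩) • dz (F b)))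
      (coeffDeriv v F b) ((D.laxL b).map expInf) ((D.laxA b).map expInf) (D.irrInf b)
      (D.irrInfDeriv v b) where
  F_reg := vanishesBelow_toLaurent _
  F01 := (vanishesBelow_toLaurent (F b) 0 1).succ (by
    rw [coeff_zero_toLaurent, (hF.coeff_offdiag hD hrinf hr hb).1])
  F10 := (vanishesBelow_toLaurent (F b) 1 0).succ (by
    rw [coeff_zero_toLaurent, (hF.coeff_offdiag hD hrinf hr hb).2])
  G_reg := vanishesBelow_toLaurent _
  G01 := (vanishesBelow_toLaurent _ 0 1).succ (by
    rw [coeff_zero_toLaurent, Matrix.of_apply, PowerSeries.coeff_mk]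
    exact dirDeriv_eq_zero hU hb fun e he => (hF.coeff_offdiag hD hrinf hr he).1)
  G10 := (vanishesBelow_toLaurent _ 1 0).succ (by
    rw [coeff_zero_toLaurent, Matrix.of_apply, PowerSeries.coeff_mk]
    exact dirDeriv_eq_zero hU hb fun e he => (hF.coeff_offdiag hD hrinf hr he).2)
  B_reg := fun i j => ((VanishesBelow.single _).mul'
    (VanishesBelow.ofPowerSeries (F b i j)).derivative (by norm_num)).neg
  B01 := by
    rw [Matrix.neg_apply, Matrix.smul_apply, HahnSeries.coeff_neg, smul_eq_mul,
      HahnSeries.coeff_single_mul, dz, Matrix.map_apply, LaurentSeries.derivative_apply,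
      LaurentSeries.hasseDeriv_coeff]
    simp
  det := det_toLaurent (hF.det_eq_one b hb)
  t_reg := D.vanishesBelow_irrInf b
  τ_reg := hD.vanishesBelow_irrInfDeriv hU hb
  L_eq := hF.lam_eq b hb
  A_eq := hF.deform_eq b hb

theorem IsIsomonodromic.trace_laxA (hU : IsOpen U) (hD : D.IsIsomonodromic U v)
    (hrinf : 1 ≤ rinf) (hr : ∀ s, 1 ≤ r s) (hb : b ∈ U) :
    D.laxA b 1 1 = -D.laxA b 0 0 := by
  obtain ⟨F, hF⟩ := hD.formal_inf
  have h := hF.isBirkhoff hU hD hrinf hr hb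
  obtain ⟨h00, -, -, h11⟩ := entries_of_birkhoff h.det h.A_eq
  have ht := congrArg (HahnSeries.ofPowerSeries ℤ ℂ)
    (trace_seriesDeriv (v := v) hU hb hF.coeff_differentiable hF.det_eq_one)
  simp only [map_sub, map_add, map_mul, map_zero] at ht
  apply expInf.injective
  rw [map_neg]
  rw [Matrix.map_apply] at h00 h11
  rw [h00, h11]
  simp only [coeffDeriv_apply, toLaurent, Matrix.map_apply]
  linear_combination ht

/-- The constant term of `A11 - ν L11` at infinity. -/
theorem IsIsomonodromic.expInf_C00 (hU : IsOpen U) (hD : D.IsIsomonodromic U v)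
    (hrinf : 1 ≤ rinf) (hr : ∀ s, 1 ≤ r s) (hb : b ∈ U) :
    VanishesBelow 0 (expInf (D.laxA b 0 0 - D.operA12 b * D.laxL b 0 0)) ∧
      (expInf (D.laxA b 0 0 - D.operA12 b * D.laxL b 0 0)).coeff 0 =
        1 / (2 * D.om b) * dirDeriv v D.om b +
          if rinf = 1 then 1 / 2 * D.nuInf b (-1) else 0 := by
  obtain ⟨F, hF⟩ := hD.formal_inf
  have h := hF.isBirkhoff hU hD hrinf hr hb
  have hN := hD.normalized b hb
  have hom := hN.om_ne_zero
  have htc : (D.irrInf b).coeff (2 - (rinf : ℤ)) = -D.tInf (rinf - 1) b := by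
    have := D.coeff_irrInf b (rinf - 1)
    rw [if_pos (by omega)] at this
    rw [← this]
    congr 1
    push_cast [hrinf]
    ring
  -- the leading coefficient of `L12` as a function on `U`
  have hom_eq : ∀ e ∈ U, D.om e = (2 * D.tInf (rinf - 1) b - if rinf = 1 then 1 else 0) *
      (PowerSeries.coeff 0 (F e 0 0) * PowerSeries.coeff 1 (F e 0 1)) := by
    intro e he
    have h1 := (hF.isBirkhoff hU hD hrinf hr he).coeff_L01 (by exact_mod_cast hrinf)
    rw [Matrix.map_apply, (hD.normalized e he).coeff_laxL_om D hrinf hr, coeff_zero_toLaurent,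
      coeff_one_toLaurent] at h1
    have htc' : (D.irrInf e).coeff (2 - (rinf : ℤ)) = -D.tInf (rinf - 1) b := by
      have := D.coeff_irrInf e (rinf - 1)
      rw [if_pos (by omega), hD.tInf_lead_const hrinf hb he] at this
      rw [← this]
      congr 1
      push_cast [hrinf]
      ring
    rw [h1, htc']
    simp only [Nat.cast_eq_one]
    ring
  have hd : ∀ i j k, DifferentiableAt ℂ (fun e => PowerSeries.coeff k (F e i j)) b :=
    fun i j k => (hF.coeff_differentiable i j k).differentiableAt (hU.mem_nhds hb)
  have hdom := dirDeriv_congr (v := v) hU hb hom_eq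
  rw [dirDeriv_const_mul _ ((hd 0 0 0).fun_mul (hd 0 1 1)), dirDeriv_mul (hd 0 0 0) (hd 0 1 1)] at hdom
  have hL01 := hN.vanishesBelow_laxL_offdiag D hrinf hr (zero_ne_one' (Fin 2))
  have hlead : (((D.laxL b).map expInf) 0 1).coeff (3 - (rinf : ℤ)) ≠ 0 := by
    rw [Matrix.map_apply, hN.coeff_laxL_om D hrinf hr]
    exact hom
  obtain ⟨h0, hc⟩ := h.coeff_C00 (by exact_mod_cast hrinf) hlead hL01
  have hG0 : (coeffDeriv v F b 0 0).coeff 0 =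
      dirDeriv v (fun e => PowerSeries.coeff 0 (F e 0 0)) b := by
    rw [coeffDeriv, coeff_zero_toLaurent, Matrix.of_apply, PowerSeries.coeff_mk]
  have hG1 : (coeffDeriv v F b 0 1).coeff 1 =
      dirDeriv v (fun e => PowerSeries.coeff 1 (F e 0 1)) b := by
    rw [coeffDeriv, coeff_one_toLaurent, Matrix.of_apply, PowerSeries.coeff_mk]
  have hnu : rinf = 1 → D.nuInf b (-1) * D.om b =
      dirDeriv v (fun e => PowerSeries.coeff 1 (F e 0 1)) b * PowerSeries.coeff 0 (F b 0 0) -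
        dirDeriv v (fun e => PowerSeries.coeff 0 (F e 0 0)) b * PowerSeries.coeff 1 (F b 0 1) := by
    rintro rfl
    obtain ⟨-, g01, -, -⟩ := entries_of_birkhoff h.det h.A_eq
    have hA1 := h.vanishesBelow_A01 (m := 1) le_rfl (by norm_num)
    have hν : VanishesBelow (-1) (expInf (D.operA12 b)) := by
      rw [operA12_eq, map_div₀]
      exact hA1.div' hlead (by norm_num)
    rw [nuInf, ← hN.coeff_laxL_om D hrinf hr, ← coeff_mul_lead hν hL01 (m := 1) (by norm_num),
      operA12_eq, ← map_mul, div_mul_cancel₀]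
    · rw [Matrix.map_apply] at g01
      rw [g01, HahnSeries.coeff_sub, h.τ_reg.mul (((h.F_reg 0 0).mul h.F01).two_mul) 1 (by norm_num),
        sub_zero, HahnSeries.coeff_sub, coeff_mul_lead h.G01 (h.F_reg 0 0) (by norm_num),
        coeff_mul_lead (h.G_reg 0 0) h.F01 (by norm_num), hG0, hG1, coeff_zero_toLaurent,
        coeff_one_toLaurent]
    · intro h0
      apply hlead
      rw [Matrix.map_apply, h0]
      simp
  have hC : expInf (D.laxA b 0 0 - D.operA12 b * D.laxL b 0 0) =
      ((D.laxA b).map expInf) 0 0 - ((D.laxA b).map expInf) 0 1 / ((D.laxL b).map expInf) 0 1 *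
        ((D.laxL b).map expInf) 0 0 := by
    simp only [operA12_eq, map_sub, map_mul, map_div₀, Matrix.map_apply]
  rw [hC]
  refine ⟨h0, ?_⟩
  have hom' : (((D.laxL b).map expInf) 0 1).coeff (3 - (rinf : ℤ)) = D.om b :=
    hN.coeff_laxL_om D hrinf hr
  rw [hom'] at hc
  refine mul_right_cancel₀ hom ?_
  rw [hc, htc, hG0, hG1, coeff_zero_toLaurent, coeff_one_toLaurent, hdom]
  simp only [Nat.cast_eq_one]
  split_ifs with h1
  · rw [add_mul, mul_assoc (1 / 2 : ℂ), hnu h1]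
    field_simp
    ring
  · field_simp
    ring

/-- The remaining consequences of the existence of a formal solution at infinity. -/
theorem IsIsomonodromic.expInf_bounds (hU : IsOpen U) (hD : D.IsIsomonodromic U v)
    (hrinf : 1 ≤ rinf) (hr : ∀ s, 1 ≤ r s) (hb : b ∈ U) :
    VanishesBelow (4 - (rinf : ℤ))
        (expInf (D.laxL b 0 0 ^ 2 + D.laxL b 0 1 * D.laxL b 1 0) - D.irrInf b ^ 2) ∧
      VanishesBelow (min 2 (4 - (rinf : ℤ))) (expInf (D.laxL b 0 0) - D.irrInf b) ∧
      VanishesBelow (min 1 (4 - (rinf : ℤ))) (expInf (D.laxA b 0 1)) ∧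
      VanishesBelow (min 1 (4 - (rinf : ℤ))) (expInf (D.laxA b 1 0)) ∧
      (3 ≤ rinf → VanishesBelow 1 (expInf (D.laxA b 1 0 - D.operA12 b * D.laxL b 1 0))) ∧
      VanishesBelow 0 (D.irrInf b * expInf (D.operA12 b) - D.irrInfDeriv v b) := by
  obtain ⟨F, hF⟩ := hD.formal_inf
  have h := hF.isBirkhoff hU hD hrinf hr hb
  have hlead : (((D.laxL b).map expInf) 0 1).coeff (3 - (rinf : ℤ)) ≠ 0 := by
    rw [Matrix.map_apply, (hD.normalized b hb).coeff_laxL_om D hrinf hr]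
    exact (hD.normalized b hb).om_ne_zero
  refine ⟨?_, h.vanishesBelow_L00_sub (min_le_left _ _) (min_le_right _ _),
    h.vanishesBelow_A01 (min_le_left _ _) (min_le_right _ _),
    h.vanishesBelow_A10 (min_le_left _ _) (min_le_right _ _), fun h3 => ?_, ?_⟩
  · have := vanishesBelow_sq_sub h.F_reg h.B_reg h.det h.L_eq h.t_reg (by omega)
    rw [show 2 - (rinf : ℤ) + 2 = 4 - rinf by ring] at this
    simpa only [map_add, map_mul, map_pow, Matrix.map_apply] using this
  · have := h.vanishesBelow_C10 (by exact_mod_cast h3) hlead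
    simpa only [operA12_eq, map_sub, map_mul, map_div₀, Matrix.map_apply] using this
  · have := h.vanishesBelow_t_mul_sub hlead
    simpa only [operA12_eq, map_div₀, Matrix.map_apply] using this

/-- Consequences of the existence of a formal solution at a finite pole where the upper right entry
of the Lax matrix has the maximal pole order. -/
theorem IsIsomonodromic.expAt_bounds (hD : D.IsIsomonodromic U v) (hr : ∀ s, 1 ≤ r s) (hb : b ∈ U)
    (s : Fin n) (hlead : (expAt (D.pos s b) (D.laxL b 0 1)).coeff (-(r s : ℤ)) ≠ 0) :
    VanishesBelow (-(r s : ℤ))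
        (expAt (D.pos s b) (D.laxL b 0 0 ^ 2 + D.laxL b 0 1 * D.laxL b 1 0) - D.irrX b s ^ 2) ∧
      VanishesBelow 0 (expAt (D.pos s b) (D.operA12 b)) ∧ D.nuX b s 0 = -D.alphaPos v b s ∧
      VanishesBelow 0
        (D.irrX b s * (expAt (D.pos s b) (D.operA12 b) + HahnSeries.C (D.alphaPos v b s)) -
          (D.irrXDeriv v b s + HahnSeries.C (D.alphaPos v b s) * D.irrX b s)) ∧
      VanishesBelow 0 (expAt (D.pos s b) (D.laxA b 0 0 - D.operA12 b * D.laxL b 0 0)) ∧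
      VanishesBelow 0 (expAt (D.pos s b) (D.laxA b 1 0 - D.operA12 b * D.laxL b 1 0)) := by
  obtain ⟨F, hF⟩ := hD.formal_X s
  have hpos := (hD.normalized b hb).pos_injective
  have hdz : ∀ i j, VanishesBelow 0 (dz (F b) i j) := fun i j =>
    (VanishesBelow.ofPowerSeries (F b i j)).derivative
  have hσ : VanishesBelow (1 - (r s : ℤ))
      (D.irrXDeriv v b s + HahnSeries.C (D.alphaPos v b s) * D.irrX b s) := by
    rw [irrXDeriv_add]
    exact (VanishesBelow.sum fun k hk => (VanishesBelow.single _).mono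
      (by have := Finset.mem_Icc.mp hk; omega)).neg
  have hG : ∀ i j, VanishesBelow 0 ((coeffDeriv v F b - D.alphaPos v b s • dz (F b)) i j) := by
    intro i j
    refine (vanishesBelow_toLaurent _ i j).sub fun m hm => ?_
    rw [Matrix.smul_apply, HahnSeries.coeff_smul, hdz i j m hm, smul_zero]
  have h1 := vanishesBelow_sq_sub (vanishesBelow_toLaurent (F b)) hdz
    (det_toLaurent (hF.det_eq_one b hb)) (hF.lam_eq b hb) (D.vanishesBelow_irrX b s) (by omega)
  obtain ⟨h2, h3, h4, h5, h6⟩ := local_deformation (r := r s) (by exact_mod_cast hr s)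
    (vanishesBelow_toLaurent (F b)) hdz hG
    (det_toLaurent (hF.det_eq_one b hb)) (D.vanishesBelow_irrX b s) hσ (hF.lam_eq b hb)
    (hF.deform_eq b hb) hlead (fun i j => D.vanishesBelow_expAt_laxL hpos s i j)
  rw [add_zero] at h1
  simp only [Matrix.map_apply, ← map_div₀, ← map_mul, ← map_sub, ← map_add, ← map_pow,
    ← operA12_eq] at h1 h2 h3 h5 h6
  refine ⟨h1, h2, h3, ?_, h5, h6⟩
  simpa only [operA12_eq, map_div₀, Matrix.map_apply] using h4

end LaxFamily

/-! ### Finite convolution formulas and leading terms -/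

/-- Convolution formula for a series with a pole of order at most `r` and a power series. -/
theorem coeff_mul_neg {r : ℕ} {f h : ℂ⸨X⸩} (hf : VanishesBelow (-(r : ℤ)) f)
    (hh : VanishesBelow 0 h) (k : ℕ) :
    (f * h).coeff (-(k : ℤ)) =
      ∑ j ∈ Finset.Icc k r, f.coeff (-(j : ℤ)) * h.coeff ((j - k : ℕ) : ℤ) := by
  rw [coeff_mul_of_vanishesBelow hf hh]
  refine Finset.sum_nbij' (fun i => (-i).toNat) (fun j => -(j : ℤ)) ?_ ?_ ?_ ?_ ?_
  · intro i hi
    rw [Finset.mem_Icc] at *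
    omega
  · intro j hj
    rw [Finset.mem_Icc] at *
    omega
  · intro i hi
    rw [Finset.mem_Icc] at hi
    omega
  · intro j _
    simp
  · intro i hi
    rw [Finset.mem_Icc] at hi
    have h1 : -(((-i).toNat : ℕ) : ℤ) = i := by omega
    have h2 : (((-i).toNat - k : ℕ) : ℤ) = -(k : ℤ) - i := by omega
    rw [h1, h2]

/-- `f = z ^ e (1 + d z + O(z ^ 2))`. -/
structure HasLead (e : ℤ) (d : ℂ) (f : ℂ⸨X⸩) : Prop where
  vanishes : VanishesBelow e f
  lead : f.coeff e = 1
  next : f.coeff (e + 1) = d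

namespace HasLead

theorem one : HasLead 0 0 1 where
  vanishes := VanishesBelow.one
  lead := by simp
  next := by rw [← HahnSeries.single_zero_one, HahnSeries.coeff_single_of_ne (by norm_num)]

theorem mul {e e' : ℤ} {d d' : ℂ} {f f' : ℂ⸨X⸩} (h : HasLead e d f) (h' : HasLead e' d' f') :
    HasLead (e + e') (d + d') (f * f') where
  vanishes := h.vanishes.mul h'.vanishes
  lead := by rw [coeff_mul_lead h.vanishes h'.vanishes rfl, h.lead, h'.lead, mul_one]
  next := by
    rw [coeff_mul_lead_succ h.vanishes h'.vanishes rfl, h.lead, h'.lead, h.next, h'.next]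
    ring

theorem pow {e : ℤ} {d : ℂ} {f : ℂ⸨X⸩} (h : HasLead e d f) :
    ∀ k : ℕ, HasLead (k * e) (k * d) (f ^ k)
  | 0 => by simpa using one
  | k + 1 => by
    have := (pow h k).mul h
    rw [pow_succ]
    convert this using 1 <;> push_cast <;> ring

theorem prod {ι : Type*} {S : Finset ι} {e : ι → ℤ} {d : ι → ℂ} {f : ι → ℂ⸨X⸩}
    (h : ∀ i ∈ S, HasLead (e i) (d i) (f i)) :
    HasLead (∑ i ∈ S, e i) (∑ i ∈ S, d i) (∏ i ∈ S, f i) := by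
  classical
  induction S using Finset.induction_on with
  | empty => simpa using one
  | insert a S ha ih =>
    rw [Finset.sum_insert ha, Finset.sum_insert ha, Finset.prod_insert ha]
    exact (h a (Finset.mem_insert_self _ _)).mul
      (ih fun i hi => h i (Finset.mem_insert_of_mem hi))

theorem X_sub_C (a : ℂ) : HasLead (-1) (-a) (expInf (RatFunc.X - RatFunc.C a)) where
  vanishes := (coeff_expInf_X_sub_C a).1
  lead := (coeff_expInf_X_sub_C a).2.1
  next := (coeff_expInf_X_sub_C a).2.2

end HasLead

theorem coeff_expInf_inv_succ (a : ℂ) (m : ℕ) :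
    (expInf (RatFunc.X - RatFunc.C a)⁻¹).coeff ((m + 1 : ℕ) : ℤ) = a ^ m := by
  have h := fun m => coeff_expInf_div_succ a 1 0 m
  simp only [map_one, zero_add, pow_one, pow_zero, one_div, inv_one] at h
  induction m with
  | zero =>
    have h0 := h 0
    rw [vanishesBelow_expInf_inv a 0 (by norm_num)] at h0
    simpa using h0
  | succ m ih =>
    have h1 := h ((m + 1 : ℕ) : ℤ)
    rw [ih, HahnSeries.coeff_one, if_neg (by omega)] at h1
    push_cast at h1 ⊢
    rw [h1]
    ring

theorem coeff_expAt_inv {a c : ℂ} (hac : a ≠ c) (m : ℕ) :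
    (expAt a (RatFunc.X - RatFunc.C c)⁻¹).coeff (m : ℤ) = -((c - a) ^ (m + 1))⁻¹ := by
  have hne : c - a ≠ 0 := sub_ne_zero.mpr hac.symm
  have hreg := vanishesBelow_expAt_inv hac
  have h : (HahnSeries.single 1 1 + HahnSeries.C (a - c)) *
      expAt a (RatFunc.X - RatFunc.C c)⁻¹ = 1 := by
    rw [← expAt_X_sub_C, ← map_mul, mul_inv_cancel₀ (X_sub_C_ne_zero c), map_one]
  have hrec : ∀ m : ℤ, (expAt a (RatFunc.X - RatFunc.C c)⁻¹).coeff (m - 1) +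
      (a - c) * (expAt a (RatFunc.X - RatFunc.C c)⁻¹).coeff m = (1 : ℂ⸨X⸩).coeff m := by
    intro m
    rw [← h, add_mul, HahnSeries.coeff_add, HahnSeries.coeff_single_mul, one_mul,
      HahnSeries.C_mul_eq_smul, HahnSeries.coeff_smul, smul_eq_mul]
  induction m with
  | zero =>
    have h0 := hrec 0
    rw [hreg _ (by norm_num), HahnSeries.coeff_one, if_pos rfl] at h0
    rw [zero_add, pow_one, Nat.cast_zero, eq_neg_iff_add_eq_zero]
    generalize (expAt a (RatFunc.X - RatFunc.C c)⁻¹).coeff 0 = y at *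
    field_simp
    linear_combination -h0
  | succ m ih =>
    have h1 := hrec ((m + 1 : ℕ) : ℤ)
    rw [HahnSeries.coeff_one, if_neg (by omega),
      show ((m + 1 : ℕ) : ℤ) - 1 = m by push_cast; ring, ih] at h1
    refine mul_left_cancel₀ hne ?_
    rw [pow_succ _ (m + 1), mul_inv]
    field_simp at h1 ⊢
    linear_combination -h1

theorem coeff_expAt_X_mul (a : ℂ) (f : RatFunc ℂ) (m : ℤ) :
    (expAt a (RatFunc.X * f)).coeff m = (expAt a f).coeff (m - 1) + a * (expAt a f).coeff m := by
  rw [map_mul, expAt_X, add_mul, HahnSeries.coeff_add, HahnSeries.coeff_single_mul, one_mul,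
    HahnSeries.C_mul_eq_smul, HahnSeries.coeff_smul, smul_eq_mul]

theorem coeff_expAt_C_mul (a c : ℂ) (f : RatFunc ℂ) (m : ℤ) :
    (expAt a (RatFunc.C c * f)).coeff m = c * (expAt a f).coeff m := by
  rw [map_mul, expAt_C, HahnSeries.C_mul_eq_smul, HahnSeries.coeff_smul, smul_eq_mul]

theorem coeff_expInf_X_mul (f : RatFunc ℂ) (m : ℤ) :
    (expInf (RatFunc.X * f)).coeff m = (expInf f).coeff (m + 1) := by
  rw [map_mul, expInf_X, HahnSeries.coeff_single_mul, one_mul, sub_neg_eq_add]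

theorem coeff_expInf_C_mul (c : ℂ) (f : RatFunc ℂ) (m : ℤ) :
    (expInf (RatFunc.C c * f)).coeff m = c * (expInf f).coeff m := by
  rw [map_mul, expInf_C, HahnSeries.C_mul_eq_smul, HahnSeries.coeff_smul, smul_eq_mul]

/-- The value of a rational function at a point where its expansion has no polar part is the
constant term of the expansion. -/
theorem evalAt_eq_coeff {c : ℂ} {f : RatFunc ℂ} (hf : VanishesBelow 0 (expAt c f)) :
    evalAt c f = (expAt c f).coeff 0 := by
  have hd := vanishesBelow_expAt_algebraMap c f.denom
  have hn := vanishesBelow_expAt_algebraMap c f.num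
  have hne : algebraMap (Polynomial ℂ) (RatFunc ℂ) f.denom ≠ 0 :=
    RatFunc.algebraMap_ne_zero f.denom_ne_zero
  have h : f * algebraMap _ _ f.denom = algebraMap _ _ f.num := by
    nth_rewrite 1 [← RatFunc.num_div_denom f]
    exact div_mul_cancel₀ _ hne
  have h1 := congrArg (fun f => (expAt c f).coeff 0) h
  simp only [map_mul] at h1
  rw [coeff_mul_lead hf hd.1 (by norm_num), hd.2, hn.2] at h1
  have hd0 : f.denom.eval c ≠ 0 := by
    intro h0
    rw [h0, mul_zero] at h1
    obtain ⟨u, w, huw⟩ := RatFunc.isCoprime_num_denom f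
    have := congrArg (Polynomial.eval c) huw
    simp [h0, ← h1] at this
  rw [evalAt, RatFunc.eval, Polynomial.eval₂_id, Polynomial.eval₂_id, ← h1]
  field_simp

namespace LaxFamily

variable {n rinf : ℕ} {r : Fin n → ℕ} {E : Type*} (D : LaxFamily n rinf r E)
  {b : E} {g : ℕ} {q : Fin g → ℂ}

/-! ### The upper right entry of the Lax matrix and the apparent singularities -/

/-- The polynomial `∏_s (lam - X_s) ^ (r s)`. -/
def polePoly (b : E) : Polynomial ℂ :=
  ∏ s, (Polynomial.X - Polynomial.C (D.pos s b)) ^ r s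

theorem algebraMap_polePoly (b : E) :
    algebraMap (Polynomial ℂ) (RatFunc ℂ) (D.polePoly b) = ∏ s, D.lin b s ^ r s := by
  simp [polePoly, lin]

theorem polePoly_ne_zero (b : E) : D.polePoly b ≠ 0 :=
  Finset.prod_ne_zero_iff.mpr fun _ _ => pow_ne_zero _ (Polynomial.X_sub_C_ne_zero _)

theorem algebraMap_polePoly_ne_zero (b : E) :
    algebraMap (Polynomial ℂ) (RatFunc ℂ) (D.polePoly b) ≠ 0 :=
  RatFunc.algebraMap_ne_zero (D.polePoly_ne_zero b)

theorem hasLead_polePoly (b : E) :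
    HasLead (-∑ s, (r s : ℤ)) (-∑ s, (r s : ℂ) * D.pos s b)
      (expInf (algebraMap (Polynomial ℂ) (RatFunc ℂ) (D.polePoly b))) := by
  rw [algebraMap_polePoly, map_prod]
  simp_rw [map_pow]
  have := HasLead.prod (S := Finset.univ) fun s _ => (HasLead.X_sub_C (D.pos s b)).pow (r s)
  convert this using 1
  · simp
  · simp
  · rfl

theorem eval_polePoly_ne_zero {c : ℂ} (hc : ∀ s, c ≠ D.pos s b) : (D.polePoly b).eval c ≠ 0 := by
  rw [polePoly, Polynomial.eval_prod]
  refine Finset.prod_ne_zero_iff.mpr fun s _ => ?_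
  rw [Polynomial.eval_pow, Polynomial.eval_sub, Polynomial.eval_X, Polynomial.eval_C]
  exact pow_ne_zero _ (sub_ne_zero.mpr (hc s))

variable {D}

theorem IsApparent.laxL_mul (hq : D.IsApparent b q) :
    D.laxL b 0 1 * algebraMap _ _ (D.polePoly b) =
      RatFunc.C (D.om b) * ∏ j, (RatFunc.X - RatFunc.C (q j)) := by
  rw [hq.factorization, factored, ← algebraMap_polePoly,
    div_mul_cancel₀ _ (D.algebraMap_polePoly_ne_zero b)]

/-- The upper right entry has a pole of the maximal order at each finite pole. -/
theorem IsApparent.coeff_lead_ne_zero (hq : D.IsApparent b q) (hN : D.IsNormalized b) (s : Fin n) :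
    (expAt (D.pos s b) (D.laxL b 0 1)).coeff (-(r s : ℤ)) ≠ 0 := by
  classical
  have h1 : D.laxL b 0 1 * D.lin b s ^ r s *
      algebraMap _ _ (∏ t ∈ Finset.univ.erase s,
        (Polynomial.X - Polynomial.C (D.pos t b)) ^ r t) =
      algebraMap _ _ (Polynomial.C (D.om b) * ∏ j, (Polynomial.X - Polynomial.C (q j))) := by
    have h := hq.laxL_mul
    rw [algebraMap_polePoly, ← Finset.mul_prod_erase _ _ (Finset.mem_univ s), ← mul_assoc] at h
    simpa [lin] using h
  have hreg : VanishesBelow 0 (expAt (D.pos s b) (D.laxL b 0 1 * D.lin b s ^ r s)) := by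
    rw [map_mul, map_pow, lin, expAt_X_sub_C_self, HahnSeries.single_pow]
    exact (D.vanishesBelow_expAt_laxL hN.pos_injective s 0 1).mul' (VanishesBelow.single _)
      (by simp)
  have hc : (expAt (D.pos s b) (D.laxL b 0 1 * D.lin b s ^ r s)).coeff 0 =
      (expAt (D.pos s b) (D.laxL b 0 1)).coeff (-(r s : ℤ)) := by
    rw [map_mul, map_pow, lin, expAt_X_sub_C_self, HahnSeries.single_pow,
      HahnSeries.coeff_mul_single]
    simp
  have hp := fun p : Polynomial ℂ => vanishesBelow_expAt_algebraMap (D.pos s b) p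
  have h2 := congrArg (fun f => (expAt (D.pos s b) f).coeff 0) h1
  simp only [map_mul (expAt (D.pos s b)) (_ * _) (algebraMap _ _ _)] at h2
  rw [coeff_mul_lead hreg (hp _).1 (by norm_num), hc, (hp _).2, (hp _).2] at h2
  intro h0
  rw [h0, zero_mul, Polynomial.eval_mul, Polynomial.eval_C, Polynomial.eval_prod] at h2
  refine mul_ne_zero hN.om_ne_zero (Finset.prod_ne_zero_iff.mpr fun j _ => ?_) h2.symm
  rw [Polynomial.eval_sub, Polynomial.eval_X, Polynomial.eval_C]
  exact sub_ne_zero.mpr (hq.ne_pos j s).symm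

theorem IsApparent.coeff_next (hq : D.IsApparent b q) (hN : D.IsNormalized b)
    (hrinf : 1 ≤ rinf) (hr : ∀ s, 1 ≤ r s) (hg : g + 3 = rinf + ∑ s, r s) :
    (expInf (D.laxL b 0 1)).coeff (4 - (rinf : ℤ)) =
      D.om b * (∑ s, (r s : ℂ) * D.pos s b - ∑ j, q j) := by
  have hg' : (g : ℤ) + 3 = rinf + ∑ s, (r s : ℤ) := by exact_mod_cast hg
  have hL := hN.vanishesBelow_laxL_offdiag D hrinf hr (zero_ne_one' (Fin 2))
  have hP := D.hasLead_polePoly b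
  have hQ : HasLead (-(g : ℤ)) (-∑ j, q j)
      (expInf (∏ j, (RatFunc.X - RatFunc.C (q j)))) := by
    rw [map_prod]
    have := HasLead.prod (S := Finset.univ) fun j _ => HasLead.X_sub_C (q j)
    convert this using 1
    · simp
    · simp
  have h := congrArg (fun f => (expInf f).coeff (-(g : ℤ) + 1)) hq.laxL_mul
  simp only [map_mul expInf (D.laxL b 0 1)] at h
  rw [coeff_expInf_C_mul, hQ.next, coeff_mul_lead_succ hL hP.vanishes (by linarith), hP.lead,
    hP.next, hN.coeff_laxL_om D hrinf hr, show 3 - (rinf : ℤ) + 1 = 4 - rinf by ring] at h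
  linear_combination h

theorem IsApparent.QX_eq (hq : D.IsApparent b q) (s : Fin n) (k : ℕ) :
    D.QX b s k q = (expAt (D.pos s b) (D.laxL b 0 1)).coeff (-(k : ℤ)) := by
  rw [QX, hq.factorization]

theorem IsApparent.QInf_eq (hq : D.IsApparent b q) (k : ℕ) :
    D.QInf b k q = (expInf (D.laxL b 0 1)).coeff (-(k : ℤ)) := by
  rw [QInf, hq.factorization]

theorem IsApparent.coeff_zero_expAt (hq : D.IsApparent b q) (i : Fin g) :
    (expAt (q i) (D.laxL b 0 1)).coeff 0 = 0 := by
  have hreg := partialFractions.vanishesBelow_expAt (D.laxL_mem (b := b) 0 1) (hq.ne_pos i)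
  have hp := fun p : Polynomial ℂ => vanishesBelow_expAt_algebraMap (q i) p
  have h := congrArg (fun f => (expAt (q i) f).coeff 0) hq.laxL_mul
  simp only [map_mul (expAt (q i)) (D.laxL b 0 1)] at h
  rw [coeff_mul_lead hreg (hp _).1 (by norm_num), (hp _).2, coeff_expAt_C_mul] at h
  have h2 : (∏ j, (RatFunc.X - RatFunc.C (q j)) : RatFunc ℂ) =
      algebraMap _ _ (∏ j, (Polynomial.X - Polynomial.C (q j))) := by simp
  rw [h2, (hp _).2, Polynomial.eval_prod, Finset.prod_eq_zero (Finset.mem_univ i) (by simp),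
    mul_zero] at h
  exact (mul_eq_zero.mp h).resolve_right (D.eval_polePoly_ne_zero (hq.ne_pos i))

/-- The upper right entry of the Lax matrix. -/
theorem IsApparent.laxL12 (hq : D.IsApparent b q) (hN : D.IsNormalized b)
    (hrinf : 1 ≤ rinf) (hr : ∀ s, 1 ≤ r s) :
    D.laxL b 0 1 = D.formL12 b (fun s k => D.QX b s k q) (fun k => D.QInf b k q) := by
  have hL := hN.vanishesBelow_laxL_offdiag D hrinf hr (zero_ne_one' (Fin 2))
  have hpos := hN.pos_injective
  have hlast : (if 3 ≤ rinf then RatFunc.C (D.om b) * RatFunc.X ^ (rinf - 3) else 0 : RatFunc ℂ) =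
      RatFunc.C (if 3 ≤ rinf then D.om b else 0) * RatFunc.X ^ (rinf - 3) := by
    split_ifs <;> simp
  refine partialFractions.ext hpos (D.laxL_mem 0 1) ?_ (fun k => ?_) fun s k hk => ?_
  · rw [formL12, hlast]
    exact Submodule.add_mem _ (Submodule.add_mem _ (D.polarSum_mem _)
      (sum_mem_partialFractions _ _)) (partialFractions.C_mul_X_pow_mem _ _)
  · rw [formL12, hlast, map_add, map_add, HahnSeries.coeff_add, HahnSeries.coeff_add,
      D.vanishesBelow_expInf_polarSum _ _ (by omega), coeff_expInf_sum,
      coeff_expInf_C_mul_X_pow, zero_add, hq.QInf_eq]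
    simp only [Finset.mem_range]
    rcases lt_trichotomy (k : ℤ) (rinf - 3) with h | h | h
    · rw [if_pos (by omega), if_neg (by omega), add_zero]
    · rw [if_neg (by omega), if_pos (by omega), if_pos (by omega), zero_add,
        ← hN.coeff_laxL_om D hrinf hr]
      congr 1
      omega
    · rw [hL _ (by omega), if_neg (by omega), zero_add]
      by_cases h3 : 3 ≤ rinf
      · rw [if_neg (by omega)]
      · rw [if_neg h3, ite_self]
  · rw [formL12, hlast, map_add, map_add, HahnSeries.coeff_add, HahnSeries.coeff_add,
      D.coeff_expAt_polarSum hpos _ _ hk, vanishesBelow_expAt_sum _ _ _ _ (by omega),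
      vanishesBelow_expAt_C_mul_X_pow _ _ _ _ (by omega), add_zero, add_zero, hq.QX_eq]
    split_ifs with h
    · rfl
    · exact D.vanishesBelow_expAt_laxL hpos s 0 1 _ (by omega)

end LaxFamily

namespace LaxFamily

variable {n rinf : ℕ} {r : Fin n → ℕ} {E : Type*} {D : LaxFamily n rinf r E}
  {b : E} {g : ℕ} {q : Fin g → ℂ}

/-! ### The conjugate coordinates and the upper left entry of the Lax matrix -/

theorem IsApparent.vanishesBelow_expAt (hq : D.IsApparent b q) (i : Fin g) (k l : Fin 2) :
    VanishesBelow 0 (expAt (q i) (D.laxL b k l)) :=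
  partialFractions.vanishesBelow_expAt (D.laxL_mem (b := b) k l) (hq.ne_pos i)

/-- Moving the apparent singularity `q_i` to `x` multiplies the upper right entry by
`(lam - x) / (lam - q_i)`. -/
theorem IsApparent.factored_update (hq : D.IsApparent b q) (i : Fin g) (x : ℂ) :
    D.factored b (Function.update q i x) =
      (RatFunc.X - RatFunc.C x) * (D.laxL b 0 1 * (RatFunc.X - RatFunc.C (q i))⁻¹) := by
  classical
  have h0 := X_sub_C_ne_zero (q i)
  rw [hq.factorization, factored, factored, ← Finset.mul_prod_erase _ _ (Finset.mem_univ i),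
    ← Finset.mul_prod_erase _ (fun j => RatFunc.X - RatFunc.C (q j)) (Finset.mem_univ i),
    Function.update_self]
  have : ∏ j ∈ Finset.univ.erase i, (RatFunc.X - RatFunc.C (Function.update q i x j)) =
      ∏ j ∈ Finset.univ.erase i, (RatFunc.X - RatFunc.C (q j)) :=
    Finset.prod_congr rfl fun j hj => by
      rw [Function.update_of_ne (Finset.ne_of_mem_erase hj)]
  rw [this]
  field_simp

theorem deriv_sub_mul (u w : ℂ) (x₀ : ℂ) : deriv (fun x => u - x * w) x₀ = -w := by
  have : HasDerivAt (fun x : ℂ => u - x * w) (-(1 * w)) x₀ :=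
    ((hasDerivAt_id x₀).mul_const w).const_sub u
  rw [this.deriv, one_mul]

theorem IsApparent.partialq_QX (hq : D.IsApparent b q) (hN : D.IsNormalized b) (i : Fin g)
    (s : Fin n) (k : ℕ) :
    partialq (D.QX b s k) q i = ∑ j ∈ Finset.Icc k (r s),
      D.QX b s j q * ((q i - D.pos s b) ^ (j - k + 1))⁻¹ := by
  have h : ∀ x, D.QX b s k (Function.update q i x) =
      (expAt (D.pos s b) (RatFunc.X * (D.laxL b 0 1 * (RatFunc.X - RatFunc.C (q i))⁻¹))).coeff
        (-(k : ℤ)) - x * (expAt (D.pos s b)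
          (D.laxL b 0 1 * (RatFunc.X - RatFunc.C (q i))⁻¹)).coeff (-(k : ℤ)) := by
    intro x
    rw [QX, hq.factored_update, sub_mul, map_sub, HahnSeries.coeff_sub, coeff_expAt_C_mul]
  have hne : D.pos s b ≠ q i := (hq.ne_pos i s).symm
  rw [partialq, funext h, deriv_sub_mul, map_mul,
    coeff_mul_neg (D.vanishesBelow_expAt_laxL hN.pos_injective s 0 1)
      (vanishesBelow_expAt_inv hne), ← Finset.sum_neg_distrib]
  refine Finset.sum_congr rfl fun j _ => ?_
  rw [coeff_expAt_inv hne, hq.QX_eq]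
  ring

theorem IsApparent.partialq_QInf (hq : D.IsApparent b q) (hN : D.IsNormalized b)
    (hr : ∀ s, 1 ≤ r s) (h3 : 3 ≤ rinf) (i : Fin g) {k : ℕ} (hk : k < rinf - 3) :
    partialq (D.QInf b k) q i = -∑ j ∈ Finset.range (rinf - 3 - k),
      (expInf (D.laxL b 0 1)).coeff (-((k + 1 + j : ℕ) : ℤ)) * q i ^ j := by
  have h : ∀ x, D.QInf b k (Function.update q i x) =
      (expInf (RatFunc.X * (D.laxL b 0 1 * (RatFunc.X - RatFunc.C (q i))⁻¹))).coeff
        (-(k : ℤ)) - x * (expInf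
          (D.laxL b 0 1 * (RatFunc.X - RatFunc.C (q i))⁻¹)).coeff (-(k : ℤ)) := by
    intro x
    rw [QInf, hq.factored_update, sub_mul, map_sub, HahnSeries.coeff_sub, coeff_expInf_C_mul]
  have hL : VanishesBelow (-((rinf - 3 : ℕ) : ℤ)) (expInf (D.laxL b 0 1)) :=
    (hN.vanishesBelow_laxL_offdiag D (by omega) hr (zero_ne_one' (Fin 2))).mono
      (by push_cast [h3]; omega)
  rw [partialq, funext h, deriv_sub_mul, map_mul,
    coeff_mul_neg hL ((vanishesBelow_expInf_inv (q i)).mono (by norm_num))]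
  congr 1
  rw [← Finset.add_sum_Ioc_eq_sum_Icc hk.le, Nat.sub_self, Nat.cast_zero,
    vanishesBelow_expInf_inv (q i) 0 (by norm_num), mul_zero, zero_add,
    ← Finset.Ico_add_one_add_one_eq_Ioc, Finset.sum_Ico_eq_sum_range]
  refine Finset.sum_congr (by congr 1; omega) fun j _ => ?_
  rw [show k + 1 + j - k = j + 1 by omega, coeff_expInf_inv_succ]

/-- Coefficient at `X_s` of the part of the upper left entry depending on the momenta. -/
def momX (D : LaxFamily n rinf r E) (b : E) (q : Fin g → ℂ) (PX : Fin n → ℕ → ℂ) (s : Fin n)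
    (k : ℕ) : ℂ :=
  ∑ m ∈ Finset.Icc 1 (r s + 1 - k), PX s m * D.QX b s (k + m - 1) q

/-- Coefficient at infinity of the part of the upper left entry depending on the momenta. -/
def momInf (D : LaxFamily n rinf r E) (b : E) (q : Fin g → ℂ) (PInf : ℕ → ℂ) (k : ℕ) : ℂ :=
  -D.om b * PInf (rinf - 4 - k) - ∑ m ∈ Finset.range (rinf - 4 - k), PInf m * D.QInf b (k + 1 + m) q

/-- The part of the upper left entry depending on the momenta. -/
def momPart (D : LaxFamily n rinf r E) (b : E) (q : Fin g → ℂ) (PX : Fin n → ℕ → ℂ)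
    (PInf : ℕ → ℂ) : RatFunc ℂ :=
  D.polarSum b (D.momX b q PX) +
    ∑ k ∈ Finset.range (rinf - 3), RatFunc.C (D.momInf b q PInf k) * RatFunc.X ^ k

theorem IsApparent.momInf_eq (hq : D.IsApparent b q) (hN : D.IsNormalized b)
    (hr : ∀ s, 1 ≤ r s) (PInf : ℕ → ℂ) {k : ℕ} (hk : k < rinf - 3) :
    D.momInf b q PInf k = -∑ m ∈ Finset.range (rinf - 3 - k),
      PInf m * (expInf (D.laxL b 0 1)).coeff (-((k + 1 + m : ℕ) : ℤ)) := by
  rw [momInf, show rinf - 3 - k = rinf - 4 - k + 1 by omega, Finset.sum_range_succ,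
    show -((k + 1 + (rinf - 4 - k) : ℕ) : ℤ) = 3 - rinf by omega,
    hN.coeff_laxL_om D (by omega) hr]
  simp_rw [hq.QInf_eq]
  ring

theorem coeff_zero_expAt_pow_inv {a c : ℂ} (h : a ≠ c) (d : ℂ) (k : ℕ) :
    (expAt a (RatFunc.C d / (RatFunc.X - RatFunc.C c) ^ k)).coeff 0 = d * ((a - c) ^ k)⁻¹ := by
  have hp := vanishesBelow_expAt_algebraMap a ((Polynomial.X - Polynomial.C c) ^ k)
  have hne : (a - c) ^ k ≠ 0 := pow_ne_zero _ (sub_ne_zero.mpr h)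
  have h1 : RatFunc.C d / (RatFunc.X - RatFunc.C c) ^ k *
      algebraMap _ _ ((Polynomial.X - Polynomial.C c) ^ k) = RatFunc.C d := by
    rw [map_pow, map_sub, RatFunc.algebraMap_X, RatFunc.algebraMap_C]
    exact div_mul_cancel₀ _ (pow_ne_zero _ (X_sub_C_ne_zero c))
  have h2 := congrArg (fun f => (expAt a f).coeff 0) h1
  simp only [map_mul] at h2
  rw [coeff_mul_lead (vanishesBelow_expAt_div h d k) hp.1 (by norm_num), hp.2, expAt_C,
    HahnSeries.C_apply, HahnSeries.coeff_single_same] at h2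
  refine mul_right_cancel₀ hne ?_
  rw [mul_assoc, inv_mul_cancel₀ hne, mul_one]
  simpa only [Polynomial.eval_pow, Polynomial.eval_sub, Polynomial.eval_X, Polynomial.eval_C]
    using h2

/-- The momentum part takes the values `p_i` at the apparent singularities. -/
theorem IsConjugate.coeff_momPart (hq : D.IsApparent b q) (hN : D.IsNormalized b)
    (hr : ∀ s, 1 ≤ r s) {PX : Fin n → ℕ → ℂ} {PInf : ℕ → ℂ} (hP : D.IsConjugate b q PX PInf)
    (i : Fin g) : (expAt (q i) (D.momPart b q PX PInf)).coeff 0 = D.pcoord b q i := by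
  rw [hP.momentum, momPart, map_add, HahnSeries.coeff_add, add_comm]
  congr 1
  · have h : ∑ k ∈ Finset.range (rinf - 3), RatFunc.C (D.momInf b q PInf k) * RatFunc.X ^ k =
        algebraMap _ _ (∑ k ∈ Finset.range (rinf - 3),
          Polynomial.C (D.momInf b q PInf k) * Polynomial.X ^ k) := by simp
    rw [h, (vanishesBelow_expAt_algebraMap _ _).2, Polynomial.eval_finsetSum]
    have h1 : ∀ k ∈ Finset.range (rinf - 3),
        (Polynomial.C (D.momInf b q PInf k) * Polynomial.X ^ k).eval (q i) =
          ∑ m ∈ Finset.range (rinf - 3 - k), -(PInf m *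
            (expInf (D.laxL b 0 1)).coeff (-((k + 1 + m : ℕ) : ℤ)) * q i ^ k) := by
      intro k hk
      rw [Polynomial.eval_mul, Polynomial.eval_C, Polynomial.eval_pow, Polynomial.eval_X,
        hq.momInf_eq hN hr _ (Finset.mem_range.mp hk), Finset.sum_neg_distrib, neg_mul,
        Finset.sum_mul]
    have h2 : ∀ k ∈ Finset.range (rinf - 3), PInf k * partialq (D.QInf b k) q i =
        ∑ j ∈ Finset.range (rinf - 3 - k), -(PInf k *
            (expInf (D.laxL b 0 1)).coeff (-((j + 1 + k : ℕ) : ℤ)) * q i ^ j) := by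
      intro k hk
      have hk' := Finset.mem_range.mp hk
      rw [hq.partialq_QInf hN hr (by omega) i hk', Finset.sum_neg_distrib, mul_neg,
        Finset.mul_sum]
      congr 1
      refine Finset.sum_congr rfl fun j _ => ?_
      rw [show k + 1 + j = j + 1 + k by ring]
      ring
    rw [Finset.sum_congr rfl h1, Finset.sum_congr rfl h2]
    refine Finset.sum_comm' fun k m => ?_
    simp only [Finset.mem_range]
    omega
  · rw [polarSum, map_sum, HahnSeries.coeff_sum]
    refine Finset.sum_congr rfl fun s _ => ?_
    rw [map_sum, HahnSeries.coeff_sum]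
    have h1 : ∀ k ∈ Finset.Icc 1 (r s),
        (expAt (q i) (RatFunc.C (D.momX b q PX s k) / D.lin b s ^ k)).coeff 0 =
          ∑ m ∈ Finset.Icc 1 (r s + 1 - k),
            PX s m * D.QX b s (k + m - 1) q * ((q i - D.pos s b) ^ k)⁻¹ := by
      intro k _
      rw [lin, coeff_zero_expAt_pow_inv (hq.ne_pos i s), momX, Finset.sum_mul]
    have h2 : ∀ k ∈ Finset.Icc 1 (r s), PX s k * partialq (D.QX b s k) q i =
        ∑ j ∈ Finset.Icc 1 (r s + 1 - k),
          PX s k * D.QX b s (j + k - 1) q * ((q i - D.pos s b) ^ j)⁻¹ := by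
      intro k hk
      rw [Finset.mem_Icc] at hk
      rw [hq.partialq_QX hN i s k, Finset.mul_sum]
      refine Finset.sum_nbij' (fun j => j + 1 - k) (fun j => j + k - 1) ?_ ?_ ?_ ?_ ?_
      · intro j hj
        rw [Finset.mem_Icc] at *
        omega
      · intro j hj
        rw [Finset.mem_Icc] at *
        omega
      · intro j hj
        rw [Finset.mem_Icc] at hj
        omega
      · intro j hj
        rw [Finset.mem_Icc] at hj
        omega
      · intro j hj
        rw [Finset.mem_Icc] at hj
        rw [show j + 1 - k + k - 1 = j by omega, show j + 1 - k = j - k + 1 by omega]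
        ring
    rw [Finset.sum_congr rfl h1, Finset.sum_congr rfl h2]
    refine Finset.sum_comm' fun k m => ?_
    simp only [Finset.mem_Icc]
    omega

theorem momPart_mem (PX : Fin n → ℕ → ℂ) (PInf : ℕ → ℂ) :
    D.momPart b q PX PInf ∈ D.polarSpace b :=
  Submodule.add_mem _ (D.polarSum_mem _) (sum_mem_partialFractions _ _)

theorem formL11_eq_sum (Rx : Fin n → ℕ → ℂ) (Ri : ℕ → ℂ) :
    D.formL11 b Rx Ri = D.polarSum b Rx -
      RatFunc.C (if 2 ≤ rinf then D.tInf (rinf - 1) b else 0) * RatFunc.X ^ (rinf - 2) -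
      RatFunc.C (if 3 ≤ rinf then D.tInf (rinf - 2) b else 0) * RatFunc.X ^ (rinf - 3) +
      ∑ k ∈ Finset.range (rinf - 3), RatFunc.C (Ri k) * RatFunc.X ^ k := by
  rw [formL11]
  congr 3
  · split_ifs <;> simp
  · split_ifs <;> simp

theorem formL11_mem (Rx : Fin n → ℕ → ℂ) (Ri : ℕ → ℂ) :
    D.formL11 b Rx Ri ∈ D.polarSpace b := by
  rw [formL11_eq_sum]
  exact Submodule.add_mem _ (Submodule.sub_mem _ (Submodule.sub_mem _ (D.polarSum_mem _)
    (partialFractions.C_mul_X_pow_mem _ _)) (partialFractions.C_mul_X_pow_mem _ _))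
    (sum_mem_partialFractions _ _)

theorem coeff_expAt_formL11 (hN : D.IsNormalized b) (Rx : Fin n → ℕ → ℂ) (Ri : ℕ → ℂ) (s : Fin n)
    {k : ℕ} (hk : 1 ≤ k) : (expAt (D.pos s b) (D.formL11 b Rx Ri)).coeff (-(k : ℤ)) =
      if k ≤ r s then Rx s k else 0 := by
  have hX := fun c m => vanishesBelow_expAt_C_mul_X_pow (D.pos s b) c m (-(k : ℤ)) (by omega)
  rw [formL11_eq_sum, map_add, map_sub, map_sub, HahnSeries.coeff_add, HahnSeries.coeff_sub,
    HahnSeries.coeff_sub, D.coeff_expAt_polarSum hN.pos_injective _ _ hk,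
    vanishesBelow_expAt_sum _ _ _ _ (by omega), hX, hX]
  ring

theorem coeff_expInf_formL11 (Rx : Fin n → ℕ → ℂ) (Ri : ℕ → ℂ) (k : ℕ) :
    (expInf (D.formL11 b Rx Ri)).coeff (-(k : ℤ)) =
      (if k < rinf - 3 then Ri k else 0) -
      (if k + 2 = rinf then D.tInf (rinf - 1) b else 0) -
      (if k + 3 = rinf then D.tInf (rinf - 2) b else 0) := by
  rw [formL11_eq_sum, map_add, map_sub, map_sub, HahnSeries.coeff_add, HahnSeries.coeff_sub,
    HahnSeries.coeff_sub, D.vanishesBelow_expInf_polarSum _ _ (by omega), coeff_expInf_sum,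
    coeff_expInf_C_mul_X_pow, coeff_expInf_C_mul_X_pow]
  simp only [Finset.mem_range]
  have h1 : (if k = rinf - 2 then if 2 ≤ rinf then D.tInf (rinf - 1) b else 0 else 0) =
      if k + 2 = rinf then D.tInf (rinf - 1) b else 0 := by
    split_ifs <;> first | rfl | omega
  have h2 : (if k = rinf - 3 then if 3 ≤ rinf then D.tInf (rinf - 2) b else 0 else 0) =
      if k + 3 = rinf then D.tInf (rinf - 2) b else 0 := by
    split_ifs <;> first | rfl | omega
  rw [h1, h2]
  ring

/-- The polynomial `g_0 + t lam` divided by `om`, times the upper right entry: the term subtracted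
from the momentum part in the upper left entry. -/
def gaugeTerm (D : LaxFamily n rinf r E) (b : E) (q : Fin g → ℂ) : RatFunc ℂ :=
  RatFunc.C (D.g0 b q / D.om b) * D.laxL b 0 1 +
    RatFunc.C (D.tInf (rinf - 1) b / D.om b) * (RatFunc.X * D.laxL b 0 1)

theorem gaugeTerm_mem : D.gaugeTerm b q ∈ D.polarSpace b :=
  Submodule.add_mem _ (partialFractions.C_mul_mem _ (D.laxL_mem _ _))
    (partialFractions.C_mul_mem _ (partialFractions.X_mul_mem (D.laxL_mem _ _)))

theorem coeff_expInf_gaugeTerm (m : ℤ) : (expInf (D.gaugeTerm b q)).coeff m =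
    D.g0 b q / D.om b * (expInf (D.laxL b 0 1)).coeff m +
      D.tInf (rinf - 1) b / D.om b * (expInf (D.laxL b 0 1)).coeff (m + 1) := by
  rw [gaugeTerm, map_add, HahnSeries.coeff_add, coeff_expInf_C_mul, coeff_expInf_C_mul,
    coeff_expInf_X_mul]

theorem IsApparent.formL11_eq (hq : D.IsApparent b q) (hN : D.IsNormalized b)
    (hrinf : 1 ≤ rinf) (hr : ∀ s, 1 ≤ r s) (hg : g + 3 = rinf + ∑ s, r s)
    (PX : Fin n → ℕ → ℂ) (PInf : ℕ → ℂ) :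
    D.formL11 b (D.RX b q PX) (D.RInf b q PInf) = D.momPart b q PX PInf - D.gaugeTerm b q := by
  have hom := hN.om_ne_zero
  have hL := hN.vanishesBelow_laxL_offdiag D hrinf hr (zero_ne_one' (Fin 2))
  have hlead := hN.coeff_laxL_om D hrinf hr
  have hnext := hq.coeff_next hN hrinf hr hg
  refine partialFractions.ext hN.pos_injective (formL11_mem _ _)
    (Submodule.sub_mem _ (momPart_mem _ _) gaugeTerm_mem) (fun k => ?_) fun s k hk => ?_
  · rw [coeff_expInf_formL11, map_sub, HahnSeries.coeff_sub, coeff_expInf_gaugeTerm, momPart,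
      map_add, HahnSeries.coeff_add, D.vanishesBelow_expInf_polarSum _ _ (by omega),
      coeff_expInf_sum, zero_add]
    simp only [Finset.mem_range]
    rcases (by omega : k < rinf - 3 ∨ k + 3 = rinf ∨ k + 2 = rinf ∨ rinf < k + 2) with
      h | h | h | h
    · rw [if_pos h, if_pos h, if_neg (by omega), if_neg (by omega), RInf, momInf, hq.QInf_eq k]
      split_ifs with h0
      · subst h0
        have h1 : (expInf (D.laxL b 0 1)).coeff 1 = ∑ s, D.QX b s 1 q := by
          rw [hq.laxL12 hN hrinf hr, formL12, map_add, map_add, HahnSeries.coeff_add,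
            HahnSeries.coeff_add, D.coeff_expInf_polarSum_one hr,
            coeff_expInf_sum_of_pos _ _ one_pos, if_pos (by omega), expInf_C_mul_X_pow,
            HahnSeries.coeff_single_of_ne (by omega), add_zero, add_zero]
        rw [← h1]
        norm_num
        ring
      · rw [hq.QInf_eq, show -((k - 1 : ℕ) : ℤ) = -(k : ℤ) + 1 by omega]
        ring
    · rw [if_neg (show ¬k < rinf - 3 by omega), if_neg (show ¬k + 2 = rinf by omega), if_pos h,
        if_neg (show ¬k < rinf - 3 by omega), show -(k : ℤ) = 3 - rinf by omega, hlead, show 3 - (rinf : ℤ) + 1 = 4 - rinf by ring,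
        hnext, g0, if_pos (by omega)]
      field_simp
      ring
    · rw [if_neg (show ¬k < rinf - 3 by omega), if_pos h, if_neg (show ¬k + 3 = rinf by omega),
        if_neg (show ¬k < rinf - 3 by omega), show -(k : ℤ) + 1 = 3 - rinf by omega, hlead, hL _ (by omega)]
      field_simp
      ring
    · rw [if_neg (by omega), if_neg (by omega), if_neg (by omega), if_neg (by omega),
        hL _ (by omega), hL _ (by omega)]
      ring
  · rw [coeff_expAt_formL11 hN _ _ _ hk, map_sub, HahnSeries.coeff_sub, momPart, map_add,
      HahnSeries.coeff_add, D.coeff_expAt_polarSum hN.pos_injective _ _ hk,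
      vanishesBelow_expAt_sum _ _ _ _ (by omega), gaugeTerm, map_add, HahnSeries.coeff_add,
      coeff_expAt_C_mul, coeff_expAt_C_mul, coeff_expAt_X_mul,
      show -(k : ℤ) - 1 = -((k + 1 : ℕ) : ℤ) by push_cast; ring, ← hq.QX_eq, ← hq.QX_eq]
    have hz : ∀ m, r s < m → D.QX b s m q = 0 := by
      intro m hm
      rw [hq.QX_eq]
      exact D.vanishesBelow_expAt_laxL hN.pos_injective s 0 1 _ (by omega)
    split_ifs with h
    · rw [RX, ← momX]
      split_ifs with h'
      · ring
      · rw [hz (k + 1) (by omega)]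
        ring
    · rw [hz k (by omega), hz (k + 1) (by omega)]
      ring

theorem exists_polynomial_mul_polePoly (a : ℕ → ℂ) (N : ℕ) (c : Fin n → ℕ → ℂ) :
    ∃ p : Polynomial ℂ, (∑ k ∈ Finset.range N, RatFunc.C (a k) * RatFunc.X ^ k +
      D.polarSum b c) * algebraMap _ _ (D.polePoly b) = algebraMap _ _ p := by
  classical
  refine ⟨(∑ k ∈ Finset.range N, Polynomial.C (a k) * Polynomial.X ^ k) * D.polePoly b +
    ∑ s, ∑ k ∈ Finset.Icc 1 (r s), Polynomial.C (c s k) *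
      ((Polynomial.X - Polynomial.C (D.pos s b)) ^ (r s - k) *
        ∏ t ∈ Finset.univ.erase s, (Polynomial.X - Polynomial.C (D.pos t b)) ^ r t), ?_⟩
  rw [add_mul, map_add, map_mul]
  congr 1
  · simp
  · rw [polarSum, Finset.sum_mul, map_sum]
    refine Finset.sum_congr rfl fun s _ => ?_
    rw [Finset.sum_mul, map_sum]
    refine Finset.sum_congr rfl fun k hk => ?_
    have hk' := (Finset.mem_Icc.mp hk).2
    have h0 := X_sub_C_ne_zero (D.pos s b)
    rw [algebraMap_polePoly, ← Finset.mul_prod_erase _ _ (Finset.mem_univ s)]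
    have h1 : D.lin b s ^ r s = D.lin b s ^ k * D.lin b s ^ (r s - k) := by
      rw [← pow_add]
      congr 1
      omega
    rw [h1]
    simp only [lin, map_mul, map_pow, map_sub, map_prod, RatFunc.algebraMap_X,
      RatFunc.algebraMap_C]
    field_simp

/-- A rational function with poles of order at most `r s` at the `X_s`, vanishing at the `g` points
`q_j` and of order at most `rinf - 4` at infinity, is zero: its numerator has degree less than `g`.
-/
theorem IsApparent.eq_zero_of_vanishes (hq : D.IsApparent b q) (hg : g + 3 = rinf + ∑ s, r s)
    {f : RatFunc ℂ} (hf : f ∈ D.polarSpace b)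
    (hp : ∃ p : Polynomial ℂ, f * algebraMap _ _ (D.polePoly b) = algebraMap _ _ p)
    (hinf : VanishesBelow (4 - (rinf : ℤ)) (expInf f))
    (hzero : ∀ i, (expAt (q i) f).coeff 0 = 0) : f = 0 := by
  obtain ⟨p, hp⟩ := hp
  have hg' : (g : ℤ) + 3 = rinf + ∑ s, (r s : ℤ) := by exact_mod_cast hg
  have hv : VanishesBelow (1 - (g : ℤ)) (expInf (algebraMap _ _ p)) := by
    rw [← hp, map_mul]
    exact hinf.mul' (D.hasLead_polePoly b).vanishes (by linarith)
  have hdeg : p.degree < (Finset.univ : Finset (Fin g)).card := by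
    rw [Finset.card_univ, Fintype.card_fin, Polynomial.degree_lt_iff_coeff_zero]
    intro m hm
    rw [← coeff_expInf_algebraMap]
    exact hv _ (by omega)
  have heval : ∀ i ∈ (Finset.univ : Finset (Fin g)), p.eval (q i) = 0 := by
    intro i _
    rw [← (vanishesBelow_expAt_algebraMap (q i) p).2, ← hp, map_mul,
      coeff_mul_lead (partialFractions.vanishesBelow_expAt hf (hq.ne_pos i))
        (vanishesBelow_expAt_algebraMap (q i) _).1 (by norm_num), hzero, zero_mul]
  have hp0 := Polynomial.eq_zero_of_degree_lt_of_eval_index_eq_zero _ hq.injective.injOn hdeg heval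
  rw [hp0, map_zero] at hp
  exact (mul_eq_zero.mp hp).resolve_right (D.algebraMap_polePoly_ne_zero b)

variable [NormedAddCommGroup E] [NormedSpace ℂ E] {v : E → E} {U : Set E}

theorem IsIsomonodromic.coeff_laxL00_next (hU : IsOpen U) (hD : D.IsIsomonodromic U v)
    (hr : ∀ s, 1 ≤ r s) (hb : b ∈ U) (h2 : 2 ≤ rinf) :
    (expInf (D.laxL b 0 0)).coeff (3 - (rinf : ℤ)) = -D.tInf (rinf - 2) b := by
  obtain ⟨-, h, -⟩ := hD.expInf_bounds hU (by omega) hr hb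
  rw [coeff_eq_of_sub h (lt_min (by omega) (by omega))]
  have := D.coeff_irrInf b (rinf - 2)
  rw [if_pos (by omega)] at this
  rw [← this]
  congr 1
  push_cast [h2]
  ring

/-- The upper left entry of the Lax matrix. -/
theorem IsIsomonodromic.laxL11 (hU : IsOpen U) (hD : D.IsIsomonodromic U v) (hrinf : 1 ≤ rinf)
    (hr : ∀ s, 1 ≤ r s) (hg : g + 3 = rinf + ∑ s, r s) (hb : b ∈ U) (hq : D.IsApparent b q)
    {PX : Fin n → ℕ → ℂ} {PInf : ℕ → ℂ} (hP : D.IsConjugate b q PX PInf) :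
    D.laxL b 0 0 = D.formL11 b (D.RX b q PX) (D.RInf b q PInf) := by
  have hN := hD.normalized b hb
  have hom := hN.om_ne_zero
  have hL := hN.vanishesBelow_laxL_offdiag D hrinf hr (zero_ne_one' (Fin 2))
  have hlead := hN.coeff_laxL_om D hrinf hr
  have hnext := hq.coeff_next hN hrinf hr hg
  refine (sub_eq_zero.mp (hq.eq_zero_of_vanishes hg
    (Submodule.sub_mem _ (formL11_mem _ _) (D.laxL_mem _ _)) ?_ ?_ fun i => ?_)).symm
  · have h1 : D.formL11 b (D.RX b q PX) (D.RInf b q PInf) - D.laxL b 0 0 =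
        ∑ k ∈ Finset.range rinf, RatFunc.C ((if k + 3 < rinf then D.RInf b q PInf k else 0) -
          (if k + 2 = rinf then D.tInf (rinf - 1) b else 0) -
          (if k + 3 = rinf then D.tInf (rinf - 2) b else 0) -
          (if k + 1 < rinf then D.LInf (k + 1) b 0 0 else 0)) * RatFunc.X ^ k +
        D.polarSum b (fun s k => D.RX b q PX s k - D.LX s (k - 1) b 0 0) := by
      refine partialFractions.ext hN.pos_injective
        (Submodule.sub_mem _ (formL11_mem _ _) (D.laxL_mem _ _))
        (Submodule.add_mem _ (sum_mem_partialFractions _ _) (D.polarSum_mem _))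
        (fun k => ?_) fun s k hk => ?_
      · rw [map_sub, map_add, HahnSeries.coeff_sub, HahnSeries.coeff_add, coeff_expInf_formL11,
          D.coeff_expInf_laxL, coeff_expInf_sum, D.vanishesBelow_expInf_polarSum _ _ (by omega),
          add_zero]
        have e1 : (k < rinf - 3) = (k + 3 < rinf) := by apply propext; omega
        have e2 : (k + 1 ≤ rinf - 1) = (k + 1 < rinf) := by apply propext; omega
        simp only [Finset.mem_range, e1, e2]
        by_cases hk : k < rinf
        · rw [if_pos hk]
        · rw [if_neg hk, if_neg (by omega), if_neg (by omega), if_neg (by omega),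
            if_neg (by omega)]
          ring
      · rw [map_sub, map_add, HahnSeries.coeff_sub, HahnSeries.coeff_add,
          coeff_expAt_formL11 hN _ _ _ hk, D.laxL_apply, map_add, HahnSeries.coeff_add,
          vanishesBelow_expAt_sum _ _ _ _ (by omega), vanishesBelow_expAt_sum _ _ _ _ (by omega),
          D.coeff_expAt_polarSum hN.pos_injective _ _ hk,
          D.coeff_expAt_polarSum hN.pos_injective _ _ hk]
        split_ifs <;> ring
    rw [h1]
    exact exists_polynomial_mul_polePoly _ _ _
  · have hY : VanishesBelow (4 - (rinf : ℤ)) (expInf (D.gaugeTerm b q + D.laxL b 0 0)) := by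
      have h1 : VanishesBelow (2 - (rinf : ℤ)) (expInf (D.gaugeTerm b q + D.laxL b 0 0)) := by
        rw [map_add]
        refine VanishesBelow.add (fun m hm => ?_) (D.vanishesBelow_expInf_laxL hrinf 0 0)
        rw [coeff_expInf_gaugeTerm, hL m (by omega), hL (m + 1) (by omega)]
        ring
      have h2 := h1.succ (by
        rw [map_add, HahnSeries.coeff_add, coeff_expInf_gaugeTerm, hL _ (by omega),
          show 2 - (rinf : ℤ) + 1 = 3 - rinf by ring, hlead, hN.coeff_lead D hrinf hr]
        simp only [Matrix.diagonal_apply_eq, Matrix.cons_val_zero]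
        field_simp
        ring)
      have h3 := h2.succ (by
        rw [show 2 - (rinf : ℤ) + 1 = 3 - rinf by ring, map_add, HahnSeries.coeff_add,
          coeff_expInf_gaugeTerm, hlead, show 3 - (rinf : ℤ) + 1 = 4 - rinf by ring, hnext]
        rcases Nat.lt_or_ge rinf 2 with h | h
        · obtain rfl : rinf = 1 := by omega
          rw [g0, if_neg (by norm_num), show 3 - ((1 : ℕ) : ℤ) = 2 by norm_num,
            D.coeff_expInf_laxL_two hr]
          simp_rw [add_comm (D.pos _ b • D.LX _ 0 b)]
          field_simp
          ring
        · rw [hD.coeff_laxL00_next hU hr hb h, g0, if_pos h]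
          field_simp
          ring)
      exact h3.mono (by omega)
    have hK : VanishesBelow (4 - (rinf : ℤ)) (expInf (D.momPart b q PX PInf)) := by
      have hp1 := D.vanishesBelow_expInf_polarSum (b := b) (D.momX b q PX)
      have hmom1 : rinf ≤ 2 → (expInf (D.polarSum b (D.momX b q PX))).coeff 1 = 0 := by
        intro h
        rw [D.coeff_expInf_polarSum_one hr, ← hP.relation_le_two h]
        refine Finset.sum_congr rfl fun s _ => ?_
        rw [momX, Nat.add_sub_cancel]
        refine Finset.sum_congr rfl fun m _ => ?_
        rw [show 1 + m - 1 = m by omega]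
      rw [momPart, map_add]
      rcases (by omega : rinf = 1 ∨ rinf = 2 ∨ 3 ≤ rinf) with h | h | h
      · have h2 := (hp1.succ (hmom1 (by omega))).succ (by
          rw [show (1 : ℤ) + 1 = 2 by norm_num, D.coeff_expInf_polarSum_two hr,
            Finset.sum_add_distrib]
          refine Eq.trans ?_ (hP.relation_one h)
          congr 1
          · refine Finset.sum_congr rfl fun s _ => ?_
            split_ifs with hs
            · rw [momX, show r s + 1 - 2 = r s - 1 by omega]
              refine Finset.sum_congr rfl fun m _ => ?_
              rw [show 2 + m - 1 = m + 1 by omega]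
            · rw [Finset.Icc_eq_empty (by omega), Finset.sum_empty]
          · refine Finset.sum_congr rfl fun s _ => ?_
            rw [momX, Nat.add_sub_cancel, Finset.mul_sum]
            refine Finset.sum_congr rfl fun m _ => ?_
            rw [show 1 + m - 1 = m by omega, mul_assoc])
        rw [show rinf - 3 = 0 by omega, Finset.sum_range_zero, map_zero, add_zero]
        exact h2.mono (by omega)
      · rw [show rinf - 3 = 0 by omega, Finset.sum_range_zero, map_zero, add_zero]
        exact (hp1.succ (hmom1 (by omega))).mono (by omega)
      · exact (hp1.mono (by omega)).add
          ((vanishesBelow_expInf_sum _ _).mono (by push_cast [h]; omega))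
    have : expInf (D.formL11 b (D.RX b q PX) (D.RInf b q PInf) - D.laxL b 0 0) =
        expInf (D.momPart b q PX PInf) - expInf (D.gaugeTerm b q + D.laxL b 0 0) := by
      rw [hq.formL11_eq hN hrinf hr hg, ← map_sub]
      congr 1
      ring
    rw [this]
    exact hK.sub hY
  · have hgauge : (expAt (q i) (D.gaugeTerm b q)).coeff 0 = 0 := by
      rw [gaugeTerm, map_add, HahnSeries.coeff_add, coeff_expAt_C_mul, coeff_expAt_C_mul,
        coeff_expAt_X_mul, hq.coeff_zero_expAt, hq.vanishesBelow_expAt i 0 1 _ (by norm_num)]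
      ring
    rw [map_sub, HahnSeries.coeff_sub, hq.formL11_eq hN hrinf hr hg, map_sub,
      HahnSeries.coeff_sub, hgauge, hP.coeff_momPart hq hN hr, pcoord,
      evalAt_eq_coeff (hq.vanishesBelow_expAt i 0 0)]
    ring

end LaxFamily

/-! ### Convolutions with a factor vanishing at infinity -/

theorem coeff_mul_neg_succ {r : ℕ} {f h : ℂ⸨X⸩} (hf : VanishesBelow (-(r : ℤ)) f)
    (hh : VanishesBelow 1 h) (k : ℕ) :
    (f * h).coeff (-(k : ℤ)) =
      ∑ i ∈ Finset.range (r - k), f.coeff (-((k + 1 + i : ℕ) : ℤ)) * h.coeff ((i : ℤ) + 1) := by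
  rw [coeff_mul_neg hf (hh.mono zero_le_one)]
  rcases lt_or_ge r k with h' | hkr
  · rw [Finset.Icc_eq_empty (by omega), show r - k = 0 by omega]
    rfl
  rw [← Finset.add_sum_Ioc_eq_sum_Icc hkr, Nat.sub_self, Nat.cast_zero, hh 0 one_pos,
    mul_zero, zero_add, ← Finset.Ico_add_one_add_one_eq_Ioc, Finset.sum_Ico_eq_sum_range]
  refine Finset.sum_congr (by congr 1; omega) fun j _ => ?_
  rw [show ((k + 1 + j - k : ℕ) : ℤ) = (j : ℤ) + 1 by omega]

theorem coeff_one_mul {r : ℕ} {f h : ℂ⸨X⸩} (hf : VanishesBelow (-(r : ℤ)) f)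
    (hh : VanishesBelow 1 h) :
    (f * h).coeff 1 = ∑ j ∈ Finset.range (r + 1), f.coeff (-(j : ℤ)) * h.coeff ((j : ℤ) + 1) := by
  rw [coeff_mul_of_vanishesBelow hf hh]
  refine Finset.sum_nbij' (fun i => (-i).toNat) (fun j => -(j : ℤ)) ?_ ?_ ?_ ?_ ?_
  · intro i hi
    rw [Finset.mem_Icc] at hi
    rw [Finset.mem_range]
    omega
  · intro j hj
    rw [Finset.mem_range] at hj
    rw [Finset.mem_Icc]
    omega
  · intro i hi
    rw [Finset.mem_Icc] at hi
    omega
  · intro j _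
    simp
  · intro i hi
    rw [Finset.mem_Icc] at hi
    rw [show (((-i).toNat : ℕ) : ℤ) = -i by omega, neg_neg, show -i + 1 = 1 - i by ring]

theorem coeff_two_mul {r : ℕ} {f h : ℂ⸨X⸩} (hf : VanishesBelow (-(r : ℤ)) f)
    (hh : VanishesBelow 1 h) :
    (f * h).coeff 2 = f.coeff 1 * h.coeff 1 +
      ∑ j ∈ Finset.range (r + 1), f.coeff (-(j : ℤ)) * h.coeff ((j : ℤ) + 2) := by
  rw [coeff_mul_of_vanishesBelow hf hh, show (2 : ℤ) - 1 = 1 by norm_num,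
    ← Finset.sum_Ico_add_eq_sum_Icc (by omega : -(r : ℤ) ≤ 1), add_comm]
  congr 1
  refine Finset.sum_nbij' (fun i => (-i).toNat) (fun j => -(j : ℤ)) ?_ ?_ ?_ ?_ ?_
  · intro i hi
    rw [Finset.mem_Ico] at hi
    rw [Finset.mem_range]
    omega
  · intro j hj
    rw [Finset.mem_range] at hj
    rw [Finset.mem_Ico]
    omega
  · intro i hi
    rw [Finset.mem_Ico] at hi
    omega
  · intro j _
    simp
  · intro i hi
    rw [Finset.mem_Ico] at hi
    rw [show (((-i).toNat : ℕ) : ℤ) = -i by omega, neg_neg, show -i + 2 = 2 - i by ring]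

/-- The entries of the product of a lower triangular Toeplitz matrix and a vector. -/
theorem sum_fin_ite_le_mul {N i : ℕ} (hi : i < N) (f : ℕ → ℂ) (h : ℕ → ℂ) :
    ∑ j : Fin N, (if (j : ℕ) ≤ i then f j else 0) * h j = ∑ j ∈ Finset.range (i + 1), f j * h j := by
  rw [Fin.sum_univ_eq_sum_range (fun j => (if j ≤ i then f j else 0) * h j)]
  symm
  rw [← Finset.sum_subset (Finset.range_subset_range.mpr (Nat.succ_le_of_lt hi))]
  · refine Finset.sum_congr rfl fun j hj => ?_
    rw [Finset.mem_range] at hj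
    rw [if_pos (by omega)]
  · intro j _ hj
    rw [Finset.mem_range] at hj
    rw [if_neg (by omega), zero_mul]

namespace LaxFamily

variable {n rinf : ℕ} {r : Fin n → ℕ} {E : Type*} {D : LaxFamily n rinf r E}
  {b : E} {g : ℕ} {q : Fin g → ℂ}

/-! ### Coefficients of the upper right entry of the oper form -/

theorem IsNormalized.laxL12_ne_zero (hN : D.IsNormalized b) (hrinf : 1 ≤ rinf)
    (hr : ∀ s, 1 ≤ r s) : D.laxL b 0 1 ≠ 0 := by
  intro h
  have := hN.coeff_laxL_om D hrinf hr
  rw [h, map_zero] at this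
  exact hN.om_ne_zero this.symm

theorem IsNormalized.laxA12_eq_mul (hN : D.IsNormalized b) (hrinf : 1 ≤ rinf)
    (hr : ∀ s, 1 ≤ r s) : D.laxA b 0 1 = D.laxL b 0 1 * D.operA12 b := by
  rw [operA12_eq, mul_div_cancel₀ _ (hN.laxL12_ne_zero hrinf hr)]

theorem IsApparent.QX_eq_zero (hq : D.IsApparent b q) (hN : D.IsNormalized b) (s : Fin n) {k : ℕ}
    (hk : r s < k) : D.QX b s k q = 0 := by
  rw [hq.QX_eq]
  exact D.vanishesBelow_expAt_laxL hN.pos_injective s 0 1 _ (by omega)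

theorem IsApparent.coeff_one (hq : D.IsApparent b q) (hN : D.IsNormalized b) (hrinf : 1 ≤ rinf)
    (hr : ∀ s, 1 ≤ r s) : (expInf (D.laxL b 0 1)).coeff 1 = ∑ s, D.QX b s 1 q := by
  rw [hq.laxL12 hN hrinf hr, formL12, map_add, map_add, HahnSeries.coeff_add,
    HahnSeries.coeff_add, D.coeff_expInf_polarSum_one hr, coeff_expInf_sum_of_pos _ _ one_pos,
    add_zero]
  split_ifs
  · rw [expInf_C_mul_X_pow, HahnSeries.coeff_single_of_ne (by omega), add_zero]
  · simp

theorem IsApparent.coeff_three (hq : D.IsApparent b q) (hN : D.IsNormalized b)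
    (h1 : rinf = 1) (hr : ∀ s, 1 ≤ r s) :
    (expInf (D.laxL b 0 1)).coeff 3 = D.thirdMoment b fun s k => D.QX b s k q := by
  subst h1
  rw [hq.laxL12 hN le_rfl hr, formL12, if_neg (by norm_num), map_add, map_add,
    HahnSeries.coeff_add, HahnSeries.coeff_add, D.coeff_expInf_polarSum_three hr,
    coeff_expInf_sum_of_pos _ _ three_pos, map_zero, HahnSeries.coeff_zero, add_zero, add_zero,
    thirdMoment]
  refine Finset.sum_congr rfl fun s _ => ?_
  have h2 : (if 2 ≤ r s then D.QX b s 2 q else 0) = D.QX b s 2 q := by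
    split_ifs with h
    · rfl
    · exact (hq.QX_eq_zero hN s (by omega)).symm
  have h3 : (if 3 ≤ r s then D.QX b s 3 q else 0) = D.QX b s 3 q := by
    split_ifs with h
    · rfl
    · exact (hq.QX_eq_zero hN s (by omega)).symm
  rw [h2, h3]
  ring

theorem IsApparent.vanishesBelow_neg (hN : D.IsNormalized b) (h3 : 3 ≤ rinf) (hr : ∀ s, 1 ≤ r s) :
    VanishesBelow (-((rinf - 3 : ℕ) : ℤ)) (expInf (D.laxL b 0 1)) :=
  (hN.vanishesBelow_laxL_offdiag D (by omega) hr (zero_ne_one' (Fin 2))).mono (by omega)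

/-- The value of `g_0` when infinity is a simple pole. -/
theorem IsApparent.g0_eq (hq : D.IsApparent b q) (hN : D.IsNormalized b)
    (h1 : rinf = 1) (hr : ∀ s, 1 ≤ r s) (hg : g + 3 = rinf + ∑ s, r s)
    {Rx : Fin n → ℕ → ℂ} {Ri : ℕ → ℂ} (hL : D.laxL b 0 0 = D.formL11 b Rx Ri) :
    D.g0 b q = -∑ s, (D.pos s b * Rx s 1 + if 2 ≤ r s then Rx s 2 else 0) -
      D.tInf 0 b / D.om b * D.thirdMoment b fun s k => D.QX b s k q := by
  have hom := hN.om_ne_zero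
  have h2 := D.coeff_expInf_laxL_two (b := b) hr 0 0
  have h3 := hq.coeff_next hN (by omega) hr hg
  subst h1
  rw [show 4 - ((1 : ℕ) : ℤ) = 3 by norm_num, hq.coeff_three hN rfl hr] at h3
  have h4 : D.formL11 b Rx Ri = D.polarSum b Rx := by simp [formL11]
  rw [hL, h4, D.coeff_expInf_polarSum_two hr] at h2
  have h5 : ∑ s, (D.pos s b • D.LX s 0 b + if 2 ≤ r s then D.LX s 1 b else 0) =
      ∑ s, ((if 2 ≤ r s then D.LX s 1 b else 0) + D.pos s b • D.LX s 0 b) :=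
    Finset.sum_congr rfl fun s _ => add_comm _ _
  have h6 : ∑ s, (D.pos s b * Rx s 1 + if 2 ≤ r s then Rx s 2 else 0) =
      ∑ s, ((if 2 ≤ r s then Rx s 2 else 0) + D.pos s b * Rx s 1) :=
    Finset.sum_congr rfl fun s _ => add_comm _ _
  rw [g0, if_neg (by norm_num), h5, h6, ← h2, h3]
  field_simp
  ring

theorem formA12_eq_sum (Qx : Fin n → ℕ → ℂ) (Qi : ℕ → ℂ) (nx : Fin n → ℕ → ℂ) (ni : ℤ → ℂ) :
    D.formA12 b Qx Qi nx ni =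
      RatFunc.C (if 4 ≤ rinf then D.om b * ni 1 else 0) * RatFunc.X ^ (rinf - 4) +
      ∑ j ∈ Finset.range (rinf - 4),
        RatFunc.C (D.om b * ni ((rinf : ℤ) - 3 - j) +
          ∑ k ∈ Finset.Icc (j + 1) (rinf - 4), ni ((k : ℤ) - j) * Qi k) * RatFunc.X ^ j +
      D.polarSum b (fun s j => ∑ k ∈ Finset.Icc j (r s), nx s (k - j) * Qx s k) := by
  rw [formA12]
  congr 2
  split_ifs <;> simp

section Differential

variable [NormedAddCommGroup E] [NormedSpace ℂ E] {U : Set E} {v : E → E}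

theorem IsIsomonodromic.vanishesBelow_operA12 (hU : IsOpen U) (hD : D.IsIsomonodromic U v)
    (hrinf : 1 ≤ rinf) (hr : ∀ s, 1 ≤ r s) (hb : b ∈ U) :
    VanishesBelow (min ((rinf : ℤ) - 2) 1) (expInf (D.operA12 b)) := by
  have hN := hD.normalized b hb
  obtain ⟨-, -, h, -⟩ := hD.expInf_bounds hU hrinf hr hb
  have hc : (expInf (D.laxL b 0 1)).coeff (3 - (rinf : ℤ)) ≠ 0 := by
    rw [hN.coeff_laxL_om D hrinf hr]
    exact hN.om_ne_zero
  rw [operA12_eq, map_div₀]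
  exact h.div' hc (by omega)

theorem IsIsomonodromic.vanishesBelow_operA12_one (hU : IsOpen U) (hD : D.IsIsomonodromic U v)
    (h3 : 3 ≤ rinf) (hr : ∀ s, 1 ≤ r s) (hb : b ∈ U) :
    VanishesBelow 1 (expInf (D.operA12 b)) :=
  (hD.vanishesBelow_operA12 hU (by omega) hr hb).mono (by omega)

/-- The Toeplitz system determining the coefficients of the oper form at `X_s`. -/
theorem IsIsomonodromic.matMX_mulVec (hD : D.IsIsomonodromic U v)
    (hr : ∀ s, 1 ≤ r s) (hb : b ∈ U) (hq : D.IsApparent b q) (s : Fin n) :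
    (D.matMX b s).mulVec (fun i : Fin (r s - 1) => D.nuX b s ((i : ℕ) + 1)) =
      fun i : Fin (r s - 1) =>
        -(D.alphaX v b s (r s - 1 - (i : ℕ)) / ((r s - 1 - (i : ℕ) : ℕ) : ℂ)) := by
  obtain ⟨-, hreg, h0, h, -⟩ := hD.expAt_bounds hr hb s
    (hq.coeff_lead_ne_zero (hD.normalized b hb) s)
  -- the shift by the velocity of the pole removes the constant term
  have hM : VanishesBelow 1 (expAt (D.pos s b) (D.operA12 b) +
      HahnSeries.C (D.alphaPos v b s)) := by
    refine ((hreg.add (VanishesBelow.C _)).succ ?_).mono (by norm_num)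
    rw [nuX, Nat.cast_zero] at h0
    rw [HahnSeries.coeff_add, h0, HahnSeries.C_apply, HahnSeries.coeff_single_same,
      neg_add_cancel]
  ext ⟨i, hi⟩
  rw [← D.coeff_irrXDeriv_add b s (by omega) (by omega), ← coeff_eq_of_sub h (by omega),
    coeff_mul_neg_succ (D.vanishesBelow_irrX b s) hM, Matrix.mulVec, dotProduct]
  simp only [matMX, Matrix.of_apply]
  rw [sum_fin_ite_le_mul hi (fun j => D.tX s (r s - 1 - (i - j)) b) (fun j => D.nuX b s (j + 1))]
  refine Finset.sum_congr (by congr 1; omega) fun j hj => ?_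
  rw [Finset.mem_range] at hj
  have h1 := D.coeff_irrX b s (r s - 1 - (i - j))
  rw [if_pos (by omega)] at h1
  rw [show -((r s - 1 - i + 1 + j : ℕ) : ℤ) = -((r s - 1 - (i - j) : ℕ) : ℤ) - 1 by omega, h1,
    HahnSeries.coeff_add, HahnSeries.C_apply, HahnSeries.coeff_single_of_ne (by omega), add_zero,
    nuX, Nat.cast_add, Nat.cast_one]

/-- The Toeplitz system determining the coefficients of the oper form at infinity. -/
theorem IsIsomonodromic.matMInf_mulVec (hU : IsOpen U) (hD : D.IsIsomonodromic U v)
    (hrinf : 1 ≤ rinf) (hr : ∀ s, 1 ≤ r s) (hb : b ∈ U) :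
    (D.matMInf b).mulVec (fun i : Fin (rinf - 3) => D.nuInf b (((i : ℕ) : ℤ) + 1)) =
      fun i : Fin (rinf - 3) =>
        D.alphaInf v b (rinf - 3 - (i : ℕ)) / ((rinf - 3 - (i : ℕ) : ℕ) : ℂ) := by
  obtain ⟨-, -, -, -, -, h⟩ := hD.expInf_bounds hU hrinf hr hb
  ext ⟨i, hi⟩
  have hM := hD.vanishesBelow_operA12_one hU (by omega) hr hb
  have ht : VanishesBelow (-((rinf - 2 : ℕ) : ℤ)) (D.irrInf b) :=
    (D.vanishesBelow_irrInf b).mono (by omega)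
  have h1 := D.coeff_irrInfDeriv (v := v) b (k := rinf - 3 - i) (by omega) (by omega)
  rw [← coeff_eq_of_sub h (by omega), coeff_mul_neg_succ ht hM, eq_comm, neg_eq_iff_eq_neg,
    ← Finset.sum_neg_distrib] at h1
  rw [h1, Matrix.mulVec, dotProduct]
  simp only [matMInf, Matrix.of_apply]
  rw [sum_fin_ite_le_mul hi (fun j => D.tInf (rinf - 1 - (i - j)) b)
    (fun j => D.nuInf b ((j : ℤ) + 1))]
  refine Finset.sum_congr (by congr 1; omega) fun j hj => ?_
  rw [Finset.mem_range] at hj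
  have h2 := D.coeff_irrInf b (rinf - 1 - (i - j))
  rw [if_pos (by omega)] at h2
  rw [show -((rinf - 3 - i + 1 + j : ℕ) : ℤ) = 1 - ((rinf - 1 - (i - j) : ℕ) : ℤ) by omega, h2,
    nuInf, neg_mul, neg_neg]

/-! ### The upper right entry of the auxiliary matrix -/

/-- The upper right entry of the auxiliary matrix. -/
theorem IsIsomonodromic.laxA12 (hU : IsOpen U) (hD : D.IsIsomonodromic U v)
    (hrinf : 1 ≤ rinf) (hr : ∀ s, 1 ≤ r s) (hb : b ∈ U) (hq : D.IsApparent b q) :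
    D.laxA b 0 1 = D.formA12 b (fun s k => D.QX b s k q) (fun k => D.QInf b k q)
      (D.nuX b) (D.nuInf b) := by
  have hN := hD.normalized b hb
  have hpos := hN.pos_injective
  rw [formA12_eq_sum]
  refine partialFractions.ext hpos (D.laxA_mem 0 1) (Submodule.add_mem _ (Submodule.add_mem _
    (partialFractions.C_mul_X_pow_mem _ _) (sum_mem_partialFractions _ _)) (D.polarSum_mem _))
    (fun k => ?_) fun s k hk => ?_
  · rw [map_add, map_add, HahnSeries.coeff_add, HahnSeries.coeff_add, coeff_expInf_sum,
      coeff_expInf_C_mul_X_pow, D.vanishesBelow_expInf_polarSum _ _ (by omega), add_zero]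
    simp only [Finset.mem_range]
    rcases Nat.lt_or_ge rinf 4 with h4 | h4
    · obtain ⟨-, -, h, -⟩ := hD.expInf_bounds hU hrinf hr hb
      rw [h _ (lt_min (by omega) (by omega)), if_neg (show ¬ 4 ≤ rinf by omega), ite_self,
        if_neg (show ¬ k < rinf - 4 by omega), add_zero]
    · rw [hN.laxA12_eq_mul hrinf hr, map_mul,
        coeff_mul_neg_succ (IsApparent.vanishesBelow_neg hN (by omega) hr)
          (hD.vanishesBelow_operA12_one hU (by omega) hr hb), if_pos h4]
      have hlast : (expInf (D.laxL b 0 1)).coeff (-((rinf - 3 : ℕ) : ℤ)) = D.om b := by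
        rw [← hN.coeff_laxL_om D hrinf hr]
        congr 1
        omega
      rcases (by omega : k < rinf - 4 ∨ k = rinf - 4 ∨ rinf - 4 < k) with h | h | h
      · rw [if_neg (by omega), if_pos h, zero_add, show rinf - 3 - k = rinf - 4 - k + 1 by omega,
          Finset.sum_range_succ, show k + 1 + (rinf - 4 - k) = rinf - 3 by omega, hlast,
          show ((rinf - 4 - k : ℕ) : ℤ) + 1 = rinf - 3 - k by omega, add_comm]
        congr 1
        rw [← Finset.Ico_add_one_right_eq_Icc, Finset.sum_Ico_eq_sum_range]
        refine Finset.sum_congr (by congr 1; omega) fun j _ => ?_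
        rw [hq.QInf_eq, nuInf, mul_comm]
        congr 2
        push_cast
        ring
      · rw [if_pos h, if_neg (by omega), add_zero, show rinf - 3 - k = 1 by omega,
          Finset.sum_range_one, show k + 1 + 0 = rinf - 3 by omega, hlast, nuInf]
        norm_num
      · rw [if_neg (by omega), if_neg (by omega), show rinf - 3 - k = 0 by omega,
          Finset.sum_range_zero, add_zero]
  · obtain ⟨-, hreg, -⟩ := hD.expAt_bounds hr hb s (hq.coeff_lead_ne_zero hN s)
    rw [map_add, map_add, HahnSeries.coeff_add, HahnSeries.coeff_add,
      vanishesBelow_expAt_C_mul_X_pow _ _ _ _ (by omega),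
      vanishesBelow_expAt_sum _ _ _ _ (by omega), D.coeff_expAt_polarSum hpos _ _ hk, zero_add,
      zero_add, hN.laxA12_eq_mul hrinf hr, map_mul,
      coeff_mul_neg (D.vanishesBelow_expAt_laxL hpos s 0 1) hreg]
    split_ifs with h
    · refine Finset.sum_congr rfl fun j _ => ?_
      rw [hq.QX_eq, nuX, mul_comm]
    · rw [Finset.Icc_eq_empty (by omega), Finset.sum_empty]

/-- Coefficient of `1 / lam` at infinity of the upper right entry of the auxiliary matrix. -/
theorem IsIsomonodromic.coeff_laxA12_one (hU : IsOpen U) (hD : D.IsIsomonodromic U v)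
    (hrinf : 1 ≤ rinf) (hr : ∀ s, 1 ≤ r s) (hb : b ∈ U) (hq : D.IsApparent b q) :
    (expInf (D.laxL b 0 1) * expInf (D.operA12 b)).coeff 1 =
      ∑ s, ∑ k ∈ Finset.Icc 1 (r s), D.nuX b s (k - 1) * D.QX b s k q := by
  rw [← map_mul, ← (hD.normalized b hb).laxA12_eq_mul hrinf hr, hD.laxA12 hU hrinf hr hb hq,
    formA12_eq_sum, map_add, map_add, HahnSeries.coeff_add, HahnSeries.coeff_add,
    coeff_expInf_sum_of_pos _ _ one_pos, expInf_C_mul_X_pow,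
    HahnSeries.coeff_single_of_ne (by omega), D.coeff_expInf_polarSum_one hr, zero_add, zero_add]

/-- Coefficient of `1 / lam ^ 2` at infinity of the upper right entry of the auxiliary matrix. -/
theorem IsIsomonodromic.coeff_laxA12_two (hU : IsOpen U) (hD : D.IsIsomonodromic U v)
    (hrinf : 1 ≤ rinf) (hr : ∀ s, 1 ≤ r s) (hb : b ∈ U) (hq : D.IsApparent b q) :
    (expInf (D.laxL b 0 1) * expInf (D.operA12 b)).coeff 2 =
      ∑ s, (∑ k ∈ Finset.Icc 2 (r s), D.nuX b s (k - 2) * D.QX b s k q +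
        D.pos s b * ∑ k ∈ Finset.Icc 1 (r s), D.nuX b s (k - 1) * D.QX b s k q) := by
  rw [← map_mul, ← (hD.normalized b hb).laxA12_eq_mul hrinf hr, hD.laxA12 hU hrinf hr hb hq,
    formA12_eq_sum, map_add, map_add, HahnSeries.coeff_add, HahnSeries.coeff_add,
    coeff_expInf_sum_of_pos _ _ two_pos, expInf_C_mul_X_pow,
    HahnSeries.coeff_single_of_ne (by omega), D.coeff_expInf_polarSum_two hr, zero_add, zero_add]
  refine Finset.sum_congr rfl fun s _ => ?_
  congr 1
  split_ifs with h
  · rfl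
  · rw [Finset.Icc_eq_empty h, Finset.sum_empty]

theorem IsIsomonodromic.nuInf_two (hU : IsOpen U) (hD : D.IsIsomonodromic U v)
    (h2 : rinf = 2) (hr : ∀ s, 1 ≤ r s) (hb : b ∈ U) (hq : D.IsApparent b q) :
    ∑ s, ∑ k ∈ Finset.Icc 1 (r s), D.nuX b s (k - 1) * D.QX b s k q = D.om b * D.nuInf b 0 := by
  have hN := hD.normalized b hb
  rw [← hD.coeff_laxA12_one hU (by omega) hr hb hq,
    coeff_mul_lead (hN.vanishesBelow_laxL_offdiag D (by omega) hr (zero_ne_one' (Fin 2)))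
      ((hD.vanishesBelow_operA12 hU (by omega) hr hb).mono (le_min (by omega) zero_le_one))
      (by rw [h2]; norm_num), hN.coeff_laxL_om D (by omega) hr, nuInf]

theorem IsIsomonodromic.nuInf_one (hU : IsOpen U) (hD : D.IsIsomonodromic U v)
    (h1 : rinf = 1) (hr : ∀ s, 1 ≤ r s) (hb : b ∈ U) (hq : D.IsApparent b q) :
    D.om b * D.nuInf b (-1) =
        ∑ s, ∑ k ∈ Finset.Icc 1 (r s), D.nuX b s (k - 1) * D.QX b s k q ∧
      D.thirdMoment b (fun s k => D.QX b s k q) * D.nuInf b (-1) + D.om b * D.nuInf b 0 =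
        ∑ s, (∑ k ∈ Finset.Icc 2 (r s), D.nuX b s (k - 2) * D.QX b s k q +
          D.pos s b * ∑ k ∈ Finset.Icc 1 (r s), D.nuX b s (k - 1) * D.QX b s k q) := by
  have hN := hD.normalized b hb
  have hL := hN.vanishesBelow_laxL_offdiag D (by omega) hr (zero_ne_one' (Fin 2))
  have hM : VanishesBelow (-1) (expInf (D.operA12 b)) :=
    (hD.vanishesBelow_operA12 hU (by omega) hr hb).mono (le_min (by omega) (by norm_num))
  have hom := hN.coeff_laxL_om D (by omega) hr
  rw [← hD.coeff_laxA12_one hU (by omega) hr hb hq, ← hD.coeff_laxA12_two hU (by omega) hr hb hq,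
    coeff_mul_lead hL hM (by rw [h1]; norm_num),
    coeff_mul_lead_succ hL hM (by rw [h1]; norm_num), hom,
    show 3 - (rinf : ℤ) + 1 = 3 by rw [h1]; norm_num, hq.coeff_three hN h1 hr, nuInf, nuInf]
  exact ⟨rfl, add_comm _ _⟩

theorem IsIsomonodromic.nuInf_ge_three (hU : IsOpen U) (hD : D.IsIsomonodromic U v)
    (h3 : 3 ≤ rinf) (hr : ∀ s, 1 ≤ r s) (hb : b ∈ U) (hq : D.IsApparent b q) :
    D.om b * D.nuInf b ((rinf : ℤ) - 2) =
        ∑ s, ∑ k ∈ Finset.Icc 1 (r s), D.nuX b s (k - 1) * D.QX b s k q -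
          ∑ j ∈ Finset.Icc 1 (rinf - 3), D.nuInf b (j : ℤ) * D.QInf b (j - 1) q ∧
      D.om b * D.nuInf b ((rinf : ℤ) - 1) =
        ∑ s, ∑ k ∈ Finset.Icc 2 (r s), D.nuX b s (k - 2) * D.QX b s k q +
          ∑ s, ∑ k ∈ Finset.Icc 1 (r s), D.nuX b s (k - 1) * D.pos s b * D.QX b s k q -
          ∑ j ∈ Finset.Icc 2 (rinf - 2), D.nuInf b (j : ℤ) * D.QInf b (j - 2) q -
          D.nuInf b 1 * ∑ s, D.QX b s 1 q := by
  have hN := hD.normalized b hb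
  have hL := IsApparent.vanishesBelow_neg hN h3 hr
  have hM := hD.vanishesBelow_operA12_one hU h3 hr hb
  have hom : (expInf (D.laxL b 0 1)).coeff (-((rinf - 3 : ℕ) : ℤ)) = D.om b := by
    rw [← hN.coeff_laxL_om D (by omega) hr]
    congr 1
    omega
  have h1 := hD.coeff_laxA12_one hU (by omega) hr hb hq
  have h2 := hD.coeff_laxA12_two hU (by omega) hr hb hq
  rw [coeff_one_mul hL hM, Finset.sum_range_succ, hom] at h1
  rw [coeff_two_mul hL hM, Finset.sum_range_succ, hom, hq.coeff_one hN (by omega) hr] at h2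
  have hs1 : ∑ j ∈ Finset.Icc 1 (rinf - 3), D.nuInf b (j : ℤ) * D.QInf b (j - 1) q =
      ∑ j ∈ Finset.range (rinf - 3), (expInf (D.laxL b 0 1)).coeff (-(j : ℤ)) *
        (expInf (D.operA12 b)).coeff ((j : ℤ) + 1) := by
    rw [← Finset.Ico_add_one_right_eq_Icc, Finset.sum_Ico_eq_sum_range]
    refine Finset.sum_congr (by congr 1) fun j _ => ?_
    rw [hq.QInf_eq, nuInf, mul_comm, Nat.add_sub_cancel_left, Nat.cast_add, Nat.cast_one,
      add_comm (1 : ℤ)]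
  have hs2 : ∑ j ∈ Finset.Icc 2 (rinf - 2), D.nuInf b (j : ℤ) * D.QInf b (j - 2) q =
      ∑ j ∈ Finset.range (rinf - 3), (expInf (D.laxL b 0 1)).coeff (-(j : ℤ)) *
        (expInf (D.operA12 b)).coeff ((j : ℤ) + 2) := by
    rw [← Finset.Ico_add_one_right_eq_Icc, Finset.sum_Ico_eq_sum_range]
    refine Finset.sum_congr (by congr 1) fun j _ => ?_
    rw [hq.QInf_eq, nuInf, mul_comm, Nat.add_sub_cancel_left, Nat.cast_add, Nat.cast_two,
      add_comm (2 : ℤ)]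
  have hs3 : ∑ s, ∑ k ∈ Finset.Icc 1 (r s), D.nuX b s (k - 1) * D.pos s b * D.QX b s k q =
      ∑ s, D.pos s b * ∑ k ∈ Finset.Icc 1 (r s), D.nuX b s (k - 1) * D.QX b s k q := by
    simp_rw [Finset.mul_sum]
    refine Finset.sum_congr rfl fun s _ => Finset.sum_congr rfl fun k _ => ?_
    ring
  rw [Finset.sum_add_distrib] at h2
  rw [hs1, hs2, hs3, ← h1]
  refine ⟨?_, ?_⟩
  · rw [nuInf, show (rinf : ℤ) - 2 = ((rinf - 3 : ℕ) : ℤ) + 1 by omega]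
    ring
  · rw [nuInf, nuInf, show (rinf : ℤ) - 1 = ((rinf - 3 : ℕ) : ℤ) + 2 by omega]
    linear_combination h2

end Differential

end LaxFamily

namespace LaxFamily

variable {n rinf : ℕ} {r : Fin n → ℕ} {E : Type*} {D : LaxFamily n rinf r E}
  {b : E} {g : ℕ} {q : Fin g → ℂ}

/-! ### Squares of the irregular types -/

theorem coeff_irrX_sq (s : Fin n) {j : ℕ} (hj : r s < j) (hj' : j ≤ 2 * r s) :
    (D.irrX b s ^ 2).coeff (-(j : ℤ)) = D.sqCoeffX b s j := by
  have hX := D.vanishesBelow_irrX b s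
  rw [pow_two, coeff_mul_of_vanishesBelow hX hX, sqCoeffX]
  refine Finset.sum_nbij' (fun i => (i + r s).toNat) (fun m => (m : ℤ) - r s) ?_ ?_ ?_ ?_ ?_
  · intro i hi
    rw [Finset.mem_Icc] at hi
    rw [Finset.mem_range]
    omega
  · intro m hm
    rw [Finset.mem_range] at hm
    rw [Finset.mem_Icc]
    omega
  · intro i hi
    rw [Finset.mem_Icc] at hi
    omega
  · intro m _
    simp
  · intro i hi
    rw [Finset.mem_Icc] at hi
    obtain ⟨m, rfl⟩ : ∃ m : ℕ, i = (m : ℤ) - r s := ⟨(i + r s).toNat, by omega⟩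
    rw [show ((m : ℤ) - r s + r s).toNat = m by omega]
    have h1 := D.coeff_irrX b s (r s - 1 - m)
    have h2 := D.coeff_irrX b s (j + m - r s - 1)
    rw [if_pos (by omega)] at h1 h2
    rw [← h1, ← h2]
    congr 2 <;> omega

theorem coeff_irrInf_sq (h3 : 3 ≤ rinf) {j : ℕ} (hj : rinf - 3 ≤ j) (hj' : j ≤ 2 * rinf - 4) :
    (D.irrInf b ^ 2).coeff (-(j : ℤ)) = D.sqCoeffInf b j := by
  have hX := D.vanishesBelow_irrInf b
  rw [pow_two, coeff_mul_of_vanishesBelow hX hX, sqCoeffInf]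
  refine Finset.sum_nbij' (fun i => (i + rinf - 2).toNat) (fun m => (m : ℤ) + 2 - rinf)
    ?_ ?_ ?_ ?_ ?_
  · intro i hi
    rw [Finset.mem_Icc] at hi
    rw [Finset.mem_range]
    omega
  · intro m hm
    rw [Finset.mem_range] at hm
    rw [Finset.mem_Icc]
    omega
  · intro i hi
    rw [Finset.mem_Icc] at hi
    omega
  · intro m _
    simp
  · intro i hi
    rw [Finset.mem_Icc] at hi
    obtain ⟨m, rfl⟩ : ∃ m : ℕ, i = (m : ℤ) + 2 - rinf := ⟨(i + rinf - 2).toNat, by omega⟩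
    rw [show ((m : ℤ) + 2 - rinf + rinf - 2).toNat = m by omega]
    have h1 := D.coeff_irrInf b (rinf - 1 - m)
    have h2 := D.coeff_irrInf b (j + m + 3 - rinf)
    rw [if_pos (by omega)] at h1 h2
    rw [← neg_mul_neg (D.tInf _ b), ← h1, ← h2]
    congr 2 <;> omega

theorem vanishesBelow_irrX_sq (s : Fin n) :
    VanishesBelow (-((2 * r s : ℕ) : ℤ)) (D.irrX b s ^ 2) := by
  rw [pow_two]
  exact (D.vanishesBelow_irrX b s).mul' (D.vanishesBelow_irrX b s) (by push_cast; omega)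

theorem vanishesBelow_irrInf_sq (h3 : 3 ≤ rinf) :
    VanishesBelow (-((2 * rinf - 4 : ℕ) : ℤ)) (D.irrInf b ^ 2) := by
  rw [pow_two]
  exact (D.vanishesBelow_irrInf b).mul' (D.vanishesBelow_irrInf b) (by omega)

theorem coeff_expAt_sum_div (s : Fin n) (S : Finset ℕ) (c : ℕ → ℂ) (k : ℕ) :
    (expAt (D.pos s b) (∑ j ∈ S, RatFunc.C (c j) / D.lin b s ^ j)).coeff (-(k : ℤ)) =
      if k ∈ S then c k else 0 := by
  rw [map_sum, HahnSeries.coeff_sum]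
  have h : ∀ x ∈ S, (expAt (D.pos s b) (RatFunc.C (c x) / D.lin b s ^ x)).coeff (-(k : ℤ)) =
      if k = x then c k else 0 := by
    intro x _
    rw [lin, expAt_div_X_sub_C_pow_self]
    by_cases hx : k = x
    · subst hx
      rw [if_pos rfl, HahnSeries.coeff_single_same]
    · rw [if_neg hx, HahnSeries.coeff_single_of_ne (by omega)]
  rw [Finset.sum_congr rfl h, Finset.sum_ite_eq]

/-- The part of order beyond `r s` of the square of the irregular type times a power series. -/
theorem vanishesBelow_sum_sub_irrX_sq_mul (s : Fin n) {h : ℂ⸨X⸩} (hh : VanishesBelow 0 h) :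
    VanishesBelow (-(r s : ℤ)) (expAt (D.pos s b)
      (∑ k ∈ Finset.Icc (r s + 1) (2 * r s),
        RatFunc.C (∑ j ∈ Finset.Icc k (2 * r s), D.sqCoeffX b s j * h.coeff ((j - k : ℕ) : ℤ)) /
          D.lin b s ^ k) - D.irrX b s ^ 2 * h) := by
  intro i hi
  obtain ⟨k, rfl⟩ : ∃ k : ℕ, i = -(k : ℤ) := ⟨(-i).toNat, by omega⟩
  rw [HahnSeries.coeff_sub, coeff_expAt_sum_div, coeff_mul_neg (vanishesBelow_irrX_sq s) hh,
    sub_eq_zero]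
  split_ifs with hk
  · refine Finset.sum_congr rfl fun j hj => ?_
    rw [Finset.mem_Icc] at hj hk
    rw [coeff_irrX_sq s (by omega) hj.2]
  · rw [Finset.mem_Icc] at hk
    rw [Finset.Icc_eq_empty (by omega), Finset.sum_empty]

theorem vanishesBelow_sum_sub_irrX_sq (s : Fin n) :
    VanishesBelow (-(r s : ℤ)) (expAt (D.pos s b)
      (∑ j ∈ Finset.Icc (r s + 1) (2 * r s), RatFunc.C (D.sqCoeffX b s j) / D.lin b s ^ j) -
        D.irrX b s ^ 2) := by
  intro i hi
  obtain ⟨k, rfl⟩ : ∃ k : ℕ, i = -(k : ℤ) := ⟨(-i).toNat, by omega⟩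
  rw [HahnSeries.coeff_sub, coeff_expAt_sum_div, sub_eq_zero]
  split_ifs with hk
  · rw [Finset.mem_Icc] at hk
    rw [coeff_irrX_sq s (by omega) hk.2]
  · rw [Finset.mem_Icc] at hk
    exact (vanishesBelow_irrX_sq s _ (by omega)).symm

theorem vanishesBelow_sum_sub_irrInf_sq (h3 : 3 ≤ rinf) :
    VanishesBelow (4 - (rinf : ℤ)) (expInf (∑ j ∈ Finset.Icc (rinf - 3) (2 * rinf - 4),
      RatFunc.C (D.sqCoeffInf b j) * RatFunc.X ^ j) - D.irrInf b ^ 2) := by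
  intro i hi
  rcases lt_or_ge 0 i with h0 | h0
  · omega
  obtain ⟨k, rfl⟩ : ∃ k : ℕ, i = -(k : ℤ) := ⟨(-i).toNat, by omega⟩
  rw [HahnSeries.coeff_sub, coeff_expInf_sum, sub_eq_zero]
  split_ifs with hk
  · rw [Finset.mem_Icc] at hk
    rw [coeff_irrInf_sq h3 hk.1 hk.2]
  · rw [Finset.mem_Icc] at hk
    exact (vanishesBelow_irrInf_sq h3 _ (by omega)).symm

/-- The part of order beyond `rinf - 4` of the square of the irregular type at infinity times a
power series without constant term. -/
theorem vanishesBelow_sum_sub_irrInf_sq_mul (h3 : 3 ≤ rinf) {h : ℂ⸨X⸩} (hh : VanishesBelow 1 h) :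
    VanishesBelow (4 - (rinf : ℤ)) (expInf (∑ k ∈ Finset.Icc (rinf - 3) (2 * rinf - 5),
      RatFunc.C (∑ j ∈ Finset.Icc (k + 1) (2 * rinf - 4),
        D.sqCoeffInf b j * h.coeff ((j : ℤ) - k)) * RatFunc.X ^ k) - D.irrInf b ^ 2 * h) := by
  intro i hi
  rcases lt_or_ge 0 i with h0 | h0
  · omega
  obtain ⟨k, rfl⟩ : ∃ k : ℕ, i = -(k : ℤ) := ⟨(-i).toNat, by omega⟩
  rw [HahnSeries.coeff_sub, coeff_expInf_sum, coeff_mul_neg_succ (vanishesBelow_irrInf_sq h3) hh,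
    sub_eq_zero]
  split_ifs with hk
  · rw [← Finset.Ico_add_one_right_eq_Icc, Finset.sum_Ico_eq_sum_range]
    rw [Finset.mem_Icc] at hk
    refine Finset.sum_congr (by congr 1; omega) fun j hj => ?_
    rw [Finset.mem_range] at hj
    rw [coeff_irrInf_sq h3 (by omega) (by omega)]
    congr 2
    push_cast
    ring
  · rw [Finset.mem_Icc] at hk
    rw [show 2 * rinf - 4 - k = 0 by omega, Finset.sum_range_zero]

/-! ### Sums of singular parts -/

theorem sum_singAt_mem (f : Fin n → RatFunc ℂ) :
    ∑ s, singAt (D.pos s b) (f s) ∈ D.polarSpace b :=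
  Submodule.sum_mem _ fun s _ => partialFractions.singAt_mem (a := fun s => D.pos s b) s (f s)

theorem vanishesBelow_expInf_sum_singAt (f : Fin n → RatFunc ℂ) :
    VanishesBelow 1 (expInf (∑ s, singAt (D.pos s b) (f s))) := by
  rw [map_sum]
  exact .sum fun s _ => vanishesBelow_expInf_singAt _ _

theorem coeff_expAt_sum_singAt (hpos : Function.Injective fun s => D.pos s b)
    (f : Fin n → RatFunc ℂ) (s : Fin n) {k : ℕ} (hk : 1 ≤ k) :
    (expAt (D.pos s b) (∑ t, singAt (D.pos t b) (f t))).coeff (-(k : ℤ)) =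
      (expAt (D.pos s b) (f s)).coeff (-(k : ℤ)) := by
  rw [map_sum, HahnSeries.coeff_sum, Finset.sum_eq_single s]
  · exact expAt_singAt _ _ hk
  · intro t _ hts
    exact vanishesBelow_expAt_singAt (fun h => hts (hpos h).symm) _ _ (by omega)
  · simp

theorem formA11_eq_sum (dom : ℂ) (Rx : Fin n → ℕ → ℂ) (Ri : ℕ → ℂ)
    (nx : Fin n → ℕ → ℂ) (ni : ℤ → ℂ) (c : ℂ)
    (hc : c = 1 / (2 * D.om b) * dom - (if rinf = 2 then D.tInf 1 b * ni 0 else 0) +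
      (if rinf = 1 then (1 / 2 - D.tInf 0 b) * ni (-1) else 0)) :
    D.formA11 b dom Rx Ri nx ni = RatFunc.C c * RatFunc.X ^ 0 -
      ∑ j ∈ Finset.range (rinf - 2),
        RatFunc.C (D.tInf (rinf - 1) b * ni ((rinf : ℤ) - 2 - j)) * RatFunc.X ^ j -
      ∑ j ∈ Finset.range (rinf - 3),
        RatFunc.C (D.tInf (rinf - 2) b * ni ((rinf : ℤ) - 3 - j)) * RatFunc.X ^ j +
      ∑ j ∈ Finset.range (rinf - 4),
        RatFunc.C (∑ i ∈ Finset.Icc 1 (rinf - 4 - j), ni (i : ℤ) * Ri (j + i)) * RatFunc.X ^ j +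
      D.polarSum b (fun s j => ∑ i ∈ Finset.range (r s - j + 1), nx s i * Rx s (i + j)) := by
  rw [formA11, hc, pow_zero, mul_one, Finset.mul_sum, Finset.mul_sum]
  simp only [map_mul, mul_assoc]

section Differential

variable [NormedAddCommGroup E] [NormedSpace ℂ E] {U : Set E} {v : E → E}

/-! ### The upper left entry of the auxiliary matrix -/

/-- The polynomial part of the product of the upper left entry of the Lax matrix and the upper
right entry of the oper form. -/
theorem IsIsomonodromic.coeff_operA12_mul (hU : IsOpen U) (hD : D.IsIsomonodromic U v)
    (h3 : 3 ≤ rinf) (hr : ∀ s, 1 ≤ r s) (hb : b ∈ U)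
    {Rx : Fin n → ℕ → ℂ} {Ri : ℕ → ℂ} (hL : D.laxL b 0 0 = D.formL11 b Rx Ri) (k : ℕ) :
    (expInf (D.laxL b 0 0) * expInf (D.operA12 b)).coeff (-(k : ℤ)) =
      -(if k < rinf - 2 then D.tInf (rinf - 1) b * D.nuInf b ((rinf : ℤ) - 2 - k) else 0) -
      (if k < rinf - 3 then D.tInf (rinf - 2) b * D.nuInf b ((rinf : ℤ) - 3 - k) else 0) +
      if k < rinf - 4 then ∑ i ∈ Finset.Icc 1 (rinf - 4 - k), D.nuInf b (i : ℤ) * Ri (k + i)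
        else 0 := by
  have hreg : VanishesBelow (-((rinf - 2 : ℕ) : ℤ)) (expInf (D.laxL b 0 0)) :=
    (D.vanishesBelow_expInf_laxL (by omega) 0 0).mono (by omega)
  rw [coeff_mul_neg_succ hreg (hD.vanishesBelow_operA12_one hU h3 hr hb), hL]
  rcases (by omega : rinf - 2 ≤ k ∨ k = rinf - 3 ∨ k < rinf - 3) with h | h | h
  · rw [show rinf - 2 - k = 0 by omega, Finset.sum_range_zero, if_neg (by omega),
      if_neg (by omega), if_neg (by omega)]
    ring
  · rw [show rinf - 2 - k = 1 by omega, Finset.sum_range_one, if_pos (by omega),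
      if_neg (by omega), if_neg (by omega), coeff_expInf_formL11, if_neg (by omega),
      if_pos (by omega), if_neg (by omega), nuInf,
      show (rinf : ℤ) - 2 - k = ((0 : ℕ) : ℤ) + 1 by omega]
    ring
  · rw [show rinf - 2 - k = rinf - 4 - k + 1 + 1 by omega, Finset.sum_range_succ,
      Finset.sum_range_succ, if_pos (by omega), if_pos (by omega), coeff_expInf_formL11,
      coeff_expInf_formL11, if_neg (show ¬ k + 1 + (rinf - 4 - k + 1) < rinf - 3 by omega),
      if_pos (show k + 1 + (rinf - 4 - k + 1) + 2 = rinf by omega),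
      if_neg (show ¬ k + 1 + (rinf - 4 - k + 1) + 3 = rinf by omega),
      if_neg (show ¬ k + 1 + (rinf - 4 - k) < rinf - 3 by omega),
      if_neg (show ¬ k + 1 + (rinf - 4 - k) + 2 = rinf by omega),
      if_pos (show k + 1 + (rinf - 4 - k) + 3 = rinf by omega), nuInf, nuInf,
      show ((rinf - 4 - k + 1 : ℕ) : ℤ) + 1 = rinf - 2 - k by omega,
      show ((rinf - 4 - k : ℕ) : ℤ) + 1 = rinf - 3 - k by omega]
    have hsum : (if k < rinf - 4 then
          ∑ i ∈ Finset.Icc 1 (rinf - 4 - k), D.nuInf b (i : ℤ) * Ri (k + i) else 0) =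
        ∑ i ∈ Finset.range (rinf - 4 - k),
          (expInf (D.formL11 b Rx Ri)).coeff (-((k + 1 + i : ℕ) : ℤ)) *
            (expInf (D.operA12 b)).coeff ((i : ℤ) + 1) := by
      split_ifs with h4
      · rw [← Finset.Ico_add_one_right_eq_Icc, Finset.sum_Ico_eq_sum_range]
        refine Finset.sum_congr (by congr 1) fun i hi => ?_
        rw [Finset.mem_range] at hi
        rw [coeff_expInf_formL11, if_pos (by omega), if_neg (by omega), if_neg (by omega), nuInf,
          sub_zero, sub_zero, mul_comm, ← add_assoc, Nat.cast_add, Nat.cast_one,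
          add_comm (1 : ℤ)]
      · rw [show rinf - 4 - k = 0 by omega, Finset.sum_range_zero]
    rw [hsum]
    ring

/-- The upper left entry of the auxiliary matrix. -/
theorem IsIsomonodromic.laxA11 (hU : IsOpen U) (hD : D.IsIsomonodromic U v)
    (hrinf : 1 ≤ rinf) (hr : ∀ s, 1 ≤ r s) (hb : b ∈ U) (hq : D.IsApparent b q)
    {Rx : Fin n → ℕ → ℂ} {Ri : ℕ → ℂ} (hL : D.laxL b 0 0 = D.formL11 b Rx Ri) :
    D.laxA b 0 0 = D.formA11 b (dirDeriv v D.om b) Rx Ri (D.nuX b) (D.nuInf b) := by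
  have hN := hD.normalized b hb
  have hpos := hN.pos_injective
  -- the first summand contributes only its constant term at infinity
  have hsplit : D.laxA b 0 0 =
      (D.laxA b 0 0 - D.operA12 b * D.laxL b 0 0) + D.laxL b 0 0 * D.operA12 b := by ring
  obtain ⟨c, hc⟩ : ∃ c, c = 1 / (2 * D.om b) * dirDeriv v D.om b -
      (if rinf = 2 then D.tInf 1 b * D.nuInf b 0 else 0) +
      (if rinf = 1 then (1 / 2 - D.tInf 0 b) * D.nuInf b (-1) else 0) := ⟨_, rfl⟩
  rw [formA11_eq_sum _ _ _ _ _ c hc]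
  refine partialFractions.ext hpos (D.laxA_mem 0 0) (Submodule.add_mem _ (Submodule.add_mem _
    (Submodule.sub_mem _ (Submodule.sub_mem _ (partialFractions.C_mul_X_pow_mem _ _)
      (sum_mem_partialFractions _ _)) (sum_mem_partialFractions _ _))
      (sum_mem_partialFractions _ _)) (D.polarSum_mem _)) (fun k => ?_) fun s k hk => ?_
  · obtain ⟨hreg, h0⟩ := hD.expInf_C00 hU hrinf hr hb
    rw [hsplit]
    simp only [map_add, map_sub, HahnSeries.coeff_add, HahnSeries.coeff_sub, coeff_expInf_sum,
      coeff_expInf_C_mul_X_pow, Finset.mem_range]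
    rw [← HahnSeries.coeff_sub, ← map_sub, D.vanishesBelow_expInf_polarSum _ _ (by omega),
      add_zero, map_mul]
    have hC : (expInf (D.laxA b 0 0 - D.operA12 b * D.laxL b 0 0)).coeff (-(k : ℤ)) =
        if k = 0 then 1 / (2 * D.om b) * dirDeriv v D.om b +
          (if rinf = 1 then 1 / 2 * D.nuInf b (-1) else 0) else 0 := by
      split_ifs with hk h1
      · rw [hk, Nat.cast_zero, neg_zero, h0, if_pos h1]
      · rw [hk, Nat.cast_zero, neg_zero, h0, if_neg h1]
      · exact hreg _ (by omega)
    rw [hC, hc]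
    rcases (by omega : 3 ≤ rinf ∨ rinf = 2 ∨ rinf = 1) with h3 | h2 | h1
    · rw [hD.coeff_operA12_mul hU h3 hr hb hL, if_neg (show ¬ rinf = 1 by omega),
        if_neg (show ¬ rinf = 2 by omega), if_neg (show ¬ rinf = 1 by omega)]
      split_ifs <;> ring
    · have hM : VanishesBelow 0 (expInf (D.operA12 b)) :=
        (hD.vanishesBelow_operA12 hU hrinf hr hb).mono (le_min (by omega) zero_le_one)
      have hL0 : VanishesBelow 0 (expInf (D.laxL b 0 0)) :=
        (D.vanishesBelow_expInf_laxL hrinf 0 0).mono (by omega)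
      rw [if_neg (show ¬ rinf = 1 by omega),
        if_pos h2, if_neg (show ¬ rinf = 1 by omega), if_neg (show ¬ k < rinf - 2 by omega),
        if_neg (show ¬ k < rinf - 3 by omega), if_neg (show ¬ k < rinf - 4 by omega)]
      by_cases hk : k = 0
      · have hlead := hN.coeff_lead D hrinf hr 0 0
        rw [if_pos hk, if_pos hk, hk, Nat.cast_zero, neg_zero,
          coeff_mul_lead hL0 hM (by norm_num), nuInf]
        rw [show (2 : ℤ) - rinf = 0 by omega, show rinf - 1 = 1 by omega] at hlead
        rw [hlead]
        simp only [Matrix.diagonal_apply_eq, Matrix.cons_val_zero]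
        ring
      · rw [if_neg hk, if_neg hk, hL0.mul_zero_zero hM _ (by omega)]
        ring
    · have hM : VanishesBelow (-1) (expInf (D.operA12 b)) :=
        (hD.vanishesBelow_operA12 hU hrinf hr hb).mono (le_min (by omega) (by norm_num))
      have hL0 : VanishesBelow 1 (expInf (D.laxL b 0 0)) :=
        (D.vanishesBelow_expInf_laxL hrinf 0 0).mono (by omega)
      rw [if_pos h1, if_neg (show ¬ rinf = 2 by omega),
        if_pos h1, if_neg (show ¬ k < rinf - 2 by omega),
        if_neg (show ¬ k < rinf - 3 by omega), if_neg (show ¬ k < rinf - 4 by omega)]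
      by_cases hk : k = 0
      · have hlead := hN.coeff_lead D hrinf hr 0 0
        rw [if_pos hk, if_pos hk, hk, Nat.cast_zero, neg_zero,
          coeff_mul_lead hL0 hM (by norm_num), nuInf]
        rw [show (2 : ℤ) - rinf = 1 by omega, show rinf - 1 = 0 by omega] at hlead
        rw [hlead]
        simp only [Matrix.diagonal_apply_eq, Matrix.cons_val_zero]
        ring
      · rw [if_neg hk, if_neg hk, hL0.mul hM _ (by omega)]
        ring
  · obtain ⟨-, hreg, -, -, hC, -⟩ := hD.expAt_bounds hr hb s (hq.coeff_lead_ne_zero hN s)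
    rw [hsplit]
    simp only [map_add, map_sub, HahnSeries.coeff_add, HahnSeries.coeff_sub,
      vanishesBelow_expAt_sum _ _ _ _ (show -(k : ℤ) < 0 by omega),
      vanishesBelow_expAt_C_mul_X_pow _ _ _ _ (show -(k : ℤ) < 0 by omega)]
    rw [← HahnSeries.coeff_sub, ← map_sub, hC _ (by omega), D.coeff_expAt_polarSum hpos _ _ hk,
      map_mul, coeff_mul_neg (D.vanishesBelow_expAt_laxL hpos s 0 0) hreg]
    simp only [zero_add, sub_zero]
    split_ifs with h
    · rw [← Finset.Ico_add_one_right_eq_Icc, Finset.sum_Ico_eq_sum_range,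
        show r s + 1 - k = r s - k + 1 by omega]
      refine Finset.sum_congr rfl fun i hi => ?_
      rw [Finset.mem_range] at hi
      rw [hL, coeff_expAt_formL11 hN _ _ _ (by omega), if_pos (by omega), nuX,
        Nat.add_sub_cancel_left, mul_comm, add_comm k i]
    · rw [Finset.Icc_eq_empty (by omega), Finset.sum_empty]

end Differential

end LaxFamily

namespace LaxFamily

variable {n rinf : ℕ} {r : Fin n → ℕ} {E : Type*} {D : LaxFamily n rinf r E}
  {b : E} {g : ℕ} {q : Fin g → ℂ}

/-! ### The lower left entries -/

theorem IsApparent.vanishesBelow_expAt_div (hq : D.IsApparent b q) (hN : D.IsNormalized b)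
    (s : Fin n) {f : RatFunc ℂ} (hf : VanishesBelow (-(r s : ℤ)) (expAt (D.pos s b) f)) :
    VanishesBelow 0 (expAt (D.pos s b) (f / D.laxL b 0 1)) := by
  rw [map_div₀]
  exact hf.div' (hq.coeff_lead_ne_zero hN s) (by omega)

theorem IsNormalized.vanishesBelow_expInf_div (hN : D.IsNormalized b) (hrinf : 1 ≤ rinf)
    (hr : ∀ s, 1 ≤ r s) {f : RatFunc ℂ} {m : ℤ} (hf : VanishesBelow (m + 3 - rinf) (expInf f)) :
    VanishesBelow m (expInf (f / D.laxL b 0 1)) := by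
  have hc : (expInf (D.laxL b 0 1)).coeff (3 - (rinf : ℤ)) ≠ 0 := by
    rw [hN.coeff_laxL_om D hrinf hr]
    exact hN.om_ne_zero
  rw [map_div₀]
  exact hf.div' hc (by omega)

/-- The identity expressing the lower left entry of the auxiliary matrix through the determinant of
the Lax matrix and the entries of the oper gauge. -/
theorem IsNormalized.laxA21_sub (hN : D.IsNormalized b) (hrinf : 1 ≤ rinf) (hr : ∀ s, 1 ≤ r s)
    (K : RatFunc ℂ) :
    D.laxA b 1 0 - (K / D.laxL b 0 1 + D.laxL b 0 0 / D.laxL b 0 1 *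
        (D.laxL b 0 0 / D.laxL b 0 1 * D.laxA b 0 1 - 2 * D.laxA b 0 0)) =
      (D.laxA b 1 0 - D.operA12 b * D.laxL b 1 0) -
        (K - (D.laxL b 0 0 ^ 2 + D.laxL b 0 1 * D.laxL b 1 0) * D.operA12 b) / D.laxL b 0 1 +
        2 * (D.laxL b 0 0 / D.laxL b 0 1 *
          (D.laxA b 0 0 - D.operA12 b * D.laxL b 0 0)) := by
  have hne := hN.laxL12_ne_zero hrinf hr
  rw [hN.laxA12_eq_mul hrinf hr]
  field_simp
  ring

section Differential

variable [NormedAddCommGroup E] [NormedSpace ℂ E] {U : Set E} {v : E → E}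

/-- The lower left entry of the Lax matrix. -/
theorem IsIsomonodromic.laxL21 (hU : IsOpen U) (hD : D.IsIsomonodromic U v)
    (hrinf : 1 ≤ rinf) (hr : ∀ s, 1 ≤ r s) (hb : b ∈ U) (hq : D.IsApparent b q)
    {Qx Rx : Fin n → ℕ → ℂ} {Qi Ri : ℕ → ℂ} (hQ : D.laxL b 0 1 = D.formL12 b Qx Qi)
    (hL : D.laxL b 0 0 = D.formL11 b Rx Ri) :
    D.laxL b 1 0 = D.formL21 b Qx Rx Qi Ri := by
  have hN := hD.normalized b hb
  have hpos := hN.pos_injective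
  have hne := hN.laxL12_ne_zero hrinf hr
  have hid : ∀ K : RatFunc ℂ, (K - D.laxL b 0 0 ^ 2) / D.laxL b 0 1 - D.laxL b 1 0 =
      (K - (D.laxL b 0 0 ^ 2 + D.laxL b 0 1 * D.laxL b 1 0)) / D.laxL b 0 1 := by
    intro K
    field_simp
    ring
  rw [formL21, formL21Finite, ← hQ, ← hL]
  refine partialFractions.ext hpos (D.laxL_mem 1 0) (Submodule.add_mem _ ?_ (sum_singAt_mem _))
    (fun k => ?_) fun s k hk => ?_
  · split_ifs
    · exact partialFractions.polyInf_mem _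
    · exact Submodule.zero_mem _
  · rw [map_add, HahnSeries.coeff_add, vanishesBelow_expInf_sum_singAt _ _ (by omega), add_zero]
    split_ifs with h3
    · obtain ⟨hsq, -⟩ := hD.expInf_bounds hU hrinf hr hb
      rw [expInf_polyInf]
      refine (coeff_eq_of_sub (m := 1) ?_ (by omega)).symm
      rw [← map_sub, hid]
      refine hN.vanishesBelow_expInf_div hrinf hr ?_
      rw [map_sub, ← sub_sub_sub_cancel_right _ _ (D.irrInf b ^ 2)]
      exact ((vanishesBelow_sum_sub_irrInf_sq h3).sub hsq).mono (by omega)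
    · rw [map_zero, HahnSeries.coeff_zero]
      exact hN.vanishesBelow_laxL_offdiag D hrinf hr one_ne_zero _ (by omega)
  · obtain ⟨hsq, -⟩ := hD.expAt_bounds hr hb s (hq.coeff_lead_ne_zero hN s)
    rw [map_add, HahnSeries.coeff_add, coeff_expAt_sum_singAt hpos _ _ hk]
    have h0 : VanishesBelow 0 (expAt (D.pos s b) (if 3 ≤ rinf then polyInf
      ((∑ j ∈ Finset.Icc (rinf - 3) (2 * rinf - 4),
          RatFunc.C (D.sqCoeffInf b j) * RatFunc.X ^ j - D.laxL b 0 0 ^ 2) / D.laxL b 0 1)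
        else 0)) := by
      split_ifs
      · exact vanishesBelow_expAt_polyInf _ _
      · rw [map_zero]
        exact .zero _
    rw [h0 _ (by omega), zero_add]
    refine (coeff_eq_of_sub (m := 0) ?_ (by omega)).symm
    rw [← map_sub, hid]
    refine hq.vanishesBelow_expAt_div hN s ?_
    rw [map_sub, ← sub_sub_sub_cancel_right _ _ (D.irrX b s ^ 2)]
    exact (vanishesBelow_sum_sub_irrX_sq s).sub hsq

/-- The two leading coefficients at infinity of the ratio of the entries of the first row of the
Lax matrix. -/
theorem IsIsomonodromic.coeff_ratio (hU : IsOpen U) (hD : D.IsIsomonodromic U v)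
    (h3 : 3 ≤ rinf) (hr : ∀ s, 1 ≤ r s) (hb : b ∈ U) :
    VanishesBelow (-1) (expInf (D.laxL b 0 0 / D.laxL b 0 1)) ∧
      (expInf (D.laxL b 0 0 / D.laxL b 0 1)).coeff (-1) = -(1 / D.om b) ∧
      (expInf (D.laxL b 0 0 / D.laxL b 0 1)).coeff 0 =
        1 / D.om b ^ 2 * (expInf (D.laxL b 0 1)).coeff (4 - (rinf : ℤ)) := by
  have hN := hD.normalized b hb
  have hom := hN.om_ne_zero
  have hL := hN.vanishesBelow_laxL_offdiag D (by omega) hr (zero_ne_one' (Fin 2))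
  have h11 := D.vanishesBelow_expInf_laxL (b := b) (by omega : 1 ≤ rinf) 0 0
  have hreg := hN.vanishesBelow_expInf_div (m := -1) (by omega) hr (h11.mono (by omega))
  have hlead := hN.coeff_lead D (by omega) hr 0 0
  have hnext := hD.coeff_laxL00_next hU hr hb (by omega)
  obtain ⟨ht, ht'⟩ := (hD.trivialTimes b hb).ge_three h3
  have hmul : expInf (D.laxL b 0 0) =
      expInf (D.laxL b 0 0 / D.laxL b 0 1) * expInf (D.laxL b 0 1) := by
    rw [← map_mul, div_mul_cancel₀ _ (hN.laxL12_ne_zero (by omega) hr)]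
  rw [hmul, coeff_mul_lead hreg hL (by ring), hN.coeff_laxL_om D (by omega) hr,
    Matrix.diagonal_apply_eq, ht] at hlead
  simp only [Matrix.cons_val_zero] at hlead
  rw [hmul, coeff_mul_lead_succ hreg hL (by ring), hN.coeff_laxL_om D (by omega) hr, ht',
    show 3 - (rinf : ℤ) + 1 = 4 - rinf by ring, show (-1 : ℤ) + 1 = 0 by norm_num] at hnext
  have h1 : (expInf (D.laxL b 0 0 / D.laxL b 0 1)).coeff (-1) = -(1 / D.om b) := by
    field_simp
    exact hlead
  refine ⟨hreg, h1, ?_⟩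
  rw [h1] at hnext
  field_simp
  field_simp at hnext
  linear_combination hnext

/-- The lower left entry of the auxiliary matrix. -/
theorem IsIsomonodromic.laxA21 (hU : IsOpen U) (hD : D.IsIsomonodromic U v)
    (hrinf : 1 ≤ rinf) (hr : ∀ s, 1 ≤ r s) (hb : b ∈ U) (hq : D.IsApparent b q)
    {Rx : Fin n → ℕ → ℂ} {Ri : ℕ → ℂ} (hL : D.laxL b 0 0 = D.formL11 b Rx Ri) :
    D.laxA b 1 0 = D.formA21 b (dirDeriv v D.om b) (fun s k => D.QX b s k q) Rx
      (fun k => D.QInf b k q) Ri (D.nuX b) (D.nuInf b) := by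
  have hN := hD.normalized b hb
  have hom := hN.om_ne_zero
  have hpos := hN.pos_injective
  rw [formA21, formA21Finite, formW, ← hD.laxA11 hU hrinf hr hb hq hL,
    ← hD.laxA12 hU hrinf hr hb hq, ← hq.laxL12 hN hrinf hr, ← hL]
  obtain ⟨K, hK⟩ : ∃ K : RatFunc ℂ, K = ∑ k ∈ Finset.Icc (rinf - 3) (2 * rinf - 5),
    RatFunc.C (∑ j ∈ Finset.Icc (k + 1) (2 * rinf - 4),
      D.sqCoeffInf b j * D.nuInf b ((j : ℤ) - k)) * RatFunc.X ^ k := ⟨_, rfl⟩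
  obtain ⟨W, hW⟩ : ∃ W, W = D.laxL b 0 0 / D.laxL b 0 1 *
    (D.laxL b 0 0 / D.laxL b 0 1 * D.laxA b 0 1 - 2 * D.laxA b 0 0) := ⟨_, rfl⟩
  obtain ⟨x, hx⟩ : ∃ x, x = D.tInf (rinf - 1) b / D.om b ^ 2 * dirDeriv v D.om b := ⟨_, rfl⟩
  obtain ⟨y, hy⟩ : ∃ y, y = 2 / D.om b * resInf (D.laxA b 0 0 -
    D.laxL b 0 0 / D.laxL b 0 1 * D.laxA b 0 1) + 1 / D.om b ^ 3 *
      (if rinf = 3 then ∑ s, D.QX b s 1 q else D.QInf b (rinf - 4) q) * dirDeriv v D.om b :=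
    ⟨_, rfl⟩
  rw [← hK, ← hW, ← hx, ← hy, ← pow_one (RatFunc.X : RatFunc ℂ), ← mul_one (RatFunc.C y),
    ← pow_zero (RatFunc.X : RatFunc ℂ)]
  refine partialFractions.ext hpos (D.laxA_mem 1 0) (Submodule.add_mem _ ?_
    (Submodule.add_mem _ (sum_singAt_mem _) (sum_singAt_mem _)))
    (fun k => ?_) fun s k hk => ?_
  · split_ifs
    · exact Submodule.add_mem _ (Submodule.add_mem _ (Submodule.add_mem _ (Submodule.neg_mem _
        (partialFractions.C_mul_X_pow_mem _ _)) (partialFractions.C_mul_X_pow_mem _ _))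
        (partialFractions.polyInf_mem _)) (partialFractions.polyInf_mem _)
    · exact Submodule.zero_mem _
  · obtain ⟨hsq, -, -, h10, hC10, -⟩ := hD.expInf_bounds hU hrinf hr hb
    rw [map_add, map_add expInf (∑ s, _), HahnSeries.coeff_add, HahnSeries.coeff_add,
      vanishesBelow_expInf_sum_singAt _ _ (by omega),
      vanishesBelow_expInf_sum_singAt _ _ (by omega), add_zero, add_zero]
    split_ifs with h3
    · have hM := hD.vanishesBelow_operA12_one hU h3 hr hb
      obtain ⟨hH, hH1, hH0⟩ := hD.coeff_ratio hU h3 hr hb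
      obtain ⟨hC, hC0⟩ := hD.expInf_C00 hU hrinf hr hb
      rw [if_neg (show ¬ rinf = 1 by omega), add_zero] at hC0
      have hKV : VanishesBelow (4 - (rinf : ℤ)) (expInf K - D.irrInf b ^ 2 *
          expInf (D.operA12 b)) := by
        rw [hK]
        exact vanishesBelow_sum_sub_irrInf_sq_mul h3 hM
      have hdiv : VanishesBelow 1 (expInf ((K - (D.laxL b 0 0 ^ 2 +
          D.laxL b 0 1 * D.laxL b 1 0) * D.operA12 b) / D.laxL b 0 1)) := by
        refine hN.vanishesBelow_expInf_div hrinf hr ?_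
        rw [map_sub, map_mul, ← sub_sub_sub_cancel_right _ _ (D.irrInf b ^ 2 *
          expInf (D.operA12 b)), ← sub_mul]
        exact (hKV.sub (hsq.mul' hM (by omega))).mono (by omega)
      -- modulo `O(1 / lam)` there remains `2 (L11 / L12) (A11 - N L11)`: its coefficients of `lam`
      -- and `1` give the terms in the derivative of `om` and in the residue
      have hmain := congrArg (fun f => (expInf f).coeff (-(k : ℤ)))
        (hN.laxA21_sub hrinf hr K)
      rw [← hW] at hmain
      simp only [map_add, map_sub expInf (D.laxA b 1 0) (_ + _), HahnSeries.coeff_add,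
        HahnSeries.coeff_sub] at hmain
      rw [map_sub expInf (_ - _), HahnSeries.coeff_sub, hC10 h3 _ (by omega),
        hdiv _ (by omega), two_mul, map_add, HahnSeries.coeff_add, map_mul] at hmain
      simp only [map_add, map_neg, HahnSeries.coeff_add, HahnSeries.coeff_neg,
        coeff_expInf_C_mul_X_pow, expInf_polyInf]
      have hres : resInf (D.laxA b 0 0 - D.laxL b 0 0 / D.laxL b 0 1 * D.laxA b 0 1) =
          -(expInf (D.laxA b 0 0 - D.operA12 b * D.laxL b 0 0)).coeff 1 := by
        rw [resInf, hN.laxA12_eq_mul hrinf hr, ← mul_assoc,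
          div_mul_cancel₀ _ (hN.laxL12_ne_zero hrinf hr), mul_comm (D.laxL b 0 0)]
      have hQ : (if rinf = 3 then ∑ s, D.QX b s 1 q else D.QInf b (rinf - 4) q) =
          (expInf (D.laxL b 0 1)).coeff (4 - (rinf : ℤ)) := by
        split_ifs with h
        · rw [← hq.coeff_one hN hrinf hr]
          congr 1
          omega
        · rw [hq.QInf_eq]
          congr 1
          omega
      rw [hQ, hres] at hy
      rw [((hD.trivialTimes b hb).ge_three h3).1] at hx
      rcases (by omega : k = 0 ∨ k = 1 ∨ 2 ≤ k) with rfl | rfl | h2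
      · rw [if_neg zero_ne_one, if_pos rfl, hy]
        rw [coeff_mul_lead_succ hH hC (by norm_num), hH1, hC0,
          show (-1 : ℤ) + 1 = 0 by norm_num, hH0, zero_add (1 : ℤ)] at hmain
        linear_combination hmain
      · rw [if_pos rfl, if_neg one_ne_zero, hx]
        rw [coeff_mul_lead hH hC (by norm_num), hH1, hC0] at hmain
        linear_combination hmain
      · rw [if_neg (show ¬ k = 1 by omega), if_neg (show ¬ k = 0 by omega)]
        rw [hH.mul hC _ (by omega)] at hmain
        linear_combination hmain
    · rw [map_zero, HahnSeries.coeff_zero]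
      exact h10 _ (lt_min (by omega) (by omega))
  · obtain ⟨hsq, hM, -, -, hC, hC10⟩ := hD.expAt_bounds hr hb s (hq.coeff_lead_ne_zero hN s)
    rw [map_add, map_add (expAt _) (∑ s, _), HahnSeries.coeff_add, HahnSeries.coeff_add,
      coeff_expAt_sum_singAt hpos _ _ hk, coeff_expAt_sum_singAt hpos _ _ hk]
    have h0 : VanishesBelow 0 (expAt (D.pos s b) (if 3 ≤ rinf then
        -(RatFunc.C x * RatFunc.X ^ 1) + RatFunc.C y * RatFunc.X ^ 0 +
          polyInf (K / D.laxL b 0 1) + polyInf W else 0)) := by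
      split_ifs
      · rw [map_add, map_add, map_add, map_neg]
        exact (((vanishesBelow_expAt_C_mul_X_pow _ _ _).neg.add
          (vanishesBelow_expAt_C_mul_X_pow _ _ _)).add
          (vanishesBelow_expAt_polyInf _ _)).add (vanishesBelow_expAt_polyInf _ _)
      · rw [map_zero]
        exact .zero _
    rw [h0 _ (by omega), zero_add, ← HahnSeries.coeff_add, ← map_add]
    refine coeff_eq_of_sub (m := 0) ?_ (by omega)
    rw [← map_sub, hW, hN.laxA21_sub hrinf hr, map_add, map_sub]
    refine (hC10.sub (hq.vanishesBelow_expAt_div hN s ?_)).add ?_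
    · rw [map_sub, map_mul, ← sub_sub_sub_cancel_right _ _ (D.irrX b s ^ 2 *
          expAt (D.pos s b) (D.operA12 b)), ← sub_mul]
      exact (vanishesBelow_sum_sub_irrX_sq_mul s hM).sub (hsq.mul' hM (by omega))
    · rw [two_mul, map_add, map_mul]
      have := (hq.vanishesBelow_expAt_div hN s
        (D.vanishesBelow_expAt_laxL hpos s 0 0)).mul_zero_zero hC
      exact this.add this

end Differential

end LaxFamily

end GeoLax

end

theorem theorem4p3 {n rinf g : ℕ} {r : Fin n → ℕ} (hrinf : 1 ≤ rinf) (hr : ∀ s, 1 ≤ r s)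
    (hg : g + 3 = rinf + ∑ s, r s)
    {E : Type*} [NormedAddCommGroup E] [NormedSpace ℂ E]
    (D : GeoLax.LaxFamily n rinf r E) {U : Set E} (hU : IsOpen U) (v : E → E)
    (hD : D.IsIsomonodromic U v) {b : E} (hb : b ∈ U)
    (q : Fin g → ℂ) (hq : D.IsApparent b q)
    (PX : Fin n → ℕ → ℂ) (PInf : ℕ → ℂ) (hP : D.IsConjugate b q PX PInf)
    -- the geometric Lax coordinates, the coefficients `ν`, and `𝓛_α[om]`
    (Qx : Fin n → ℕ → ℂ) (hQx : Qx = fun s k => D.QX b s k q)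
    (Qi : ℕ → ℂ) (hQi : Qi = fun k => D.QInf b k q)
    (Rx : Fin n → ℕ → ℂ) (hRx : Rx = D.RX b q PX)
    (Ri : ℕ → ℂ) (hRi : Ri = D.RInf b q PInf)
    (nx : Fin n → ℕ → ℂ) (hnx : nx = D.nuX b)
    (ni : ℤ → ℂ) (hni : ni = D.nuInf b)
    (dom : ℂ) (hdom : dom = GeoLax.dirDeriv v D.om b) :
    -- the Lax matrix
    D.laxL b = !![D.formL11 b Rx Ri, D.formL12 b Qx Qi;
      D.formL21 b Qx Rx Qi Ri, -D.formL11 b Rx Ri] ∧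
    -- the value of `g_0`
    (rinf = 1 → D.g0 b q =
      -∑ s, (D.pos s b * Rx s 1 + if 2 ≤ r s then Rx s 2 else 0) -
        D.tInf 0 b / D.om b * D.thirdMoment b Qx) ∧
    -- the auxiliary matrix
    D.laxA b = !![D.formA11 b dom Rx Ri nx ni, D.formA12 b Qx Qi nx ni;
      D.formA21 b dom Qx Rx Qi Ri nx ni, -D.formA11 b dom Rx Ri nx ni] ∧
    -- the coefficients `ν` in terms of the deformation vector
    (∀ s, nx s 0 = -D.alphaPos v b s) ∧
    (∀ s, (D.matMX b s).mulVec (fun i : Fin (r s - 1) => nx s ((i : ℕ) + 1)) =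
      fun i : Fin (r s - 1) => -(D.alphaX v b s (r s - 1 - (i : ℕ)) / ((r s - 1 - (i : ℕ) : ℕ) : ℂ))) ∧
    (D.matMInf b).mulVec (fun i : Fin (rinf - 3) => ni (((i : ℕ) : ℤ) + 1)) =
      (fun i : Fin (rinf - 3) => D.alphaInf v b (rinf - 3 - (i : ℕ)) / ((rinf - 3 - (i : ℕ) : ℕ) : ℂ)) ∧
    -- extra conditions for `rinf ≤ 2`
    (rinf = 2 → ∑ s, ∑ k ∈ Finset.Icc 1 (r s), nx s (k - 1) * Qx s k = D.om b * ni 0) ∧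
    (rinf = 1 →
      D.om b * ni (-1) = ∑ s, ∑ k ∈ Finset.Icc 1 (r s), nx s (k - 1) * Qx s k ∧
      D.thirdMoment b Qx * ni (-1) + D.om b * ni 0 =
        ∑ s, (∑ k ∈ Finset.Icc 2 (r s), nx s (k - 2) * Qx s k +
          D.pos s b * ∑ k ∈ Finset.Icc 1 (r s), nx s (k - 1) * Qx s k)) ∧
    -- the next two coefficients at infinity for `3 ≤ rinf`
    (3 ≤ rinf →
      D.om b * ni ((rinf : ℤ) - 2) =
        ∑ s, ∑ k ∈ Finset.Icc 1 (r s), nx s (k - 1) * Qx s k -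
          ∑ j ∈ Finset.Icc 1 (rinf - 3), ni (j : ℤ) * Qi (j - 1) ∧
      D.om b * ni ((rinf : ℤ) - 1) =
        ∑ s, ∑ k ∈ Finset.Icc 2 (r s), nx s (k - 2) * Qx s k +
          ∑ s, ∑ k ∈ Finset.Icc 1 (r s), nx s (k - 1) * D.pos s b * Qx s k -
          ∑ j ∈ Finset.Icc 2 (rinf - 2), ni (j : ℤ) * Qi (j - 2) -
          ni 1 * ∑ s, Qx s 1) := by
  have hN := hD.normalized b hb
  have hL11 := hD.laxL11 hU hrinf hr hg hb hq hP
  have hL12 := hq.laxL12 hN hrinf hr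
  subst hQx hQi hRx hRi hnx hni hdom
  refine ⟨?_, fun h1 => hq.g0_eq hN h1 hr hg hL11, ?_, fun s => ?_,
    fun s => hD.matMX_mulVec hr hb hq s, hD.matMInf_mulVec hU hrinf hr hb,
    fun h2 => hD.nuInf_two hU h2 hr hb hq, fun h1 => hD.nuInf_one hU h1 hr hb hq,
    fun h3 => hD.nuInf_ge_three hU h3 hr hb hq⟩
  · rw [← hL11, ← hL12, ← hD.laxL21 hU hrinf hr hb hq hL12 hL11, ← hN.trace_laxL D]
    exact Matrix.eta_fin_two _
  · rw [← hD.laxA11 hU hrinf hr hb hq hL11, ← hD.laxA12 hU hrinf hr hb hq,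
      ← hD.laxA21 hU hrinf hr hb hq hL11, ← hD.trace_laxA hU hrinf hr hb]
    exact Matrix.eta_fin_two _
  · exact (hD.expAt_bounds hr hb s (hq.coeff_lead_ne_zero hN s)).2.2.1
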